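/- Write $e(t)=e^{2\pi i t}$, let $[t]$ be the largest integer $\le t$, and let $\mathbb{N}=\{1,2,3,\dots\}$. For real $y,s>0$ let $\phi_{y,s}(u)=\dfrac{y u^{1-s}}{1-s}$ if $s\ne 1$ and $\phi_{y,1}(u)=y\log u$ ($u>0$). For real $N,y,s,\varepsilon>0$ and $P\in\mathbb{N}$, let $\mathscr{F}(N,P,y,s,\varepsilon)$ be the set of functions $f\colon[a,b]\to\mathbb{R}$ (with $a<b$) such that $[a,b]\subset[N,2N]$, $f$ is $P$ times continuously differentiable on $[a,b]$, and $|f^{(p)}(u)-\phi_{y,s}^{(p)}(u)|\le\varepsilon\,|\phi_{y,s}^{(p)}(u)|$ for all integers $1\le p\le P$ and all $u\in[a,b]$. A pair of real numbers $(k,\ell)$ with $0\le k\le\frac12\le\ell\le1$ is called an exponent pair if for every real $s>0$ there are $P\in\mathbb{N}$, $\varepsilon>0$ and a constant $C_0$, depending only on $k,\ell,s$, such that for all real $N,y>0$ and all $f\in\mathscr{F}(N,P,y,s,\varepsilon)$ defined on $[a,b]$, $$\Bigl|\sum_{a<n\le b}e(f(n))\Bigr|\le C_0\bigl(L^kN^\ell+L^{-1}\bigr),\qquad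 L=yN^{-s}.$$ For real $x\ge1$, $a\in\mathbb{Z}$ and $q\in\mathbb{N}$, let $\mathscr{S}(x)=\{[x/n] : n\in[1,x]\cap\mathbb{Z}\}$ and $$S(x,q,a)=\#\{n\in\mathbb{N} : n\le x,\ [x/n]\equiv a \pmod q\},\qquad S^{*}(x,q,a)=\#\{m\in\mathscr{S}(x) : m\equiv a \pmod q\}.$$ **Theorem 1.1.** Let $(k,\ell)$ be an exponent pair. Then for all real $x\ge1$, all $a\in\mathbb{Z}$ and all $q\in\mathbb{N}$, $$S(x,q,a)=x\sum_{\substack{n=1\\ n\equiv a\ (\mathrm{mod}\ q)}}^{\infty}\frac{1}{n(n+1)}+O\Bigl(\Bigl(\frac{x}{q}\Bigr)^{\frac{k+\ell}{2k+2}}+1\Bigr),$$ $$S^{*}(x,q,a)=\frac{2\sqrt{x}}{q}+O\Bigl(\Bigl(\frac{x}{q}\Bigr)^{\frac{k+\ell}{2k+2}}+1\Bigr),$$ where the implicit constants depend only on $(k,\ell)$ (in particular they do not depend on $x$, $a$, $q$). -/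

import Mathlib

namespace FloorQuotient

noncomputable section

/-- The additive character `e(t) = exp(2πit)`. -/
def e (t : ℝ) : ℂ := Complex.exp (2 * Real.pi * Complex.I * t)

/-- The model phase function of amplitude `y` and index `s` (used at positive arguments). -/
def modelPhase (y s : ℝ) (u : ℝ) : ℝ :=
  if s = 1 then y * Real.log u else y * u ^ (1 - s) / (1 - s)

/-- `f`, restricted to the interval `[a, b]`, is an admissible phase function of scale `N`,
order `P`, amplitude `y`, index `s` and precision `ε`. Only the values of `f` on `[a, b]` matter;
at the end points the derivatives are one-sided. -/
structure IsAdmissiblePhase (N : ℝ) (P : ℕ) (y s ε : ℝ) (a b : ℝ) (f : ℝ → ℝ) : Prop where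
  lt : a < b
  subset : Set.Icc a b ⊆ Set.Icc N (2 * N)
  contDiffOn : ContDiffOn ℝ (P : WithTop ℕ∞) f (Set.Icc a b)
  approx : ∀ p : ℕ, 1 ≤ p → p ≤ P → ∀ u ∈ Set.Icc a b,
    |iteratedDerivWithin p f (Set.Icc a b) u - iteratedDeriv p (modelPhase y s) u|
      ≤ ε * |iteratedDeriv p (modelPhase y s) u|

/-- `(k, l)` is an exponent pair. Since `0 < N ≤ a`, the naturals in
`Finset.Ioc ⌊a⌋₊ ⌊b⌋₊` are exactly the integers `n` with `a < n ≤ b`. -/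
def IsExponentPair (k l : ℝ) : Prop :=
  (0 ≤ k ∧ k ≤ 1 / 2 ∧ 1 / 2 ≤ l ∧ l ≤ 1) ∧
  ∀ s : ℝ, 0 < s → ∃ P : ℕ, 1 ≤ P ∧ ∃ ε : ℝ, 0 < ε ∧ ∃ C : ℝ,
    ∀ N y : ℝ, 0 < N → 0 < y → ∀ (a b : ℝ) (f : ℝ → ℝ), IsAdmissiblePhase N P y s ε a b f →
      ‖∑ n ∈ Finset.Ioc ⌊a⌋₊ ⌊b⌋₊, e (f n)‖
        ≤ C * ((y * N ^ (-s)) ^ k * N ^ l + (y * N ^ (-s))⁻¹)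

/-- The set `{[x/n] : n ∈ [1, x] ∩ ℤ}`, without multiplicity. -/
def quotientSet (x : ℝ) : Finset ℤ :=
  (Finset.Icc 1 ⌊x⌋₊).image fun n : ℕ => ⌊x / n⌋

/-- `S(x, q, a)`: the number of positive integers `n ≤ x` with `[x/n] ≡ a (mod q)`. -/
def countMult (x : ℝ) (q : ℕ) (a : ℤ) : ℕ :=
  ((Finset.Icc 1 ⌊x⌋₊).filter fun n : ℕ => ⌊x / n⌋ ≡ a [ZMOD q]).card

/-- `S*(x, q, a)`: the number of elements of `{[x/n] : n ∈ [1, x] ∩ ℤ}` congruent to `a`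
modulo `q`. -/
def countSet (x : ℝ) (q : ℕ) (a : ℤ) : ℕ :=
  ((quotientSet x).filter fun m : ℤ => m ≡ a [ZMOD q]).card

/-- The term of index `n` of the series of `1 / (n (n + 1))` over positive integers
`n ≡ a (mod q)`. -/
def progressionTerm (q : ℕ) (a : ℤ) (n : ℕ) : ℝ :=
  if 1 ≤ n ∧ (n : ℤ) ≡ a [ZMOD q] then 1 / ((n : ℝ) * (n + 1)) else 0

theorem summable_progressionTerm (q : ℕ) (a : ℤ) : Summable (progressionTerm q a) := by
  refine Summable.of_nonneg_of_le (fun n => ?_) (fun n => ?_)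
    (Real.summable_one_div_nat_pow.mpr (one_lt_two : 1 < 2))
  · unfold progressionTerm
    split_ifs <;> positivity
  · unfold progressionTerm
    split_ifs with h
    · have hn : (0 : ℝ) < n := by exact_mod_cast h.1
      apply one_div_le_one_div_of_le (by positivity)
      nlinarith
    · positivity

/-- The sum of `1 / (n (n + 1))` over all positive integers `n ≡ a (mod q)`. -/
def progressionSum (q : ℕ) (a : ℤ) : ℝ := ∑' n : ℕ, progressionTerm q a n

end

end FloorQuotient

namespace FloorQuotient

open Finset

/-! Put ψ(t) = t - [t] - 1/2 and X = x/q. The condition [t] ≡ a (mod q) has indicator [(t-a)/q] -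
[(t-a-1)/q], so for n up to B ≈ √X the count is B/q plus sums of ψ(X/n + c). For n > B, sort by the
value m = r + qj of the quotient: it is taken [x/m] - [x/(m+1)] times, and x/m = X/(j + r/q), so the
error is again made of sums of ψ(X/(j+α)) with 0 ≤ α ≤ 2 and j = O(√X). Only X = x/q enters, whence
the uniformity in q. For S*, let R = [√x]: the n ≤ R give distinct quotients, all at least R, and
every positive integer below R is a quotient. Hence S* is R/q plus the part of S with n ≤ R, up to
O(1). That part is S minus its tail beyond R; the tail estimate
`abs_sum_floorIndicator_tail_sub_le`, applied at B and at R, shows it to be R/q up to the same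
error.

Everything thus rests on `exists_abs_sum_sawtooth_div_le`: the sums of ψ are O(X^θ + 1) with θ =
(k+l)/(2k+2). On a dyadic block (J/2, J], ψ is compared with difference quotients of its primitive,
whose Fourier series converges absolutely. The exponent pair, applied with s = 2 to the phases
hX/(n+α), then bounds the block by X^(k/(k+1)) J^((l-k)/(k+1)). If 0 < k < l the blocks add up
geometrically to X^θ.

Two boundary cases remain. If k = 0, then l = 1 is forced, and the trivial bound is enough. If k = l
= 1/2, the blocks are all of size X^(1/3) and their sum would lose a logarithm, so a stronger
estimate is proved from scratch (`exists_norm_sum_e_div_le`): a van der Corput transform of the sum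
of e(Y/(n+α)) by stationary phase, followed by a fourth derivative test (two Weyl–van der Corput
steps and a second derivative test) for the dual sum. Its leading term L^(5/16) J^(9/16), L = Y/J^2,
again gives exactly X^(1/3), now with a positive power of J, so no logarithm appears. -/

/-! ### The additive character -/

theorem norm_e (t : ℝ) : ‖e t‖ = 1 := by
  unfold e
  rw [show 2 * (Real.pi : ℂ) * Complex.I * t = ((2 * Real.pi * t : ℝ) : ℂ) * Complex.I by
    push_cast; ring]
  exact Complex.norm_exp_ofReal_mul_I _

theorem e_add (s t : ℝ) : e (s + t) = e s * e t := by
  unfold e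
  rw [← Complex.exp_add]
  congr 1
  push_cast
  ring

theorem e_zero : e 0 = 1 := by simp [e]

theorem e_int (n : ℤ) : e n = 1 := by
  unfold e
  rw [Complex.exp_eq_one_iff]
  exact ⟨n, by push_cast; ring⟩

theorem e_neg (t : ℝ) : e (-t) = (starRingEnd ℂ) (e t) := by
  unfold e
  rw [← Complex.exp_conj]
  congr 1
  simp only [map_mul, Complex.conj_ofReal, Complex.conj_I, map_ofNat, Complex.ofReal_neg]
  ring

theorem e_sub (s t : ℝ) : e (s - t) = e s * (starRingEnd ℂ) (e t) := by
  rw [sub_eq_add_neg, e_add, e_neg]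

theorem e_add_int (t : ℝ) (n : ℤ) : e (t + n) = e t := by
  rw [e_add, e_int, mul_one]

theorem norm_sum_e_neg {ι : Type*} (s : Finset ι) (g : ι → ℝ) :
    ‖∑ i ∈ s, e (-g i)‖ = ‖∑ i ∈ s, e (g i)‖ := by
  simp_rw [e_neg]
  rw [← map_sum, Complex.norm_conj]

theorem norm_e_sub_one (t : ℝ) : ‖e t - 1‖ = 2 * |Real.sin (Real.pi * t)| := by
  have h := Complex.norm_exp_I_mul_ofReal_sub_one (2 * Real.pi * t)
  unfold e
  rw [show 2 * (Real.pi : ℂ) * Complex.I * t = Complex.I * ((2 * Real.pi * t : ℝ) : ℂ) by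
    push_cast; ring, h, Real.norm_eq_abs, abs_mul, abs_two]
  congr 3
  ring

theorem norm_e_sub_le (s t : ℝ) : ‖e s - e t‖ ≤ 2 * Real.pi * |s - t| := by
  have h : e s - e t = (e (s - t) - 1) * e t := by
    rw [sub_mul, ← e_add, one_mul, sub_add_cancel]
  rw [h, norm_mul, norm_e, mul_one, norm_e_sub_one]
  have h2 : |Real.sin (Real.pi * (s - t))| ≤ |Real.pi * (s - t)| := Real.abs_sin_le_abs
  rw [abs_mul, abs_of_pos Real.pi_pos] at h2
  linarith

/-- Jordan's inequality for the sine on either side of t = 1/2. The range reaches 3/4 rather than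
1/2 because finite differences of a phase only approximate its derivative, and the transform below
needs that slack. -/
theorem abs_le_norm_e_sub_one {t : ℝ} (ht : |t| ≤ 3 / 4) : |t| ≤ ‖e t - 1‖ := by
  have key : ∀ u : ℝ, 0 ≤ u → u ≤ 3 / 4 → u ≤ 2 * Real.sin (Real.pi * u) := by
    intro u h0 h1
    have hpi := Real.pi_pos
    rcases le_total u (1 / 2) with h | h
    · have h2 := Real.mul_le_sin (x := Real.pi * u) (by positivity) (by nlinarith)
      have h3 : 2 / Real.pi * (Real.pi * u) = 2 * u := by field_simp
      linarith
    · have h2 := Real.mul_le_sin (x := Real.pi * (1 - u)) (by nlinarith) (by nlinarith)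
      have h3 : 2 / Real.pi * (Real.pi * (1 - u)) = 2 * (1 - u) := by field_simp
      have h4 : Real.sin (Real.pi * (1 - u)) = Real.sin (Real.pi * u) := by
        rw [mul_sub, mul_one, Real.sin_pi_sub]
      linarith
  rw [norm_e_sub_one]
  have h := key |t| (abs_nonneg t) ht
  rcases abs_cases t with ⟨h1, _⟩ | ⟨h1, _⟩
  · rw [h1] at h ⊢
    exact h.trans (by gcongr; exact le_abs_self _)
  · rw [h1] at h ⊢
    rw [mul_neg, Real.sin_neg] at h
    exact h.trans (by gcongr; exact neg_le_abs _)

/-! ### Kusmin–Landau and the second derivative test -/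

/-- Summation by parts. The real sequence `t` majorises the variation of the weights step by step,
so the total variation telescopes to `t n - t m`. -/
theorem norm_sum_mul_le_of_abel {m n : ℕ} (hmn : m ≤ n) (w a : ℕ → ℂ) (t : ℕ → ℝ) {M W : ℝ}
    (hM : ∀ j, m ≤ j → j ≤ n + 1 → ‖∑ i ∈ Ico m j, a i‖ ≤ M)
    (hw : ‖w n‖ ≤ W)
    (hd : ∀ i, m ≤ i → i < n → ‖w (i + 1) - w i‖ ≤ t (i + 1) - t i) :
    ‖∑ i ∈ Ico m (n + 1), w i * a i‖ ≤ M * (W + (t n - t m)) := by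
  have hid : ∀ n, m ≤ n → ∑ i ∈ Ico m (n + 1), w i * a i = w n * ∑ i ∈ Ico m (n + 1), a i -
      ∑ i ∈ Ico m n, (w (i + 1) - w i) * ∑ j ∈ Ico m (i + 1), a j := by
    intro n hn
    induction n, hn using Nat.le_induction with
    | base => simp
    | succ n hn ih =>
      rw [Finset.sum_Ico_succ_top (by omega), ih, Finset.sum_Ico_succ_top (b := n) hn
        (fun i => (w (i + 1) - w i) * ∑ j ∈ Ico m (i + 1), a j),
        Finset.sum_Ico_succ_top (b := n + 1) (by omega) a]
      ring
  have hM0 : 0 ≤ M := by simpa using hM m le_rfl (by omega)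
  rw [hid n hmn]
  refine (norm_sub_le _ _).trans ?_
  rw [mul_add]
  gcongr
  · rw [norm_mul, mul_comm]
    have := hM (n + 1) (by omega) le_rfl
    gcongr
  · refine (norm_sum_le _ _).trans ?_
    have htel : ∑ i ∈ Ico m n, (t (i + 1) - t i) = t n - t m := Finset.sum_Ico_sub t hmn
    rw [← htel, Finset.mul_sum]
    refine Finset.sum_le_sum fun i hi => ?_
    rw [Finset.mem_Ico] at hi
    rw [norm_mul, mul_comm]
    have := hM (i + 1) (by omega) (by omega)
    have := hd i hi.1 hi.2
    gcongr

/-- Discrete Kusmin–Landau inequality. -/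
theorem norm_sum_e_le_of_le_abs_diff (g : ℕ → ℝ) (m n : ℕ) {θ : ℝ} (hθ : 0 < θ)
    (h1 : ∀ i, m ≤ i → i < n → θ ≤ |g (i + 1) - g i|)
    (h2 : ∀ i, m ≤ i → i < n → |g (i + 1) - g i| ≤ 3 / 4)
    (h3 : ∀ i, m ≤ i → i + 1 < n →
      (g (i + 1 + 1) - g (i + 1))⁻¹ ≤ (g (i + 1) - g i)⁻¹) :
    ‖∑ i ∈ Ico m n, e (g i)‖ ≤ 30 / θ := by
  rcases Nat.lt_or_ge m n with hmn | hmn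
  swap
  · rw [Finset.Ico_eq_empty (by omega)]
    simp
    positivity
  obtain ⟨n, rfl⟩ : ∃ k, n = k + 1 := ⟨n - 1, by omega⟩
  have hmn' : m ≤ n := by omega
  set d : ℕ → ℝ := fun i => g (i + 1) - g i with hd
  have hdne : ∀ i, m ≤ i → i < n + 1 → e (d i) - 1 ≠ 0 := by
    intro i hi hi'
    have := abs_le_norm_e_sub_one (h2 i hi hi')
    have := h1 i hi hi'
    rw [← norm_pos_iff]
    linarith
  have hinv : ∀ i, m ≤ i → i < n + 1 → |(d i)⁻¹| ≤ 1 / θ := by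
    intro i hi hi'
    rw [abs_inv, ← one_div]
    exact one_div_le_one_div_of_le hθ (h1 i hi hi')
  -- Each term is a multiple of a difference of consecutive terms, whose partial sums are bounded by
  -- 2.
  have hsum : ∑ i ∈ Ico m (n + 1), e (g i) =
      ∑ i ∈ Ico m (n + 1), (e (d i) - 1)⁻¹ * (e (g (i + 1)) - e (g i)) := by
    refine Finset.sum_congr rfl fun i hi => ?_
    rw [Finset.mem_Ico] at hi
    have := hdne i hi.1 hi.2
    have h4 : e (g (i + 1)) = e (d i) * e (g i) := by
      rw [← e_add]; congr 1; simp [hd]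
    rw [h4]
    field_simp
  rw [hsum]
  -- The majorant is -2π/d: since |e(x) - 1| ≥ |x|, the weights 1/(e(x) - 1) and 1/(e(y) - 1) differ
  -- by at most 2π|x-y|/(|x||y|) = 2π|1/x - 1/y|, and 1/d is monotone by `h3`.
  have hb := norm_sum_mul_le_of_abel hmn' (fun i => (e (d i) - 1)⁻¹)
    (fun i => e (g (i + 1)) - e (g i)) (fun i => -(2 * Real.pi * (d i)⁻¹)) (M := 2) (W := 1 / θ)
    ?_ ?_ ?_
  · refine hb.trans ?_
    have ha := abs_le.mp (hinv n hmn' (by omega))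
    have hb := abs_le.mp (hinv m le_rfl (by omega))
    have hpi := Real.pi_lt_d2
    have hpi' := Real.pi_pos
    have hx : 0 < 1 / θ := by positivity
    rw [show 30 / θ = 30 * (1 / θ) by ring]
    nlinarith
  · intro j hj hj'
    rw [Finset.sum_Ico_sub (fun i => e (g i)) hj]
    refine (norm_sub_le _ _).trans ?_
    rw [norm_e, norm_e]
    norm_num
  · rw [norm_inv, ← one_div]
    apply one_div_le_one_div_of_le hθ
    exact (h1 n hmn' (by omega)).trans (abs_le_norm_e_sub_one (h2 n hmn' (by omega)))
  · intro i hi hi'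
    have e1 := hdne i hi (by omega)
    have e2 := hdne (i + 1) (by omega) (by omega)
    have n1 := abs_le_norm_e_sub_one (h2 i hi (by omega))
    have n2 := abs_le_norm_e_sub_one (h2 (i + 1) (by omega) (by omega))
    have p1 : 0 < |d i| := hθ.trans_le (h1 i hi (by omega))
    have p2 : 0 < |d (i + 1)| := hθ.trans_le (h1 (i + 1) (by omega) (by omega))
    have h4 := h3 i hi (by omega)
    change (d (i + 1))⁻¹ ≤ (d i)⁻¹ at h4
    have q1 : d i ≠ 0 := abs_pos.mp p1
    have q2 : d (i + 1) ≠ 0 := abs_pos.mp p2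
    have h5 : -(2 * Real.pi * (d (i + 1))⁻¹) - -(2 * Real.pi * (d i)⁻¹) =
        2 * Real.pi * |(d i)⁻¹ - (d (i + 1))⁻¹| := by
      rw [abs_of_nonneg (by linarith)]; ring
    rw [h5, inv_sub_inv e2 e1, inv_sub_inv q1 q2, norm_div, norm_mul, abs_div, abs_mul,
      show e (d i) - 1 - (e (d (i + 1)) - 1) = e (d i) - e (d (i + 1)) by ring, ← mul_div_assoc]
    have h6 := norm_e_sub_le (d i) (d (i + 1))
    rw [abs_sub_comm (d (i + 1)) (d i)]
    have h7 : |d i| * |d (i + 1)| ≤ ‖e (d (i + 1)) - 1‖ * ‖e (d i) - 1‖ := by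
      rw [mul_comm]
      exact mul_le_mul n2 n1 p1.le (norm_nonneg _)
    exact div_le_div₀ (by positivity) h6 (by positivity) h7

theorem exists_eq_Ico_of_convex (s : Finset ℕ)
    (h : ∀ a ∈ s, ∀ b ∈ s, ∀ c, a ≤ c → c ≤ b → c ∈ s) : ∃ m n, s = Ico m n := by
  rcases s.eq_empty_or_nonempty with rfl | hs
  · exact ⟨0, 0, by simp⟩
  · refine ⟨s.min' hs, s.max' hs + 1, ?_⟩
    ext c
    rw [Finset.mem_Ico]
    constructor
    · intro hc
      exact ⟨s.min'_le c hc, Nat.lt_succ_of_le (s.le_max' c hc)⟩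
    · rintro ⟨h1, h2⟩
      exact h _ (s.min'_mem hs) _ (s.max'_mem hs) c h1 (Nat.lt_succ_iff.mp h2)

theorem norm_sum_e_le_card {ι : Type*} (s : Finset ι) (g : ι → ℝ) :
    ‖∑ i ∈ s, e (g i)‖ ≤ s.card := by
  refine (norm_sum_le _ _).trans ?_
  simp [norm_e]

/-- The part of the sum where the first difference is within `1 / 2` of a fixed integer. -/
theorem norm_sum_e_le_of_diff_near_zero (g : ℕ → ℝ) (m n : ℕ) {l : ℝ} (hl : 0 < l) (hl1 : l ≤ 1)
    (h1 : ∀ i j, m ≤ i → i ≤ j → j < n →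
      l * ((j : ℝ) - i) ≤ (g (j + 1) - g j) - (g (i + 1) - g i))
    (h2 : ∀ i, m ≤ i → i < n → |g (i + 1) - g i| ≤ 1 / 2) :
    ‖∑ i ∈ Ico m n, e (g i)‖ ≤ 63 / √l := by
  set d : ℕ → ℝ := fun i => g (i + 1) - g i with hd
  -- This threshold balances the Kusmin–Landau bound 1/θ on the two outer ranges |d| > θ against the
  -- O(θ/l + 1) indices with |d| ≤ θ.
  set θ := √l with hθdef
  have hθ : 0 < θ := Real.sqrt_pos.mpr hl
  have hθ1 : θ ≤ 1 := Real.sqrt_le_one.mpr hl1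
  have hθl : θ * θ = l := Real.mul_self_sqrt hl.le
  have hmono : ∀ i j, m ≤ i → i ≤ j → j < n → d i ≤ d j := by
    intro i j hi hij hj
    have := h1 i j hi hij hj
    have h3 : (0 : ℝ) ≤ (j : ℝ) - i := by
      have : (i : ℝ) ≤ j := by exact_mod_cast hij
      linarith
    have h4 := mul_nonneg hl.le h3
    simp only [hd]
    linarith
  have hconv : ∀ p : ℝ → Prop, (∀ x y z, p x → p z → x ≤ y → y ≤ z → p y) → [DecidablePred p] →
      ∃ a b, (Ico m n).filter (fun i => p (d i)) = Ico a b := by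
    intro p hp _
    apply exists_eq_Ico_of_convex
    intro a ha b hb c hac hcb
    rw [Finset.mem_filter, Finset.mem_Ico] at *
    exact ⟨⟨by omega, by omega⟩, hp _ _ _ ha.2 hb.2 (hmono a c (by omega) hac (by omega))
      (hmono c b (by omega) hcb (by omega))⟩
  have hside : ∀ (p : ℝ → Prop) [DecidablePred p], (∀ x y z, p x → p z → x ≤ y → y ≤ z → p y) →
      (∀ x, p x → θ ≤ |x|) → (∀ x y, p x → p y → x ≤ y → y⁻¹ ≤ x⁻¹) →
      ‖∑ i ∈ (Ico m n).filter (fun i => p (d i)), e (g i)‖ ≤ 30 / θ := by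
    intro p _ hp hp1 hp2
    obtain ⟨a, b, hab⟩ := hconv p hp
    have hmem : ∀ i, a ≤ i → i < b → (m ≤ i ∧ i < n) ∧ p (d i) := by
      intro i hi hi'
      have : i ∈ (Ico m n).filter (fun i => p (d i)) := by
        rw [hab, Finset.mem_Ico]; exact ⟨hi, hi'⟩
      rwa [Finset.mem_filter, Finset.mem_Ico] at this
    rw [hab]
    apply norm_sum_e_le_of_le_abs_diff g a b hθ
    · intro i hi hi'
      exact hp1 _ (hmem i hi hi').2
    · intro i hi hi'
      have := h2 i (hmem i hi hi').1.1 (hmem i hi hi').1.2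
      linarith
    · intro i hi hi'
      have u := hmem i hi (by omega)
      have v := hmem (i + 1) (by omega) hi'
      exact hp2 _ _ u.2 v.2 (hmono _ _ u.1.1 (by omega) v.1.2)
  rw [← Finset.sum_filter_add_sum_filter_not (Ico m n) (fun i => θ < d i)]
  rw [← Finset.sum_filter_add_sum_filter_not ((Ico m n).filter (fun i => ¬ θ < d i))
    (fun i => d i < -θ), Finset.filter_filter, Finset.filter_filter]
  have hA := hside (fun x => θ < x) (fun x y z hx hz hxy hyz => by linarith)
    (fun x hx => hx.le.trans (le_abs_self _))
    (fun x y hx hy hxy => inv_anti₀ (hθ.trans hx) hxy)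
  have hB := hside (fun x => ¬ θ < x ∧ x < -θ)
    (fun x y z hx hz hxy hyz => by exact ⟨by linarith [hx.1, hz.1], by linarith [hx.2, hz.2]⟩)
    (fun x hx => by rw [le_abs]; right; linarith [hx.2])
    (fun x y hx hy hxy => by
      have hx' : x < 0 := by linarith [hx.2]
      have hy' : y < 0 := by linarith [hy.2]
      exact (inv_le_inv_of_neg hy' hx').mpr hxy)
  have hC : ‖∑ i ∈ (Ico m n).filter (fun i => ¬ θ < d i ∧ ¬ d i < -θ), e (g i)‖ ≤ 3 / θ := by
    obtain ⟨a, b, hab⟩ := hconv (fun x => ¬ θ < x ∧ ¬ x < -θ)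
      (fun x y z hx hz hxy hyz => by simp only [not_lt] at *; exact ⟨by linarith, by linarith⟩)
    have hmem : ∀ i, a ≤ i → i < b → (m ≤ i ∧ i < n) ∧ (¬ θ < d i ∧ ¬ d i < -θ) := by
      intro i hi hi'
      have : i ∈ (Ico m n).filter (fun i => ¬ θ < d i ∧ ¬ d i < -θ) := by
        rw [hab, Finset.mem_Ico]; exact ⟨hi, hi'⟩
      rwa [Finset.mem_filter, Finset.mem_Ico] at this
    refine (norm_sum_e_le_card _ _).trans ?_
    rw [hab, Nat.card_Ico]
    rcases Nat.lt_or_ge a b with hlt | hge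
    swap
    · rw [Nat.sub_eq_zero_of_le hge]
      simp only [Nat.cast_zero]
      positivity
    obtain ⟨b, rfl⟩ : ∃ k, b = k + 1 := ⟨b - 1, by omega⟩
    have u := hmem a le_rfl (by omega)
    have v := hmem b (by omega) (by omega)
    have w := h1 a b u.1.1 (by omega) v.1.2
    rw [Nat.cast_sub (by omega)]
    push_cast
    have hw : l * ((b : ℝ) - a) ≤ 2 * θ := by
      have := u.2.2
      have := v.2.1
      simp only [hd, not_lt] at *
      linarith
    rw [le_div_iff₀ hθ]
    have : θ * (θ * ((b : ℝ) - a)) ≤ θ * 2 := by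
      rw [← mul_assoc, hθl]; linarith
    have := le_of_mul_le_mul_left this hθ
    nlinarith
  refine le_trans ?_ (le_of_eq (show 30 / θ + (30 / θ + 3 / θ) = 63 / θ by ring))
  refine (norm_add_le _ _).trans (add_le_add ?_ ((norm_add_le _ _).trans (add_le_add ?_ ?_)))
  · exact hA
  · exact hB
  · exact hC

/-- Discrete second derivative test. -/
theorem norm_sum_e_le_of_second_diff (g : ℕ → ℝ) (m n : ℕ) {l A : ℝ} (hl : 0 < l) (hA : 1 ≤ A)
    (h1 : ∀ i, m ≤ i → i < n → l ≤ (g (i + 1 + 1) - g (i + 1)) - (g (i + 1) - g i))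
    (h2 : ∀ i, m ≤ i → i < n → (g (i + 1 + 1) - g (i + 1)) - (g (i + 1) - g i) ≤ A * l) :
    ‖∑ i ∈ Ico m n, e (g i)‖ ≤ 126 * A * (((n - m : ℕ) : ℝ) * √l + 1 / √l) := by
  have hs : 0 < √l := Real.sqrt_pos.mpr hl
  rcases le_or_gt l 1 with hl1 | hl1
  swap
  · have h3 : 1 ≤ √l := by rw [Real.one_le_sqrt]; exact hl1.le
    refine (norm_sum_e_le_card _ _).trans ?_
    rw [Nat.card_Ico]
    have h4 : (0 : ℝ) ≤ ((n - m : ℕ) : ℝ) := Nat.cast_nonneg _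
    have h5 : 0 < 1 / √l := by positivity
    nlinarith [mul_nonneg h4 hs.le, mul_nonneg (sub_nonneg.mpr hA) (mul_nonneg h4 hs.le),
      mul_nonneg (sub_nonneg.mpr hA) h5.le]
  rcases Nat.lt_or_ge m n with hmn | hmn
  swap
  · rw [Finset.Ico_eq_empty (by omega)]
    simp
    positivity
  set d : ℕ → ℝ := fun i => g (i + 1) - g i with hd
  have hlow : ∀ i j, m ≤ i → i ≤ j → j ≤ n → l * ((j : ℝ) - i) ≤ d j - d i := by
    intro i j hi hij hj
    induction j, hij using Nat.le_induction with
    | base => simp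
    | succ j hj' ih =>
      have := ih (by omega)
      have := h1 j (by omega) (by omega)
      simp only [hd] at *
      push_cast
      linarith
  have hup : ∀ i j, m ≤ i → i ≤ j → j ≤ n → d j - d i ≤ A * l * ((j : ℝ) - i) := by
    intro i j hi hij hj
    induction j, hij using Nat.le_induction with
    | base => simp
    | succ j hj' ih =>
      have := ih (by omega)
      have := h2 j (by omega) (by omega)
      simp only [hd] at *
      push_cast
      linarith
  have hmono : ∀ i j, m ≤ i → i ≤ j → j ≤ n → d i ≤ d j := by
    intro i j hi hij hj
    have := hlow i j hi hij hj
    have h3 : (0 : ℝ) ≤ (j : ℝ) - i := by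
      have : (i : ℝ) ≤ j := by exact_mod_cast hij
      linarith
    have h4 := mul_nonneg hl.le h3
    linarith
  have hrm : ∀ x y : ℝ, x ≤ y → round x ≤ round y := by
    intro x y hxy
    rw [round_eq, round_eq]
    exact Int.floor_le_floor (by linarith)
  have hmaps : ∀ i ∈ Ico m n, round (d i) ∈ Icc (round (d m)) (round (d n)) := by
    intro i hi
    rw [Finset.mem_Ico] at hi
    rw [Finset.mem_Icc]
    exact ⟨hrm _ _ (hmono m i le_rfl hi.1 hi.2.le), hrm _ _ (hmono i n hi.1 hi.2.le le_rfl)⟩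
  -- Indices are grouped by the integer ν nearest to the first difference. Subtracting νi from the
  -- phase changes no term and brings the difference into [-1/2, 1/2]; at most Al(n-m) + 2 values of
  -- ν occur.
  rw [← Finset.sum_fiberwise_of_maps_to hmaps]
  have hfib : ∀ ν ∈ Icc (round (d m)) (round (d n)),
      ‖∑ i ∈ (Ico m n).filter (fun i => round (d i) = ν), e (g i)‖ ≤ 63 / √l := by
    intro ν _
    obtain ⟨a, b, hab⟩ : ∃ a b, (Ico m n).filter (fun i => round (d i) = ν) = Ico a b := by
      apply exists_eq_Ico_of_convex
      intro a ha b hb c hac hcb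
      rw [Finset.mem_filter, Finset.mem_Ico] at *
      refine ⟨⟨by omega, by omega⟩, le_antisymm ?_ ?_⟩
      · rw [← hb.2]; exact hrm _ _ (hmono c b (by omega) hcb (by omega))
      · rw [← ha.2]; exact hrm _ _ (hmono a c (by omega) hac (by omega))
    have hmem : ∀ i, a ≤ i → i < b → (m ≤ i ∧ i < n) ∧ round (d i) = ν := by
      intro i hi hi'
      have : i ∈ (Ico m n).filter (fun i => round (d i) = ν) := by
        rw [hab, Finset.mem_Ico]; exact ⟨hi, hi'⟩
      rwa [Finset.mem_filter, Finset.mem_Ico] at this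
    rw [hab]
    have heq : ∀ i ∈ Ico a b, e (g i) = e (g i - ν * i) := by
      intro i _
      rw [← e_add_int (g i - ν * i) (ν * i)]
      congr 1
      push_cast
      ring
    rw [Finset.sum_congr rfl heq]
    apply norm_sum_e_le_of_diff_near_zero (fun i => g i - ν * i) a b hl hl1
    · intro i j hi hij hj
      have u := hmem i hi (by omega)
      have v := hmem j (by omega) (by omega)
      have := hlow i j u.1.1 hij v.1.2.le
      simp only [hd] at this
      push_cast
      linarith
    · intro i hi hi'
      have u := hmem i hi hi'
      have := abs_sub_round (d i)
      rw [u.2] at this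
      simp only [hd] at this
      push_cast
      rwa [show g (i + 1) - ν * ((i : ℝ) + 1) - (g i - ν * i) = g (i + 1) - g i - ν by ring]
  refine (norm_sum_le _ _).trans ((Finset.sum_le_sum hfib).trans ?_)
  rw [Finset.sum_const, nsmul_eq_mul, Int.card_Icc]
  have hle := hrm _ _ (hmono m n le_rfl hmn.le le_rfl)
  have hcard : (((round (d n) + 1 - round (d m)).toNat : ℕ) : ℝ) ≤ A * l * ((n - m : ℕ) : ℝ) + 2 := by
    have h3 : (((round (d n) + 1 - round (d m)).toNat : ℕ) : ℝ)
        = (round (d n) : ℝ) + 1 - round (d m) := by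
      have : (((round (d n) + 1 - round (d m)).toNat : ℕ) : ℤ) = round (d n) + 1 - round (d m) :=
        Int.toNat_of_nonneg (by omega)
      exact_mod_cast this
    rw [h3, Nat.cast_sub hmn.le]
    have h4 := hup m n le_rfl hmn.le le_rfl
    have h5 := abs_le.mp (abs_sub_round (d n))
    have h6 := abs_le.mp (abs_sub_round (d m))
    linarith
  have h63 : 0 ≤ 63 / √l := by positivity
  refine (mul_le_mul_of_nonneg_right hcard h63).trans ?_
  have hll : l = √l * √l := (Real.mul_self_sqrt hl.le).symm
  have h7 : (A * l * ((n - m : ℕ) : ℝ) + 2) * (63 / √l) =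
      63 * A * (((n - m : ℕ) : ℝ) * √l) + 126 * (1 / √l) := by
    nth_rewrite 1 [hll]
    field_simp
    ring
  rw [h7]
  have h8 : 0 ≤ ((n - m : ℕ) : ℝ) * √l := by positivity
  have h9 : 0 < 1 / √l := by positivity
  nlinarith [mul_nonneg (sub_nonneg.mpr hA) h8, mul_nonneg (sub_nonneg.mpr hA) h9.le]

/-! ### Weyl–van der Corput differencing and the fourth derivative test -/

theorem sum_Ico_shift_eq_sum_range (f : ℤ → ℂ) (K Q q : ℕ) (hq : q ≤ Q)
    (hf : ∀ m, f m ≠ 0 → 0 ≤ m ∧ m < K) :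
    ∑ n ∈ Ico (-(Q : ℤ)) K, f (n + q) = ∑ i ∈ range K, f i := by
  have h1 : ∑ i ∈ range K, f i = ∑ m ∈ Ico (0 : ℤ) K, f m := by
    refine Finset.sum_bij (fun i _ => (i : ℤ)) ?_ ?_ ?_ ?_
    · intro i hi
      rw [Finset.mem_range] at hi
      rw [Finset.mem_Ico]
      omega
    · intro i _ j _ h
      exact_mod_cast h
    · intro m hm
      rw [Finset.mem_Ico] at hm
      exact ⟨m.toNat, by rw [Finset.mem_range]; omega, by simp [hm.1]⟩
    · intro i _
      rfl
  have h2 : ∑ n ∈ Ico (-(Q : ℤ)) K, f (n + q) = ∑ m ∈ Ico (-(Q : ℤ) + q) (K + q), f m :=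
    Finset.sum_Ico_add' f _ _ _
  rw [h1, h2]
  symm
  apply Finset.sum_subset
  · intro m hm
    rw [Finset.mem_Ico] at *
    omega
  · intro m _ hm
    by_contra h
    exact hm (Finset.mem_Ico.mpr (hf m h))

/-- The Weyl–van der Corput inequality. -/
theorem norm_sum_sq_le_of_correlation (z : ℕ → ℂ) (K Q : ℕ) (hQ : 1 ≤ Q) {M : ℝ} (hM : 0 ≤ M)
    (hz : ∀ i, ‖z i‖ ≤ 1)
    (h : ∀ d, 1 ≤ d → d < Q →
      ‖∑ i ∈ range (K - d), z (i + d) * (starRingEnd ℂ) (z i)‖ ≤ M) :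
    ‖∑ i ∈ range K, z i‖ ^ 2 ≤ ((K : ℝ) + Q) * ((K : ℝ) / Q + M) := by
  -- Extended by zero to the integers, the sequence has the same sum after every shift. Averaging
  -- over `Q` shifts and applying Cauchy–Schwarz on an interval of length `K + Q` brings in the
  -- correlations.
  set ξ : ℤ → ℂ := fun m => if 0 ≤ m ∧ m < K then z m.toNat else 0 with hξ
  have hξ0 : ∀ m, ξ m ≠ 0 → 0 ≤ m ∧ m < K := by
    intro m hm
    by_contra hc
    exact hm (if_neg hc)
  have hξn : ∀ i : ℕ, i < K → ξ i = z i := by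
    intro i hi
    simp [hξ, hi]
  have hS : ∀ q : ℕ, q ≤ Q → ∑ n ∈ Ico (-(Q : ℤ)) K, ξ (n + q) = ∑ i ∈ range K, z i := by
    intro q hq
    rw [sum_Ico_shift_eq_sum_range ξ K Q q hq hξ0]
    exact Finset.sum_congr rfl fun i hi => hξn i (Finset.mem_range.mp hi)
  set T : ℤ → ℂ := fun n => ∑ q ∈ range Q, ξ (n + q) with hT
  have hsumT : ∑ n ∈ Ico (-(Q : ℤ)) K, T n = Q * ∑ i ∈ range K, z i := by
    simp only [hT]
    rw [Finset.sum_comm, Finset.sum_congr rfl fun q hq => hS q (Finset.mem_range.mp hq).le]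
    simp
  have hcorr : ∀ q d : ℕ, 1 ≤ d → q + d < Q →
      ‖∑ n ∈ Ico (-(Q : ℤ)) K, ξ (n + (q + d : ℕ)) * (starRingEnd ℂ) (ξ (n + q))‖ ≤ M := by
    intro q d hd hqd
    have h1 := sum_Ico_shift_eq_sum_range (fun m => ξ (m + d) * (starRingEnd ℂ) (ξ m)) K Q q
      (by omega) (fun m hm => hξ0 m fun h0 => hm (by simp [h0]))
    have h2 : ∑ n ∈ Ico (-(Q : ℤ)) K, ξ (n + (q + d : ℕ)) * (starRingEnd ℂ) (ξ (n + q)) =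
        ∑ i ∈ range K, ξ (i + d) * (starRingEnd ℂ) (ξ i) := by
      rw [← h1]
      refine Finset.sum_congr rfl fun n _ => ?_
      rw [Nat.cast_add, ← add_assoc]
    have h3 : ∑ i ∈ range K, ξ (i + d) * (starRingEnd ℂ) (ξ i) =
        ∑ i ∈ range (K - d), z (i + d) * (starRingEnd ℂ) (z i) := by
      symm
      calc _ = ∑ i ∈ range (K - d), ξ (i + d) * (starRingEnd ℂ) (ξ i) := by
            refine Finset.sum_congr rfl fun i hi => ?_
            rw [Finset.mem_range] at hi
            rw [hξn i (by omega), ← hξn (i + d) (by omega), Nat.cast_add]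
        _ = _ := by
            apply Finset.sum_subset
            · intro i hi
              rw [Finset.mem_range] at *
              omega
            · intro i hi hi'
              rw [Finset.mem_range] at *
              have : ξ (i + d) = 0 := by
                by_contra hc
                have := hξ0 _ hc
                omega
              rw [this, zero_mul]
    rw [h2, h3]
    exact h d hd (by omega)
  have hall : ∀ q ∈ range Q, ∀ q' ∈ range Q,
      ‖∑ n ∈ Ico (-(Q : ℤ)) K, ξ (n + q) * (starRingEnd ℂ) (ξ (n + q'))‖ ≤
        (if q = q' then (K : ℝ) else 0) + M := by
    intro q hq q' hq'
    rw [Finset.mem_range] at hq hq'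
    rcases lt_trichotomy q q' with hlt | rfl | hlt
    · rw [if_neg (by omega), zero_add]
      have h1 := hcorr q (q' - q) (by omega) (by omega)
      rw [show q + (q' - q) = q' by omega] at h1
      rw [← Complex.norm_conj, map_sum]
      convert h1 using 3 with n
      rw [map_mul, Complex.conj_conj, mul_comm]
    · rw [if_pos rfl]
      have h1 := sum_Ico_shift_eq_sum_range (fun m => ξ m * (starRingEnd ℂ) (ξ m)) K Q q
        hq.le (fun m hm => hξ0 m fun h0 => hm (by simp [h0]))
      rw [h1]
      have h2 : ‖∑ i ∈ range K, ξ i * (starRingEnd ℂ) (ξ i)‖ ≤ ∑ i ∈ range K, (1 : ℝ) := by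
        refine (norm_sum_le _ _).trans (Finset.sum_le_sum fun i hi => ?_)
        rw [hξn i (Finset.mem_range.mp hi), norm_mul, Complex.norm_conj]
        exact mul_le_one₀ (hz i) (norm_nonneg _) (hz i)
      simp only [Finset.sum_const, Finset.card_range, nsmul_eq_mul, mul_one] at h2
      linarith
    · rw [if_neg (by omega), zero_add]
      have h1 := hcorr q' (q - q') (by omega) (by omega)
      rwa [show q' + (q - q') = q by omega] at h1
  have hsq : ∑ n ∈ Ico (-(Q : ℤ)) K, ‖T n‖ ^ 2 ≤ Q * K + Q ^ 2 * M := by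
    have h1 : ((∑ n ∈ Ico (-(Q : ℤ)) K, ‖T n‖ ^ 2 : ℝ) : ℂ) =
        ∑ q ∈ range Q, ∑ q' ∈ range Q,
          ∑ n ∈ Ico (-(Q : ℤ)) K, ξ (n + q) * (starRingEnd ℂ) (ξ (n + q')) := by
      push_cast
      simp_rw [← Complex.mul_conj']
      simp only [hT, map_sum, Finset.sum_mul_sum]
      rw [Finset.sum_comm]
      exact Finset.sum_congr rfl fun q _ => Finset.sum_comm
    have h2 : ∑ n ∈ Ico (-(Q : ℤ)) K, ‖T n‖ ^ 2 =
        ‖((∑ n ∈ Ico (-(Q : ℤ)) K, ‖T n‖ ^ 2 : ℝ) : ℂ)‖ := by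
      rw [Complex.norm_real, Real.norm_eq_abs, abs_of_nonneg]
      positivity
    rw [h2, h1]
    refine (norm_sum_le _ _).trans ((Finset.sum_le_sum fun q hq => (norm_sum_le _ _).trans
      (Finset.sum_le_sum fun q' hq' => hall q hq q' hq')).trans (le_of_eq ?_))
    simp only [Finset.sum_add_distrib, Finset.sum_const, Finset.card_range, nsmul_eq_mul]
    rw [Finset.sum_congr rfl (fun q hq => Finset.sum_ite_eq (range Q) q (fun _ => (K : ℝ))),
      Finset.sum_congr rfl (fun q hq => if_pos hq)]
    simp only [Finset.sum_const, Finset.card_range, nsmul_eq_mul]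
    ring
  have hCS : (Q * ‖∑ i ∈ range K, z i‖) ^ 2 ≤ ((K : ℝ) + Q) * (Q * K + Q ^ 2 * M) := by
    have h1 : Q * ‖∑ i ∈ range K, z i‖ ≤ ∑ n ∈ Ico (-(Q : ℤ)) K, ‖T n‖ := by
      have h2 : Q * ‖∑ i ∈ range K, z i‖ = ‖∑ n ∈ Ico (-(Q : ℤ)) K, T n‖ := by
        rw [hsumT, norm_mul, Complex.norm_natCast]
      rw [h2]
      exact norm_sum_le _ _
    have h3 := sq_sum_le_card_mul_sum_sq (s := Ico (-(Q : ℤ)) K) (f := fun n => ‖T n‖)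
    have h4 : (((Ico (-(Q : ℤ)) K).card : ℕ) : ℝ) = K + Q := by
      rw [Int.card_Ico, show (K : ℤ) - -(Q : ℤ) = ((K + Q : ℕ) : ℤ) by push_cast; ring,
        Int.toNat_natCast]
      push_cast; ring
    rw [h4] at h3
    calc _ ≤ (∑ n ∈ Ico (-(Q : ℤ)) K, ‖T n‖) ^ 2 := by gcongr
      _ ≤ _ := h3
      _ ≤ _ := by gcongr
  have hQ0 : (0 : ℝ) < Q := by exact_mod_cast hQ
  have h5 : ((K : ℝ) + Q) * (Q * K + Q ^ 2 * M) = Q ^ 2 * (((K : ℝ) + Q) * ((K : ℝ) / Q + M)) := by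
    field_simp
  rw [h5, mul_pow] at hCS
  exact le_of_mul_le_mul_left hCS (by positivity)

/-- Discrete fourth derivative test. -/
theorem norm_sum_e_pow_four_le (g : ℕ → ℝ) (K : ℕ) {η A : ℝ} (hη : 0 < η) (hA : 1 ≤ A)
    (h : ∀ d₁ d₂ i : ℕ, 1 ≤ d₁ → 1 ≤ d₂ → i + d₁ + d₂ < K →
      ∀ f : ℕ → ℝ, (f = fun j => (g (j + d₂ + d₁) - g (j + d₂)) - (g (j + d₁) - g j)) →
        d₁ * d₂ * η ^ 4 ≤ (f (i + 1 + 1) - f (i + 1)) - (f (i + 1) - f i) ∧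
        (f (i + 1 + 1) - f (i + 1)) - (f (i + 1) - f i) ≤ A * (d₁ * d₂ * η ^ 4)) :
    ‖∑ i ∈ range K, e (g i)‖ ^ 4 ≤ 2100 * A * ((K : ℝ) ^ 4 * η + (K : ℝ) ^ 3 / η ^ 2) := by
  have htriv : ‖∑ i ∈ range K, e (g i)‖ ^ 4 ≤ (K : ℝ) ^ 4 := by
    have := norm_sum_e_le_card (range K) g
    rw [Finset.card_range] at this
    gcongr
  have hK0 : (0 : ℝ) ≤ K := Nat.cast_nonneg _
  have hc1 : (K : ℝ) ^ 4 * η + (K : ℝ) ^ 3 / η ^ 2 ≤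
      2100 * A * ((K : ℝ) ^ 4 * η + (K : ℝ) ^ 3 / η ^ 2) := by
    have : 0 ≤ (K : ℝ) ^ 4 * η + (K : ℝ) ^ 3 / η ^ 2 := by positivity
    nlinarith
  rcases le_or_gt η 1 with hη1 | hη1
  swap
  · refine htriv.trans (le_trans ?_ hc1)
    have h1 : (K : ℝ) ^ 4 ≤ (K : ℝ) ^ 4 * η := by
      have : 0 ≤ (K : ℝ) ^ 4 := by positivity
      nlinarith
    have : 0 ≤ (K : ℝ) ^ 3 / η ^ 2 := by positivity
    linarith
  -- The shift length for both differencing steps. For shifts below 1/η the second differences l =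
  -- d₁d₂η^4 satisfy η^2 ≤ √l ≤ η, so the second derivative test gives Kη + 1/η^2 up to a constant.
  set Q := ⌊1 / η⌋₊ with hQdef
  have hinv1 : 1 ≤ 1 / η := by rw [le_div_iff₀ hη]; linarith
  have hQ1 : 1 ≤ Q := Nat.le_floor (by simpa using hinv1)
  have hQle : (Q : ℝ) ≤ 1 / η := Nat.floor_le (by positivity)
  have hQη : Q * η ≤ 1 := by rwa [le_div_iff₀ hη] at hQle
  have hQ0 : (0 : ℝ) < Q := by exact_mod_cast hQ1
  have hQinv : 1 / (Q : ℝ) ≤ 2 * η := by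
    have h1 : 1 / η < Q + 1 := Nat.lt_floor_add_one _
    have h2 : (1 : ℝ) ≤ Q := by exact_mod_cast hQ1
    rw [div_lt_iff₀ hη] at h1
    rw [div_le_iff₀ hQ0]
    nlinarith
  rcases Nat.lt_or_ge K Q with hKQ | hKQ
  · refine htriv.trans (le_trans ?_ hc1)
    have h1 : (K : ℝ) ≤ 1 / η := le_trans (by exact_mod_cast hKQ.le) hQle
    have h2 : (K : ℝ) ^ 4 ≤ (K : ℝ) ^ 3 / η ^ 2 := by
      rcases Nat.eq_zero_or_pos K with hk | hk
      · simp [hk]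
      · have h3 : (1 : ℝ) ≤ K := by exact_mod_cast hk
        have h4 : (K : ℝ) ≤ (1 / η) ^ 2 := by nlinarith
        calc (K : ℝ) ^ 4 = (K : ℝ) ^ 3 * K := by ring
          _ ≤ (K : ℝ) ^ 3 * (1 / η) ^ 2 := by gcongr
          _ = _ := by ring
    have : 0 ≤ (K : ℝ) ^ 4 * η := by positivity
    linarith
  have hKQ' : (Q : ℝ) ≤ K := by exact_mod_cast hKQ
  set M' := 126 * A * ((K : ℝ) * η + 1 / η ^ 2) with hM'
  have hM'0 : 0 ≤ M' := by positivity
  set M := √(2 * K * (K / Q + M')) with hM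
  have hMsq : M ^ 2 = 2 * K * (K / Q + M') := Real.sq_sqrt (by positivity)
  have hstep2 : ∀ d₁ d₂, 1 ≤ d₁ → d₁ < Q → 1 ≤ d₂ → d₂ < Q →
      ‖∑ i ∈ range (K - d₁ - d₂), e ((g (i + d₂ + d₁) - g (i + d₂)) - (g (i + d₁) - g i))‖ ≤ M' := by
    intro d₁ d₂ h1 h1' h2 h2'
    set f : ℕ → ℝ := fun j => (g (j + d₂ + d₁) - g (j + d₂)) - (g (j + d₁) - g j) with hf
    have r1 : (1 : ℝ) ≤ d₁ := by exact_mod_cast h1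
    have r2 : (1 : ℝ) ≤ d₂ := by exact_mod_cast h2
    have r3 : (d₁ : ℝ) ≤ Q := by exact_mod_cast h1'.le
    have r4 : (d₂ : ℝ) ≤ Q := by exact_mod_cast h2'.le
    have hl : (0 : ℝ) < d₁ * d₂ * η ^ 4 := by positivity
    have ht := norm_sum_e_le_of_second_diff f 0 (K - d₁ - d₂) hl hA
      (fun i _ hi => (h d₁ d₂ i h1 h2 (by omega) f hf).1)
      (fun i _ hi => (h d₁ d₂ i h1 h2 (by omega) f hf).2)
    rw [Nat.Ico_zero_eq_range] at ht
    refine ht.trans ?_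
    rw [hM']
    have hup : √((d₁ : ℝ) * d₂ * η ^ 4) ≤ η := by
      rw [Real.sqrt_le_left hη.le]
      have h5 : (d₁ : ℝ) * d₂ ≤ Q * Q := mul_le_mul r3 r4 (by positivity) hQ0.le
      calc (d₁ : ℝ) * d₂ * η ^ 4 ≤ Q * Q * η ^ 4 := by gcongr
        _ = (Q * η) ^ 2 * η ^ 2 := by ring
        _ ≤ 1 ^ 2 * η ^ 2 := by gcongr
        _ = η ^ 2 := by ring
    have hdn : η ^ 2 ≤ √((d₁ : ℝ) * d₂ * η ^ 4) := by
      apply Real.le_sqrt_of_sq_le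
      have h5 : (1 : ℝ) ≤ (d₁ : ℝ) * d₂ := by nlinarith
      have h6 : 0 < η ^ 4 := by positivity
      nlinarith
    have hcast : ((K - d₁ - d₂ - 0 : ℕ) : ℝ) ≤ K := by
      exact_mod_cast (by omega : K - d₁ - d₂ - 0 ≤ K)
    gcongr
  have hconj : ∀ (f : ℕ → ℝ) (d k : ℕ),
      ∑ i ∈ range k, e (f (i + d)) * (starRingEnd ℂ) (e (f i)) =
        ∑ i ∈ range k, e (f (i + d) - f i) := by
    intro f d k
    exact Finset.sum_congr rfl fun i _ => (e_sub _ _).symm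
  have hstep1 : ∀ d, 1 ≤ d → d < Q →
      ‖∑ i ∈ range (K - d), e (g (i + d)) * (starRingEnd ℂ) (e (g i))‖ ≤ M := by
    intro d hd hd'
    rw [hconj]
    have hw := norm_sum_sq_le_of_correlation (fun i => e (g (i + d) - g i)) (K - d) Q hQ1 hM'0
      (fun i => (norm_e _).le) (fun d₂ h2 h2' => by
        have h5 := hconj (fun i => g (i + d) - g i) d₂ (K - d - d₂)
        exact (congrArg norm h5).le.trans (hstep2 d d₂ hd hd' h2 h2'))
    apply Real.le_sqrt_of_sq_le
    refine hw.trans ?_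
    have hcast : ((K - d : ℕ) : ℝ) ≤ K := by exact_mod_cast Nat.sub_le _ _
    apply mul_le_mul _ _ (by positivity) (by positivity)
    · linarith
    · gcongr
  have hw := norm_sum_sq_le_of_correlation (fun i => e (g i)) K Q hQ1 (Real.sqrt_nonneg _)
    (fun i => (norm_e _).le) hstep1
  have hw2 : ‖∑ i ∈ range K, e (g i)‖ ^ 2 ≤ 2 * K * (K / Q + M) := by
    refine hw.trans ?_
    have : 0 ≤ (K : ℝ) / Q + M := by positivity
    apply mul_le_mul_of_nonneg_right _ this
    linarith
  have hdivQ : (K : ℝ) / Q ≤ 2 * η * K := by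
    rw [div_eq_mul_one_div, mul_comm]
    gcongr
  have hdivQ' : (K : ℝ) / Q ≤ K := div_le_self hK0 (by exact_mod_cast hQ1)
  have hdiv0 : 0 ≤ (K : ℝ) / Q := by positivity
  calc ‖∑ i ∈ range K, e (g i)‖ ^ 4 = (‖∑ i ∈ range K, e (g i)‖ ^ 2) ^ 2 := by ring
    _ ≤ (2 * K * (K / Q + M)) ^ 2 := by gcongr
    _ ≤ 8 * K ^ 2 * ((K / Q) ^ 2 + M ^ 2) := by
        have : (K / Q + M) ^ 2 ≤ 2 * ((K / Q) ^ 2 + M ^ 2) := by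
          nlinarith [sq_nonneg (K / Q - M)]
        have h0 : 0 ≤ (K : ℝ) ^ 2 := by positivity
        nlinarith
    _ ≤ 8 * K ^ 2 * (K * (2 * η * K) + 2 * K * (2 * η * K + M')) := by
        rw [hMsq]
        have h1 : ((K : ℝ) / Q) ^ 2 ≤ K * (2 * η * K) := by
          rw [sq]; exact mul_le_mul hdivQ' hdivQ hdiv0 hK0
        gcongr
    _ = 48 * (K ^ 4 * η) + 16 * K ^ 3 * M' := by ring
    _ = 48 * (K ^ 4 * η) + 2016 * A * (K ^ 4 * η + K ^ 3 / η ^ 2) := by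
        rw [hM']; field_simp; ring
    _ ≤ _ := by
        have h1 : 0 ≤ (K : ℝ) ^ 4 * η := by positivity
        have h2 : 0 ≤ (K : ℝ) ^ 3 / η ^ 2 := by positivity
        nlinarith [mul_nonneg (sub_nonneg.mpr hA) h1, mul_nonneg (sub_nonneg.mpr hA) h2]

/-! ### Comparison of a sum with an integral -/

theorem continuous_e : Continuous e := by
  unfold e
  fun_prop

theorem hasDerivAt_e_comp {f : ℝ → ℝ} {f' x : ℝ} (hf : HasDerivAt f f' x) :
    HasDerivAt (fun u => e (f u)) (e (f x) * (2 * Real.pi * Complex.I * f')) x := by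
  unfold e
  exact (hf.ofReal_comp.const_mul (2 * (Real.pi : ℂ) * Complex.I)).cexp

/-- The integral of `e (d t)` over `0 ≤ t ≤ 1`. -/
noncomputable def unitIntegral (d : ℝ) : ℂ := ∫ t in (0 : ℝ)..1, e (d * t)

/-- The integral of `(1 - t) e (d t)` over `0 ≤ t ≤ 1`. -/
noncomputable def weightedUnitIntegral (d : ℝ) : ℂ := ∫ t in (0 : ℝ)..1, (1 - t : ℂ) * e (d * t)

theorem continuous_e_mul (d : ℝ) : Continuous fun t : ℝ => e (d * t) :=
  continuous_e.comp (continuous_const.mul continuous_id)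

theorem continuous_weighted_e_mul (d : ℝ) : Continuous fun t : ℝ => (1 - t : ℂ) * e (d * t) :=
  (continuous_const.sub Complex.continuous_ofReal).mul (continuous_e_mul d)

theorem two_pi_I_mul_unitIntegral (d : ℝ) :
    2 * Real.pi * Complex.I * d * unitIntegral d = e d - 1 := by
  have h : ∀ t ∈ Set.uIcc (0 : ℝ) 1, HasDerivAt (fun t : ℝ => e (d * t))
      (e (d * t) * (2 * Real.pi * Complex.I * d)) t := by
    intro t _
    have := hasDerivAt_e_comp ((hasDerivAt_id t).const_mul d)
    simpa using this
  have h2 := intervalIntegral.integral_eq_sub_of_hasDerivAt h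
    ((continuous_e_mul d).mul continuous_const |>.intervalIntegrable _ _)
  rw [intervalIntegral.integral_mul_const, mul_one, mul_zero, e_zero] at h2
  rw [← h2, unitIntegral]
  ring

/-- Integration by parts. The factor `d` made explicit here cancels the one in
`two_pi_I_mul_unitIntegral`, so the comparison of sum and integral is not singular where the
difference of the phase vanishes. -/
theorem unitIntegral_sub_one (d : ℝ) :
    unitIntegral d - 1 = 2 * Real.pi * Complex.I * d * weightedUnitIntegral d := by
  have h : ∀ t ∈ Set.uIcc (0 : ℝ) 1, HasDerivAt (fun t : ℝ => (1 - t : ℂ) * e (d * t))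
      (-e (d * t) + (2 * Real.pi * Complex.I * d) * ((1 - t : ℂ) * e (d * t))) t := by
    intro t _
    have h1 := hasDerivAt_e_comp ((hasDerivAt_id t).const_mul d)
    have h2 : HasDerivAt (fun t : ℝ => (1 - t : ℂ)) (-1) t := by
      simpa using ((hasDerivAt_id t).ofReal_comp).const_sub (1 : ℂ)
    have h3 : HasDerivAt (fun t : ℝ => (1 - t : ℂ) * e (d * t)) _ t := h2.mul h1
    refine h3.congr_deriv ?_
    simp only [id, mul_one]
    ring
  have c1 : Continuous fun t : ℝ => -e (d * t) := (continuous_e_mul d).neg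
  have c2 : Continuous fun t : ℝ => 2 * Real.pi * Complex.I * d * ((1 - t : ℂ) * e (d * t)) :=
    continuous_const.mul (continuous_weighted_e_mul d)
  have h2 := intervalIntegral.integral_eq_sub_of_hasDerivAt h
    ((c1.add c2).intervalIntegrable _ _)
  rw [intervalIntegral.integral_add (c1.intervalIntegrable _ _) (c2.intervalIntegrable _ _),
    intervalIntegral.integral_neg, intervalIntegral.integral_const_mul] at h2
  simp only [mul_zero, e_zero, Complex.ofReal_zero, Complex.ofReal_one, sub_self, zero_mul,
    sub_zero, mul_one] at h2
  rw [unitIntegral, weightedUnitIntegral]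
  linear_combination -h2

theorem norm_integral_unit_le {f : ℝ → ℂ} {C : ℝ} (h : ∀ t, 0 ≤ t → t ≤ 1 → ‖f t‖ ≤ C) :
    ‖∫ t in (0 : ℝ)..1, f t‖ ≤ C := by
  have := intervalIntegral.norm_integral_le_of_norm_le_const (a := 0) (b := 1) (f := f) (C := C)
    (fun t ht => by
      rw [Set.uIoc_of_le zero_le_one] at ht
      exact h t ht.1.le ht.2)
  simpa using this

theorem norm_one_sub_le_one {t : ℝ} (h0 : 0 ≤ t) (h1 : t ≤ 1) : ‖(1 - t : ℂ)‖ ≤ 1 := by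
  rw [show (1 - t : ℂ) = ((1 - t : ℝ) : ℂ) by push_cast; ring, Complex.norm_real,
    Real.norm_eq_abs, abs_of_nonneg (by linarith)]
  linarith

theorem norm_unitIntegral_le (d : ℝ) : ‖unitIntegral d‖ ≤ 1 :=
  norm_integral_unit_le fun _ _ _ => (norm_e _).le

theorem norm_weightedUnitIntegral_le (d : ℝ) : ‖weightedUnitIntegral d‖ ≤ 1 :=
  norm_integral_unit_le fun t h0 h1 => by
    rw [norm_mul, norm_e, mul_one]
    exact norm_one_sub_le_one h0 h1

theorem norm_e_mul_sub_le (d d' : ℝ) {t : ℝ} (h0 : 0 ≤ t) (h1 : t ≤ 1) :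
    ‖e (d * t) - e (d' * t)‖ ≤ 2 * Real.pi * |d - d'| := by
  refine (norm_e_sub_le _ _).trans ?_
  rw [← sub_mul, abs_mul, abs_of_nonneg h0]
  have : |d - d'| * t ≤ |d - d'| := mul_le_of_le_one_right (abs_nonneg _) h1
  gcongr

theorem norm_unitIntegral_sub_le (d d' : ℝ) :
    ‖unitIntegral d - unitIntegral d'‖ ≤ 2 * Real.pi * |d - d'| := by
  rw [unitIntegral, unitIntegral, ← intervalIntegral.integral_sub
    ((continuous_e_mul d).intervalIntegrable _ _) ((continuous_e_mul d').intervalIntegrable _ _)]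
  exact norm_integral_unit_le fun t h0 h1 => norm_e_mul_sub_le d d' h0 h1

theorem norm_weightedUnitIntegral_sub_le (d d' : ℝ) :
    ‖weightedUnitIntegral d - weightedUnitIntegral d'‖ ≤ 2 * Real.pi * |d - d'| := by
  rw [weightedUnitIntegral, weightedUnitIntegral, ← intervalIntegral.integral_sub
    ((continuous_weighted_e_mul d).intervalIntegrable _ _)
    ((continuous_weighted_e_mul d').intervalIntegrable _ _)]
  refine norm_integral_unit_le fun t h0 h1 => ?_
  rw [← mul_sub, norm_mul]
  calc _ ≤ 1 * ‖e (d * t) - e (d' * t)‖ := by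
        gcongr
        exact norm_one_sub_le_one h0 h1
    _ ≤ _ := by rw [one_mul]; exact norm_e_mul_sub_le d d' h0 h1

theorem one_le_two_pi_mul_norm_unitIntegral {d : ℝ} (hd : |d| ≤ 3 / 4) :
    1 ≤ 2 * Real.pi * ‖unitIntegral d‖ := by
  rcases eq_or_ne d 0 with rfl | h
  · have : unitIntegral 0 = 1 := by simp [unitIntegral, e_zero]
    rw [this, norm_one]
    linarith [Real.pi_gt_three]
  · have h1 := abs_le_norm_e_sub_one hd
    rw [← two_pi_I_mul_unitIntegral, norm_mul, norm_mul, norm_mul, norm_mul, Complex.norm_I,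
      Complex.norm_real, Complex.norm_real, Real.norm_eq_abs, Real.norm_eq_abs,
      abs_of_pos Real.pi_pos, Complex.norm_ofNat] at h1
    have h2 : 0 < |d| := abs_pos.mpr h
    have h3 : |d| * 1 ≤ |d| * (2 * Real.pi * ‖unitIntegral d‖) := by linarith
    exact le_of_mul_le_mul_left h3 h2

/-- The product e(g i) times `unitIntegral` is the integral of e along the chord from g i to g
(i+1). The error of replacing a term by it equals -(W/U)(e(g (i+1)) - e(g i)), where U and W are the
plain and the weighted unit integral at the difference d. Since U stays away from 0 for |d| ≤ 3/4,
W/U is Lipschitz in d; as d is monotone and bounded, summation by parts leaves O(1), however long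
the sum. -/
theorem norm_sum_e_sub_e_mul_unitIntegral_le (g : ℕ → ℝ) (m n : ℕ)
    (h1 : ∀ i, m ≤ i → i < n → |g (i + 1) - g i| ≤ 3 / 4)
    (h2 : ∀ i, m ≤ i → i + 1 < n → g (i + 1) - g i ≤ g (i + 1 + 1) - g (i + 1)) :
    ‖∑ i ∈ Ico m n, (e (g i) - e (g i) * unitIntegral (g (i + 1) - g i))‖ ≤ 1520 := by
  rcases Nat.lt_or_ge m n with hmn | hmn
  swap
  · rw [Finset.Ico_eq_empty (by omega)]
    simp
  obtain ⟨n, rfl⟩ : ∃ k, n = k + 1 := ⟨n - 1, by omega⟩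
  have hmn' : m ≤ n := by omega
  have hpi := Real.pi_lt_d2
  have hpi0 := Real.pi_pos
  set d : ℕ → ℝ := fun i => g (i + 1) - g i with hd
  have hpos : ∀ i, m ≤ i → i < n + 1 → 0 < ‖unitIntegral (d i)‖ := by
    intro i hi hi'
    have := one_le_two_pi_mul_norm_unitIntegral (h1 i hi hi')
    by_contra hc
    have h0 : ‖unitIntegral (d i)‖ = 0 := le_antisymm (not_lt.mp hc) (norm_nonneg _)
    rw [h0] at this
    linarith
  have hinv : ∀ i, m ≤ i → i < n + 1 → ‖unitIntegral (d i)‖⁻¹ ≤ 2 * Real.pi := by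
    intro i hi hi'
    have := one_le_two_pi_mul_norm_unitIntegral (h1 i hi hi')
    rw [inv_le_iff_one_le_mul₀ (hpos i hi hi')]
    exact this
  have heq : ∀ i ∈ Ico m (n + 1), e (g i) - e (g i) * unitIntegral (g (i + 1) - g i) =
      -(weightedUnitIntegral (d i) / unitIntegral (d i)) * (e (g (i + 1)) - e (g i)) := by
    intro i hi
    rw [Finset.mem_Ico] at hi
    have hne : unitIntegral (d i) ≠ 0 := norm_pos_iff.mp (hpos i hi.1 hi.2)
    have h4 : e (g (i + 1)) = e (g i) * e (d i) := by
      rw [← e_add]; congr 1; simp [hd]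
    have h5 := two_pi_I_mul_unitIntegral (d i)
    have h6 := unitIntegral_sub_one (d i)
    change e (g i) - e (g i) * unitIntegral (d i) = _
    rw [h4]
    field_simp
    have h7 : e (d i) = 1 + 2 * Real.pi * Complex.I * d i * unitIntegral (d i) := by
      rw [h5]; ring
    rw [h7]
    linear_combination (-(e (g i) * unitIntegral (d i))) * h6
  rw [Finset.sum_congr rfl heq]
  refine (norm_sum_mul_le_of_abel hmn'
    (fun i => -(weightedUnitIntegral (d i) / unitIntegral (d i)))
    (fun i => e (g (i + 1)) - e (g i)) (fun i => 500 * d i) (M := 2) (W := 2 * Real.pi)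
    ?_ ?_ ?_).trans ?_
  · intro j hj hj'
    rw [Finset.sum_Ico_sub (fun i => e (g i)) hj]
    refine (norm_sub_le _ _).trans ?_
    rw [norm_e, norm_e]
    norm_num
  · rw [norm_neg, norm_div, div_eq_mul_inv]
    calc _ ≤ 1 * (2 * Real.pi) := mul_le_mul (norm_weightedUnitIntegral_le _)
          (hinv n hmn' (by omega)) (by positivity) zero_le_one
      _ = _ := one_mul _
  · intro i hi hi'
    have p1 := hpos i hi (by omega)
    have p2 := hpos (i + 1) (by omega) (by omega)
    have q1 := hinv i hi (by omega)
    have q2 := hinv (i + 1) (by omega) (by omega)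
    have hne1 : unitIntegral (d i) ≠ 0 := norm_pos_iff.mp p1
    have hne2 : unitIntegral (d (i + 1)) ≠ 0 := norm_pos_iff.mp p2
    have hid : -(weightedUnitIntegral (d (i + 1)) / unitIntegral (d (i + 1))) -
        -(weightedUnitIntegral (d i) / unitIntegral (d i)) =
        (weightedUnitIntegral (d i) * (unitIntegral (d (i + 1)) - unitIntegral (d i)) +
          (weightedUnitIntegral (d i) - weightedUnitIntegral (d (i + 1))) * unitIntegral (d i)) *
          (unitIntegral (d i))⁻¹ * (unitIntegral (d (i + 1)))⁻¹ := by
      field_simp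
      ring
    rw [hid, norm_mul, norm_mul, norm_inv, norm_inv]
    have hm : d i ≤ d (i + 1) := h2 i hi (by omega)
    have hn1 : ‖weightedUnitIntegral (d i) * (unitIntegral (d (i + 1)) - unitIntegral (d i)) +
          (weightedUnitIntegral (d i) - weightedUnitIntegral (d (i + 1))) * unitIntegral (d i)‖ ≤
          4 * Real.pi * (d (i + 1) - d i) := by
      refine (norm_add_le _ _).trans ?_
      rw [norm_mul, norm_mul]
      have a1 := norm_unitIntegral_sub_le (d (i + 1)) (d i)
      have a2 := norm_weightedUnitIntegral_sub_le (d i) (d (i + 1))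
      rw [abs_sub_comm] at a2
      rw [abs_of_nonneg (by linarith)] at a1 a2
      have b1 := mul_le_mul (norm_weightedUnitIntegral_le (d i)) a1 (norm_nonneg _) zero_le_one
      have b2 := mul_le_mul a2 (norm_unitIntegral_le (d i)) (norm_nonneg _)
        (mul_nonneg (by positivity) (sub_nonneg.mpr hm))
      linarith
    have hdd : 0 ≤ d (i + 1) - d i := by linarith
    calc _ ≤ 4 * Real.pi * (d (i + 1) - d i) * (2 * Real.pi) * (2 * Real.pi) := by gcongr
      _ = 16 * Real.pi ^ 3 * (d (i + 1) - d i) := by ring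
      _ ≤ 16 * 3.1416 ^ 3 * (d (i + 1) - d i) := by
          have := Real.pi_lt_d4
          gcongr
      _ ≤ 500 * d (i + 1) - 500 * d i := by nlinarith
  · have a := abs_le.mp (h1 n hmn' (by omega))
    have b := abs_le.mp (h1 m le_rfl (by omega))
    have c : d n - d m ≤ 3 / 2 := by simp only [hd]; linarith
    nlinarith

/-- Comparison of an exponential sum with phase `Y / u + ν u` with the corresponding integral. -/
theorem norm_sum_sub_integral_le {Y ν α b : ℝ} (hY : 0 < Y) (hb : 0 < b) (hα : 0 ≤ α) {m n : ℕ}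
    (hmn : m ≤ n) (hm : b ≤ m + α)
    (h1 : ∀ i : ℕ, m ≤ i → i < n → |ν - Y / ((i + α) * (i + α + 1))| ≤ 3 / 4) :
    ‖∑ i ∈ Ico m n, e (Y / (i + α) + ν * (i + α)) -
      ∫ u in (m + α : ℝ)..(n + α : ℝ), e (Y / u + ν * u)‖ ≤
      1520 + 2 * Real.pi * (Y / b ^ 3) * ((n : ℝ) - m) := by
  set g : ℕ → ℝ := fun i => Y / (i + α) + ν * (i + α) with hg
  have hpos : ∀ i : ℕ, m ≤ i → b ≤ (i : ℝ) + α := by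
    intro i hi
    have : (m : ℝ) ≤ i := by exact_mod_cast hi
    linarith
  have hdiff : ∀ i : ℕ, m ≤ i → g (i + 1) - g i = ν - Y / ((i + α) * (i + α + 1)) := by
    intro i hi
    have := hb.trans_le (hpos i hi)
    simp only [hg]
    push_cast
    rw [show (i : ℝ) + 1 + α = i + α + 1 by ring]
    field_simp
    ring
  have hsum := norm_sum_e_sub_e_mul_unitIntegral_le g m n
    (fun i hi hi' => by rw [hdiff i hi]; exact h1 i hi hi')
    (fun i hi hi' => by
      rw [hdiff i hi, hdiff (i + 1) (by omega)]
      have := hb.trans_le (hpos i hi)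
      push_cast
      apply sub_le_sub_left
      gcongr <;> linarith)
  have hcont : ∀ i : ℕ, m ≤ i → ContinuousOn (fun t : ℝ => e (Y / (i + α + t) + ν * (i + α + t)))
      (Set.uIcc 0 1) := by
    intro i hi
    have := hb.trans_le (hpos i hi)
    apply continuous_e.comp_continuousOn
    apply ContinuousOn.add _ (by fun_prop)
    apply ContinuousOn.div continuousOn_const (by fun_prop)
    intro t ht
    rw [Set.uIcc_of_le zero_le_one] at ht
    have := ht.1
    positivity
  have hint : ∫ u in (m + α : ℝ)..(n + α : ℝ), e (Y / u + ν * u) =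
      ∑ i ∈ Ico m n, ∫ t in (0 : ℝ)..1, e (Y / (i + α + t) + ν * (i + α + t)) := by
    have h2 := intervalIntegral.sum_integral_adjacent_intervals_Ico (a := fun i : ℕ => (i + α : ℝ))
      (f := fun u => e (Y / u + ν * u)) (μ := MeasureTheory.volume) hmn (fun i hi => by
        rw [Set.mem_Ico] at hi
        apply ContinuousOn.intervalIntegrable
        apply continuous_e.comp_continuousOn
        apply ContinuousOn.add _ (by fun_prop)
        apply ContinuousOn.div continuousOn_const (by fun_prop)
        intro t ht
        have := hpos i hi.1
        push_cast at ht
        rw [Set.uIcc_of_le (by linarith)] at ht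
        have := ht.1
        exact (by linarith : (0 : ℝ) < t).ne')
    rw [← h2]
    refine Finset.sum_congr rfl fun i _ => ?_
    have h3 := intervalIntegral.integral_comp_add_left (fun u => e (Y / u + ν * u)) (a := 0)
      (b := 1) ((i : ℝ) + α)
    rw [h3]
    push_cast
    congr 1 <;> ring
  have hpiece : ∀ i ∈ Ico m n, ‖e (g i) * unitIntegral (g (i + 1) - g i) -
      ∫ t in (0 : ℝ)..1, e (Y / (i + α + t) + ν * (i + α + t))‖ ≤ 2 * Real.pi * (Y / b ^ 3) := by
    intro i hi
    rw [Finset.mem_Ico] at hi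
    have hu := hpos i hi.1
    have hu0 := hb.trans_le hu
    have c1 : Continuous fun t : ℝ => e (g i) * e ((g (i + 1) - g i) * t) :=
      continuous_const.mul (continuous_e_mul _)
    rw [unitIntegral, ← intervalIntegral.integral_const_mul, ← intervalIntegral.integral_sub
      (c1.intervalIntegrable _ _)
      (hcont i hi.1).intervalIntegrable]
    refine norm_integral_unit_le fun t h0 h1 => ?_
    rw [← e_add]
    refine (norm_e_sub_le _ _).trans ?_
    -- The gap between chord and curve: the linear part νu drops out, and the convexity of Y/u gives
    -- it exactly.
    have hid : g i + (g (i + 1) - g i) * t - (Y / (i + α + t) + ν * (i + α + t)) =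
        Y * (t * (1 - t)) / ((i + α) * (i + α + t) * (i + α + 1)) := by
      rw [hdiff i hi.1]
      simp only [hg]
      field_simp
      ring
    rw [hid, abs_of_nonneg (by
      have : 0 ≤ 1 - t := by linarith
      positivity)]
    have h5 : Y * (t * (1 - t)) ≤ Y :=
      mul_le_of_le_one_right hY.le (by nlinarith)
    have h6 : b ^ 3 ≤ ((i : ℝ) + α) * (i + α + t) * (i + α + 1) := by
      calc b ^ 3 = b * b * b := by ring
        _ ≤ _ := by gcongr <;> linarith
    gcongr
  have hsplit : ∑ i ∈ Ico m n, e (g i) - ∫ u in (m + α : ℝ)..(n + α : ℝ), e (Y / u + ν * u) =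
      ∑ i ∈ Ico m n, (e (g i) - e (g i) * unitIntegral (g (i + 1) - g i)) +
      ∑ i ∈ Ico m n, (e (g i) * unitIntegral (g (i + 1) - g i) -
        ∫ t in (0 : ℝ)..1, e (Y / (i + α + t) + ν * (i + α + t))) := by
    rw [hint, ← Finset.sum_add_distrib, ← Finset.sum_sub_distrib]
    exact Finset.sum_congr rfl fun i _ => by ring
  rw [hsplit]
  refine (norm_add_le _ _).trans (add_le_add hsum ?_)
  refine (norm_sum_le _ _).trans ((Finset.sum_le_sum hpiece).trans ?_)
  rw [Finset.sum_const, Nat.card_Ico, nsmul_eq_mul, Nat.cast_sub hmn, mul_comm]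

/-! ### Fresnel integrals and stationary phase -/

/-- The Fresnel integral of `e (w ^ 2)` over `0 ≤ w ≤ v`. -/
noncomputable def fresnel (v : ℝ) : ℂ := ∫ w in (0 : ℝ)..v, e (w ^ 2)

theorem continuous_e_sq : Continuous fun w : ℝ => e (w ^ 2) :=
  continuous_e.comp (continuous_pow 2)

theorem hasDerivAt_fresnel (v : ℝ) : HasDerivAt fresnel (e (v ^ 2)) v :=
  (continuous_e_sq.integral_hasStrictDerivAt 0 v).hasDerivAt

theorem fresnel_neg (v : ℝ) : fresnel (-v) = -fresnel v := by
  have h := intervalIntegral.integral_comp_neg (fun w : ℝ => e (w ^ 2)) (a := 0) (b := v)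
  simp only [neg_sq, neg_zero] at h
  rw [fresnel, fresnel, h, intervalIntegral.integral_symm]

/-- One integration by parts: subtracting e(w^2)/(4πiw) from the Fresnel integral leaves the
derivative e(w^2)/(4πiw^2), which is absolutely integrable at infinity. -/
theorem norm_fresnel_sub_le {v₁ v₂ : ℝ} (h1 : 0 < v₁) (h2 : v₁ ≤ v₂) :
    ‖fresnel v₂ - fresnel v₁‖ ≤ 1 / v₁ := by
  set D : ℝ → ℂ := fun w => fresnel w - e (w ^ 2) * (1 / (4 * Real.pi * Complex.I)) * (w⁻¹ : ℝ)
    with hD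
  have hpi0 := Real.pi_pos
  have hpiC : (Real.pi : ℂ) ≠ 0 := by exact_mod_cast hpi0.ne'
  have hder : ∀ w ∈ Set.uIcc v₁ v₂, HasDerivAt D
      (e (w ^ 2) * (1 / (4 * Real.pi * Complex.I)) * ((w ^ 2)⁻¹ : ℝ)) w := by
    intro w hw
    rw [Set.uIcc_of_le h2] at hw
    have hw0 : w ≠ 0 := (h1.trans_le hw.1).ne'
    have hwC : (w : ℂ) ≠ 0 := by exact_mod_cast hw0
    have a := hasDerivAt_e_comp (hasDerivAt_pow 2 w)
    have b := (hasDerivAt_inv hw0).ofReal_comp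
    have c := (hasDerivAt_fresnel w).sub ((a.mul_const (1 / (4 * Real.pi * Complex.I))).mul b)
    refine HasDerivAt.congr_deriv (f := D) c ?_
    push_cast
    field_simp
    ring_nf
  have hci : ContinuousOn (fun w : ℝ => e (w ^ 2) * (1 / (4 * Real.pi * Complex.I)) *
      ((w ^ 2)⁻¹ : ℝ)) (Set.uIcc v₁ v₂) := by
    apply (continuous_e_sq.mul continuous_const).continuousOn.mul
    apply Complex.continuous_ofReal.comp_continuousOn
    apply ContinuousOn.inv₀ (by fun_prop)
    intro w hw
    rw [Set.uIcc_of_le h2] at hw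
    have hw0 : 0 < w := h1.trans_le hw.1
    positivity
  have hI := intervalIntegral.integral_eq_sub_of_hasDerivAt hder hci.intervalIntegrable
  have hv2 : 0 < v₂ := h1.trans_le h2
  have hc : ‖(1 / (4 * Real.pi * Complex.I) : ℂ)‖ ≤ 1 / 12 := by
    rw [norm_div, norm_mul, norm_mul, Complex.norm_I, Complex.norm_real, Real.norm_eq_abs,
      abs_of_pos hpi0, norm_one, Complex.norm_ofNat, mul_one]
    apply one_div_le_one_div_of_le (by norm_num)
    linarith [Real.pi_gt_three]
  have hcw : ∀ x y : ℝ, 0 < y → ‖e x * (1 / (4 * Real.pi * Complex.I)) * (y : ℂ)‖ ≤ 1 / 12 * y := by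
    intro x y hy
    rw [norm_mul, norm_mul, norm_e, one_mul, Complex.norm_real, Real.norm_eq_abs, abs_of_pos hy]
    gcongr
  have hIb : ‖∫ w in v₁..v₂, e (w ^ 2) * (1 / (4 * Real.pi * Complex.I)) * ((w ^ 2)⁻¹ : ℝ)‖ ≤
      1 / 12 * (v₁⁻¹ - v₂⁻¹) := by
    have hder2 : ∀ w ∈ Set.uIcc v₁ v₂, HasDerivAt (fun w : ℝ => -(1 / 12) * w⁻¹)
        (1 / 12 * (w ^ 2)⁻¹) w := by
      intro w hw
      rw [Set.uIcc_of_le h2] at hw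
      have := (hasDerivAt_inv (h1.trans_le hw.1).ne').const_mul (-(1 / 12 : ℝ))
      exact this.congr_deriv (by ring)
    have hci2 : ContinuousOn (fun w : ℝ => 1 / 12 * (w ^ 2)⁻¹) (Set.uIcc v₁ v₂) := by
      apply continuousOn_const.mul
      apply ContinuousOn.inv₀ (by fun_prop)
      intro w hw
      rw [Set.uIcc_of_le h2] at hw
      have hw0 : 0 < w := h1.trans_le hw.1
      positivity
    have hI2 := intervalIntegral.integral_eq_sub_of_hasDerivAt hder2 hci2.intervalIntegrable
    calc _ ≤ ∫ w in v₁..v₂, 1 / 12 * (w ^ 2)⁻¹ := by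
          apply intervalIntegral.norm_integral_le_of_norm_le h2 _ hci2.intervalIntegrable
          refine Filter.Eventually.of_forall fun w hw => hcw _ _ ?_
          have : 0 < w := h1.trans hw.1
          positivity
      _ = _ := by rw [hI2]; ring
  have hfin : fresnel v₂ - fresnel v₁ =
      (∫ w in v₁..v₂, e (w ^ 2) * (1 / (4 * Real.pi * Complex.I)) * ((w ^ 2)⁻¹ : ℝ)) +
      e (v₂ ^ 2) * (1 / (4 * Real.pi * Complex.I)) * (v₂⁻¹ : ℝ) -
      e (v₁ ^ 2) * (1 / (4 * Real.pi * Complex.I)) * (v₁⁻¹ : ℝ) := by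
    rw [hI]
    simp only [hD]
    ring
  rw [hfin]
  refine (norm_sub_le _ _).trans ((add_le_add ((norm_add_le _ _).trans
    (add_le_add hIb (hcw _ _ (by positivity)))) (hcw _ _ (by positivity))).trans ?_)
  rw [one_div v₁]
  have : 0 < v₁⁻¹ := by positivity
  linarith

/-- Only the existence of the limit and the rate are needed. The value of `F` goes into implied
constants. -/
theorem exists_fresnel_limit : ∃ F : ℂ, ∀ v : ℝ, 0 < v → ‖fresnel v - F‖ ≤ 1 / v := by
  have hcau : CauchySeq fun n : ℕ => fresnel (n + 1) := by
    apply cauchySeq_of_le_tendsto_0 (fun n : ℕ => 2 / ((n : ℝ) + 1))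
    · have hkey : ∀ N n : ℕ, N ≤ n → ‖fresnel (n + 1) - fresnel (N + 1)‖ ≤ 1 / ((N : ℝ) + 1) := by
        intro N n hn
        apply norm_fresnel_sub_le (by positivity)
        have : (N : ℝ) ≤ n := by exact_mod_cast hn
        linarith
      intro n m N hn hm
      refine (dist_triangle_right _ _ (fresnel (N + 1))).trans ?_
      rw [dist_eq_norm, dist_eq_norm]
      have := hkey N n hn
      have := hkey N m hm
      rw [show 2 / ((N : ℝ) + 1) = 1 / ((N : ℝ) + 1) + 1 / ((N : ℝ) + 1) by ring]
      linarith
    · have := tendsto_one_div_add_atTop_nhds_zero_nat (𝕜 := ℝ)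
      have h2 := this.const_mul 2
      simp only [mul_zero] at h2
      refine h2.congr fun n => ?_
      ring
  obtain ⟨F, hF⟩ := cauchySeq_tendsto_of_complete hcau
  refine ⟨F, fun v hv => ?_⟩
  have hlim : Filter.Tendsto (fun n : ℕ => ‖fresnel v - fresnel (n + 1)‖) Filter.atTop
      (nhds ‖fresnel v - F‖) := (tendsto_const_nhds.sub hF).norm
  apply le_of_tendsto hlim
  filter_upwards [Filter.eventually_ge_atTop ⌈v⌉₊] with n hn
  rw [norm_sub_rev]
  apply norm_fresnel_sub_le hv
  have : v ≤ n := Nat.ceil_le.mp hn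
  linarith

/-- Exact reduction of an integral with phase `(a (s - c² / s))²` to Fresnel integrals. -/
theorem norm_integral_sub_fresnel_le {a c s₁ s₂ : ℝ} (ha : 0 < a) (hc : 0 < c) (h1 : 0 < s₁)
    (h12 : s₁ ≤ s₂) (h2 : s₂ ≤ 2 * c) :
    ‖(∫ s in s₁..s₂, e ((a * (s - c ^ 2 / s)) ^ 2) * (2 * s : ℝ)) -
      (c / a : ℝ) * (fresnel (a * (s₂ - c ^ 2 / s₂)) - fresnel (a * (s₁ - c ^ 2 / s₁)))‖ ≤
      6 / a ^ 2 := by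
  set v : ℝ → ℝ := fun s => a * (s - c ^ 2 / s) with hv
  set D : ℝ → ℝ := fun s => 2 * a ^ 2 * ((s + c) * (s ^ 2 + c ^ 2)) with hDdef
  -- This `k` solves 2s = (c/a)v' + 2kvv'. Since 2s and (c/a)v' agree at the stationary point s = c,
  -- the factor s - c cancels and `k` has no pole. The first part integrates to Fresnel integrals;
  -- the second is integrated by parts, with `k` of size 1/a^2 and `k'` of size 1/(a^2 c).
  set k : ℝ → ℝ := fun s => (s * (2 * s ^ 2 + c * s + c ^ 2)) / D s with hk
  set k' : ℝ → ℝ := fun s => ((6 * s ^ 2 + 2 * c * s + c ^ 2) * D s -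
    (s * (2 * s ^ 2 + c * s + c ^ 2)) * (2 * a ^ 2 * (3 * s ^ 2 + 2 * c * s + c ^ 2))) / D s ^ 2
    with hk'
  have hpi0 := Real.pi_pos
  have hpiC : (Real.pi : ℂ) ≠ 0 := by exact_mod_cast hpi0.ne'
  have hDpos : ∀ s, 0 < s → 0 < D s := by
    intro s hs
    simp only [hDdef]
    positivity
  have hvd : ∀ s, 0 < s → HasDerivAt v (a * (1 + c ^ 2 / s ^ 2)) s := by
    intro s hs
    have b := ((hasDerivAt_id s).sub ((hasDerivAt_inv hs.ne').const_mul (c ^ 2))).const_mul a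
    refine HasDerivAt.congr_deriv (f := v) b ?_
    ring
  have hkd : ∀ s, 0 < s → HasDerivAt k (k' s) s := by
    intro s hs
    have hN : HasDerivAt (fun s : ℝ => s * (2 * s ^ 2 + c * s + c ^ 2))
        (6 * s ^ 2 + 2 * c * s + c ^ 2) s := by
      have b := (hasDerivAt_id s).mul ((((hasDerivAt_pow 2 s).const_mul 2).add
        ((hasDerivAt_id s).const_mul c)).add_const (c ^ 2))
      refine HasDerivAt.congr_deriv
        (f := fun s : ℝ => s * (2 * s ^ 2 + c * s + c ^ 2)) b ?_
      simp only [id, Pi.add_apply, Nat.reduceSub, pow_one, Nat.cast_ofNat]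
      ring
    have hDd : HasDerivAt D (2 * a ^ 2 * (3 * s ^ 2 + 2 * c * s + c ^ 2)) s := by
      have b := (((hasDerivAt_id s).add_const c).mul
        ((hasDerivAt_pow 2 s).add_const (c ^ 2))).const_mul (2 * a ^ 2)
      refine HasDerivAt.congr_deriv (f := D) b ?_
      simp only [id, Nat.reduceSub, pow_one, Nat.cast_ofNat]
      ring
    exact hN.div hDd (hDpos s hs).ne'
  set B : ℝ → ℂ := fun s => (c / a : ℝ) * fresnel (v s) +
    (k s : ℂ) * (e (v s ^ 2) * (1 / (2 * Real.pi * Complex.I))) with hB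
  have hBd : ∀ s ∈ Set.uIcc s₁ s₂, HasDerivAt B (e (v s ^ 2) * (2 * s : ℝ) +
      (k' s : ℂ) * (e (v s ^ 2) * (1 / (2 * Real.pi * Complex.I)))) s := by
    intro s hs
    rw [Set.uIcc_of_le h12] at hs
    have hs0 : 0 < s := h1.trans_le hs.1
    have d1 := ((hasDerivAt_fresnel (v s)).scomp s (hvd s hs0)).const_mul ((c / a : ℝ) : ℂ)
    have d2 := hasDerivAt_e_comp ((hvd s hs0).pow 2)
    have d3 := (hkd s hs0).ofReal_comp.mul (d2.mul_const (1 / (2 * Real.pi * Complex.I)))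
    have d4 := d1.add d3
    refine HasDerivAt.congr_deriv (f := B) d4 ?_
    have hid : 2 * s = c / a * (a * (1 + c ^ 2 / s ^ 2)) +
        k s * (2 * v s * (a * (1 + c ^ 2 / s ^ 2))) := by
      simp only [hk, hv, hDdef]
      field_simp
      ring
    have hidC : ((2 * s : ℝ) : ℂ) = ((c / a * (a * (1 + c ^ 2 / s ^ 2)) +
        k s * (2 * v s * (a * (1 + c ^ 2 / s ^ 2))) : ℝ) : ℂ) := by
      rw [← hid]
    rw [hidC]
    have haC : (a : ℂ) ≠ 0 := by exact_mod_cast ha.ne'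
    have hsC : (s : ℂ) ≠ 0 := by exact_mod_cast hs0.ne'
    simp only [Complex.real_smul, Pi.pow_apply, Nat.reduceSub, pow_one]
    push_cast
    field_simp
    ring
  have hcv : ContinuousOn v (Set.uIcc s₁ s₂) := by
    intro s hs
    rw [Set.uIcc_of_le h12] at hs
    exact (hvd s (h1.trans_le hs.1)).continuousAt.continuousWithinAt
  have hcev : ContinuousOn (fun s => e (v s ^ 2)) (Set.uIcc s₁ s₂) :=
    continuous_e.comp_continuousOn (hcv.pow 2)
  have hck' : ContinuousOn k' (Set.uIcc s₁ s₂) := by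
    simp only [hk', hDdef]
    apply ContinuousOn.div (by fun_prop) (by fun_prop)
    intro s hs
    rw [Set.uIcc_of_le h12] at hs
    have hs0 : 0 < s := h1.trans_le hs.1
    positivity
  have c1 : ContinuousOn (fun s => e (v s ^ 2) * ((2 * s : ℝ) : ℂ)) (Set.uIcc s₁ s₂) :=
    hcev.mul (Complex.continuous_ofReal.comp_continuousOn (by fun_prop))
  have c2 : ContinuousOn (fun s => (k' s : ℂ) * (e (v s ^ 2) * (1 / (2 * Real.pi * Complex.I))))
      (Set.uIcc s₁ s₂) :=
    (Complex.continuous_ofReal.comp_continuousOn hck').mul (hcev.mul continuousOn_const)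
  have hI := intervalIntegral.integral_eq_sub_of_hasDerivAt hBd (c1.add c2).intervalIntegrable
  rw [intervalIntegral.integral_add c1.intervalIntegrable c2.intervalIntegrable] at hI
  have hcn : ‖(1 / (2 * Real.pi * Complex.I) : ℂ)‖ ≤ 1 / 6 := by
    rw [norm_div, norm_mul, norm_mul, Complex.norm_I, Complex.norm_real, Real.norm_eq_abs,
      abs_of_pos hpi0, norm_one, Complex.norm_ofNat, mul_one]
    apply one_div_le_one_div_of_le (by norm_num)
    linarith [Real.pi_gt_three]
  have hcw : ∀ x y C : ℝ, |y| ≤ C →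
      ‖(y : ℂ) * (e x * (1 / (2 * Real.pi * Complex.I)))‖ ≤ C * (1 / 6) := by
    intro x y C hy
    rw [norm_mul, norm_mul, norm_e, one_mul, Complex.norm_real, Real.norm_eq_abs]
    exact mul_le_mul hy hcn (norm_nonneg _) ((abs_nonneg _).trans hy)
  have hkb : ∀ s, 0 < s → |k s| ≤ 3 / (2 * a ^ 2) := by
    intro s hs
    have := hDpos s hs
    rw [abs_of_nonneg (by simp only [hk]; positivity)]
    simp only [hk, hDdef]
    rw [div_le_div_iff₀ (by positivity) (by positivity)]
    have h3 : s * (2 * s ^ 2 + c * s + c ^ 2) ≤ 3 * ((s + c) * (s ^ 2 + c ^ 2)) := by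
      have : 0 ≤ s ^ 3 + 2 * (c * s ^ 2) + 2 * (c ^ 2 * s) + 3 * c ^ 3 := by positivity
      nlinarith
    have h4 : 0 < 2 * a ^ 2 := by positivity
    nlinarith
  have hk'b : ∀ s, 0 < s → |k' s| ≤ 15 / (a ^ 2 * c) := by
    intro s hs
    have hD := hDpos s hs
    set P := (s + c) * (s ^ 2 + c ^ 2) with hP
    have hPpos : 0 < P := by positivity
    have hPD : D s = 2 * a ^ 2 * P := rfl
    have hfact : k' s = ((6 * s ^ 2 + 2 * c * s + c ^ 2) * P -
        (s * (2 * s ^ 2 + c * s + c ^ 2)) * (3 * s ^ 2 + 2 * c * s + c ^ 2)) /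
        (2 * a ^ 2 * P ^ 2) := by
      simp only [hk', hPD]
      field_simp
    rw [hfact, abs_div, abs_of_pos (show 0 < 2 * a ^ 2 * P ^ 2 by positivity),
      div_le_div_iff₀ (by positivity) (by positivity)]
    have e1 : c * (6 * s ^ 2 + 2 * c * s + c ^ 2) ≤ 6 * P := by
      have : 0 ≤ 6 * s ^ 3 + 4 * (c ^ 2 * s) + 5 * c ^ 3 := by positivity
      rw [hP]; nlinarith
    have e2 : c * (3 * s ^ 2 + 2 * c * s + c ^ 2) ≤ 3 * P := by
      have : 0 ≤ 3 * s ^ 3 + (c ^ 2 * s) + 2 * c ^ 3 := by positivity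
      rw [hP]; nlinarith
    have e3 : s * (2 * s ^ 2 + c * s + c ^ 2) ≤ 3 * P := by
      have : 0 ≤ s ^ 3 + 2 * (c * s ^ 2) + 2 * (c ^ 2 * s) + 3 * c ^ 3 := by positivity
      rw [hP]; nlinarith
    have f2 : c * (s * (2 * s ^ 2 + c * s + c ^ 2) * (3 * s ^ 2 + 2 * c * s + c ^ 2)) ≤
        9 * P ^ 2 := by
      calc _ = (s * (2 * s ^ 2 + c * s + c ^ 2)) * (c * (3 * s ^ 2 + 2 * c * s + c ^ 2)) := by ring
        _ ≤ (3 * P) * (3 * P) := by gcongr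
        _ = _ := by ring
    have f1 : c * ((6 * s ^ 2 + 2 * c * s + c ^ 2) * P) ≤ 6 * P ^ 2 := by
      calc _ = (c * (6 * s ^ 2 + 2 * c * s + c ^ 2)) * P := by ring
        _ ≤ (6 * P) * P := by gcongr
        _ = _ := by ring
    have f3 : 0 ≤ c * (s * (2 * s ^ 2 + c * s + c ^ 2) * (3 * s ^ 2 + 2 * c * s + c ^ 2)) := by
      positivity
    have f4 : 0 ≤ c * ((6 * s ^ 2 + 2 * c * s + c ^ 2) * P) := by positivity
    have habs : |(6 * s ^ 2 + 2 * c * s + c ^ 2) * P -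
        s * (2 * s ^ 2 + c * s + c ^ 2) * (3 * s ^ 2 + 2 * c * s + c ^ 2)| * c ≤ 15 * P ^ 2 := by
      rw [← abs_of_pos hc, ← abs_mul, abs_of_pos hc, abs_le]
      constructor <;> nlinarith [sq_nonneg P]
    calc _ = a ^ 2 * (|(6 * s ^ 2 + 2 * c * s + c ^ 2) * P -
        s * (2 * s ^ 2 + c * s + c ^ 2) * (3 * s ^ 2 + 2 * c * s + c ^ 2)| * c) := by ring
      _ ≤ a ^ 2 * (15 * P ^ 2) := by gcongr
      _ ≤ _ := by
        have : 0 ≤ a ^ 2 * P ^ 2 := by positivity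
        nlinarith
  have hint : ‖∫ s in s₁..s₂, (k' s : ℂ) * (e (v s ^ 2) * (1 / (2 * Real.pi * Complex.I)))‖ ≤
      5 / a ^ 2 := by
    have := intervalIntegral.norm_integral_le_of_norm_le_const (a := s₁) (b := s₂)
      (f := fun s => (k' s : ℂ) * (e (v s ^ 2) * (1 / (2 * Real.pi * Complex.I))))
      (C := 15 / (a ^ 2 * c) * (1 / 6)) (fun s hs => by
        rw [Set.uIoc_of_le h12] at hs
        exact hcw _ _ _ (hk'b s (h1.trans hs.1)))
    refine this.trans ?_
    rw [abs_of_nonneg (by linarith)]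
    calc 15 / (a ^ 2 * c) * (1 / 6) * (s₂ - s₁) ≤ 15 / (a ^ 2 * c) * (1 / 6) * (2 * c) := by
          gcongr
          linarith
      _ = 5 / a ^ 2 := by field_simp; norm_num
  have hs2 : 0 < s₂ := h1.trans_le h12
  have hfin : (∫ s in s₁..s₂, e (v s ^ 2) * (2 * s : ℝ)) -
      (c / a : ℝ) * (fresnel (v s₂) - fresnel (v s₁)) =
      (k s₂ : ℂ) * (e (v s₂ ^ 2) * (1 / (2 * Real.pi * Complex.I))) -
      (k s₁ : ℂ) * (e (v s₁ ^ 2) * (1 / (2 * Real.pi * Complex.I))) -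
      ∫ s in s₁..s₂, (k' s : ℂ) * (e (v s ^ 2) * (1 / (2 * Real.pi * Complex.I))) := by
    simp only [hB] at hI
    linear_combination hI
  change ‖(∫ s in s₁..s₂, e (v s ^ 2) * (2 * s : ℝ)) -
      (c / a : ℝ) * (fresnel (v s₂) - fresnel (v s₁))‖ ≤ _
  rw [hfin]
  refine (norm_sub_le _ _).trans ((add_le_add ((norm_sub_le _ _).trans
    (add_le_add (hcw _ _ _ (hkb s₂ hs2)) (hcw _ _ _ (hkb s₁ h1)))) hint).trans ?_)
  have : 0 < 1 / a ^ 2 := by positivity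
  rw [show 3 / (2 * a ^ 2) = 3 / 2 * (1 / a ^ 2) by field_simp, show 5 / a ^ 2 = 5 * (1 / a ^ 2) by
    ring, show 6 / a ^ 2 = 6 * (1 / a ^ 2) by ring]
  linarith

/-- Stationary phase for the phase `Y / u + ν u` with `ν = a²` and `Y = a² c⁴`. -/
theorem norm_integral_stationary_le {a c p p' : ℝ} (ha : 0 < a) (hc : 0 < c) (hp : 0 < p)
    (hpp : p ≤ p') (hp' : p' ≤ 4 * c ^ 2) :
    ‖(∫ u in p..p', e (a ^ 2 * c ^ 4 / u + a ^ 2 * u)) -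
      e (2 * (a ^ 2 * c ^ 2)) * ((c / a : ℝ) * (fresnel (a * (√p' - c ^ 2 / √p')) -
        fresnel (a * (√p - c ^ 2 / √p))))‖ ≤ 6 / a ^ 2 := by
  have hsp : 0 < √p := Real.sqrt_pos.mpr hp
  have hs12 : √p ≤ √p' := Real.sqrt_le_sqrt hpp
  have hs2 : √p' ≤ 2 * c := by
    rw [Real.sqrt_le_left (by positivity)]
    linarith
  have hmain := norm_integral_sub_fresnel_le ha hc hsp hs12 hs2
  have hsub : (∫ u in p..p', e (a ^ 2 * c ^ 4 / u + a ^ 2 * u)) =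
      ∫ s in √p..√p', e (a ^ 2 * c ^ 4 / s ^ 2 + a ^ 2 * s ^ 2) * (2 * s : ℝ) := by
    have h := intervalIntegral.integral_deriv_smul_comp'' (a := √p) (b := √p')
      (f := fun s => s ^ 2) (f' := fun s => 2 * s)
      (g := fun u => e (a ^ 2 * c ^ 4 / u + a ^ 2 * u)) (by fun_prop)
      (fun s _ => by simpa using (hasDerivAt_pow 2 s).hasDerivWithinAt) (by fun_prop) (by
        apply continuous_e.comp_continuousOn
        apply ContinuousOn.add _ (by fun_prop)
        apply ContinuousOn.div continuousOn_const (by fun_prop)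
        rintro _ ⟨s, hs, rfl⟩
        rw [Set.uIcc_of_le hs12] at hs
        have : 0 < s := hsp.trans_le hs.1
        positivity)
    simp only [Real.sq_sqrt hp.le, Real.sq_sqrt (hp.le.trans hpp)] at h
    rw [← h]
    refine intervalIntegral.integral_congr fun s _ => ?_
    simp only [Function.comp, Complex.real_smul]
    ring
  -- After the substitution u = s^2 the phase is a square plus a constant: a^2c^4/s^2 + a^2s^2 =
  -- (a(s - c^2/s))^2 + 2a^2c^2.
  have hphase : (∫ s in √p..√p', e (a ^ 2 * c ^ 4 / s ^ 2 + a ^ 2 * s ^ 2) * (2 * s : ℝ)) =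
      e (2 * (a ^ 2 * c ^ 2)) *
        ∫ s in √p..√p', e ((a * (s - c ^ 2 / s)) ^ 2) * (2 * s : ℝ) := by
    rw [← intervalIntegral.integral_const_mul]
    apply intervalIntegral.integral_congr
    intro s hs
    rw [Set.uIcc_of_le hs12] at hs
    have hs0 : 0 < s := hsp.trans_le hs.1
    simp only
    rw [← mul_assoc, ← e_add]
    congr 2
    field_simp
    ring
  rw [hsub, hphase, ← mul_sub, norm_mul, norm_e, one_mul]
  exact hmain

/-! ### The van der Corput transform, block by block -/

/-- The point where the derivative of `-Y / u` equals `ν + 1 / 2`. -/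
noncomputable def halfPoint (Y : ℝ) (ν : ℕ) : ℝ := √(Y / (ν + 1 / 2))

/-- The first integer `n` such that `n + α` is at least `halfPoint Y ν`. -/
noncomputable def cutIndex (Y α : ℝ) (ν : ℕ) : ℕ := ⌈halfPoint Y ν - α⌉₊

theorem halfPoint_pos {Y : ℝ} (hY : 0 < Y) (ν : ℕ) : 0 < halfPoint Y ν :=
  Real.sqrt_pos.mpr (by positivity)

theorem halfPoint_sq {Y : ℝ} (hY : 0 < Y) (ν : ℕ) : halfPoint Y ν ^ 2 * (ν + 1 / 2) = Y := by
  rw [halfPoint, Real.sq_sqrt (by positivity)]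
  field_simp

theorem halfPoint_anti {Y : ℝ} (hY : 0 < Y) {μ ν : ℕ} (h : μ ≤ ν) :
    halfPoint Y ν ≤ halfPoint Y μ := by
  apply Real.sqrt_le_sqrt
  have : (μ : ℝ) ≤ ν := by exact_mod_cast h
  gcongr

theorem cutIndex_anti {Y α : ℝ} (hY : 0 < Y) {μ ν : ℕ} (h : μ ≤ ν) :
    cutIndex Y α ν ≤ cutIndex Y α μ :=
  Nat.ceil_mono (sub_le_sub_right (halfPoint_anti hY h) α)

theorem norm_sub_fresnel_limit_le {F : ℂ} (hF : ∀ v : ℝ, 0 < v → ‖fresnel v - F‖ ≤ 1 / v)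
    {v₁ v₂ : ℝ} (h1 : v₁ < 0) (h2 : 0 < v₂) :
    ‖fresnel v₂ - fresnel v₁ - 2 * F‖ ≤ 1 / v₂ + 1 / (-v₁) := by
  have h3 := fresnel_neg (-v₁)
  rw [neg_neg] at h3
  rw [h3, show fresnel v₂ - -fresnel (-v₁) - 2 * F = (fresnel v₂ - F) + (fresnel (-v₁) - F) by ring]
  exact (norm_add_le _ _).trans (add_le_add (hF _ h2) (hF _ (by linarith)))

/-- Here u is the stationary point belonging to the integer k, and b' and b are the ends of its
block. Comparing squares shows that u - b' and b - u are at least of order u/k, which controls the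
Fresnel tails, and that b - b' is at most of that order, which controls the error of passing to an
integral. -/
theorem half_points_gaps {k b' u b Y : ℝ} (hk1 : 1 ≤ k) (hb'0 : 0 < b') (hu0 : 0 < u)
    (hb0 : 0 < b) (h1 : b' ^ 2 * (k + 1 / 2) = Y) (h2 : u ^ 2 * k = Y)
    (h3 : b ^ 2 * (k - 1 / 2) = Y) :
    b' ≤ u ∧ u ≤ b ∧ b ≤ 2 * b' ∧ u ≤ 3 / 2 * b' ∧ b' ≤ 6 * k * (u - b') ∧
      b ≤ 4 * k * (b - u) ∧ k * (b - b') ≤ 3 / 2 * b' := by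
  have sb := sq_nonneg b
  have sb' := sq_nonneg b'
  have su := sq_nonneg u
  have k1 := mul_nonneg (sub_nonneg.mpr hk1) sb
  have k2 := mul_nonneg (sub_nonneg.mpr hk1) sb'
  have k3 := mul_nonneg (sub_nonneg.mpr hk1) su
  have hk0 : 0 < k := by linarith
  have hle : ∀ x y : ℝ, k * x ≤ k * y → x ≤ y := fun x y h => le_of_mul_le_mul_left h hk0
  have q1 : k * (u ^ 2 - b' ^ 2) = b' ^ 2 / 2 := by linarith
  have q2 : k * (b ^ 2 - u ^ 2) = b ^ 2 / 2 := by linarith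
  have r1 : b' ≤ u := le_of_sq_le_sq (hle _ _ (by linarith)) hu0.le
  have r2 : u ≤ b := le_of_sq_le_sq (hle _ _ (by linarith)) hb0.le
  have hbb : b ^ 2 ≤ 3 * b' ^ 2 := by
    have : b ^ 2 * k ≤ 2 * Y := by linarith
    apply hle
    linarith
  have r3 : b ≤ 2 * b' := le_of_sq_le_sq (by linarith) (by positivity)
  have r4 : u ≤ 3 / 2 * b' := by
    refine le_of_sq_le_sq (hle _ _ ?_) (by positivity)
    linarith
  refine ⟨r1, r2, r3, r4, ?_, ?_, ?_⟩
  · have hs : 0 < u + b' := by positivity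
    refine le_of_mul_le_mul_right ?_ hs
    have : b' * u ≤ 2 * b' ^ 2 := by nlinarith
    linarith
  · have hs : 0 < u + b := by positivity
    refine le_of_mul_le_mul_right ?_ hs
    have : b * u ≤ b ^ 2 := by nlinarith
    linarith
  · have hs : 0 < b + b' := by positivity
    refine le_of_mul_le_mul_right ?_ hs
    have : b' ^ 2 ≤ b' * b := by nlinarith
    linarith

set_option maxHeartbeats 2000000 in
/-- One block of the van der Corput transform of the sum of `e (Y / (n + α))`. -/
theorem norm_block_sub_le {F : ℂ} (hF : ∀ v : ℝ, 0 < v → ‖fresnel v - F‖ ≤ 1 / v)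
    {Y α : ℝ} (hY : 0 < Y) (hα : 0 ≤ α) (hα2 : α ≤ 2) (ν : ℕ)
    (hν : 100 * ((ν : ℝ) + 1) ≤ halfPoint Y (ν + 1)) :
    ‖∑ n ∈ Ico (cutIndex Y α (ν + 1)) (cutIndex Y α ν), e (Y / (n + α)) -
      (√√(Y / ((ν : ℝ) + 1)) / √((ν : ℝ) + 1) : ℝ) *
        (2 * F * e (2 * √(Y * ((ν : ℝ) + 1)) - ((ν : ℝ) + 1) * α))‖ ≤ 1600 := by
  set k : ℝ := (ν : ℝ) + 1 with hk
  have hk1 : 1 ≤ k := by have := Nat.cast_nonneg (α := ℝ) ν; linarith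
  have hk0 : 0 < k := by linarith
  set b' := halfPoint Y (ν + 1) with hb'
  set b := halfPoint Y ν with hb
  have hb'sq : b' ^ 2 * (k + 1 / 2) = Y := by
    have := halfPoint_sq hY (ν + 1)
    push_cast at this
    exact this
  have hbsq : b ^ 2 * (k - 1 / 2) = Y := by
    have := halfPoint_sq hY ν
    rw [← this, hk]
    ring
  have hb0 : 0 < b := halfPoint_pos hY ν
  have hb'0 : 0 < b' := halfPoint_pos hY _
  have hb'100 : 100 ≤ b' := by linarith
  set a := √k with ha
  set c := √√(Y / k) with hc
  have ha0 : 0 < a := Real.sqrt_pos.mpr hk0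
  have hc0 : 0 < c := Real.sqrt_pos.mpr (Real.sqrt_pos.mpr (by positivity))
  have ha2 : a ^ 2 = k := Real.sq_sqrt hk0.le
  have hc2 : c ^ 2 = √(Y / k) := Real.sq_sqrt (Real.sqrt_nonneg _)
  set u := c ^ 2 with hu
  have hu0 : 0 < u := by positivity
  have husq : u ^ 2 * k = Y := by
    rw [hc2, Real.sq_sqrt (by positivity)]
    field_simp
  obtain ⟨hb'u, hub, hbb', hub', gapA, gapB, gapC⟩ :=
    half_points_gaps hk1 hb'0 hu0 hb0 hb'sq husq hbsq
  set m := cutIndex Y α (ν + 1) with hm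
  set n := cutIndex Y α ν with hn
  have hmn : m ≤ n := cutIndex_anti hY (Nat.le_succ ν)
  have hp1 : b' ≤ m + α := by
    have := Nat.le_ceil (b' - α)
    change b' - α ≤ (m : ℝ) at this
    linarith
  have hp2 : m + α < b' + 1 := by
    have := Nat.ceil_lt_add_one (a := b' - α) (by linarith)
    change (m : ℝ) < _ at this
    linarith
  have hq1 : b ≤ n + α := by
    have := Nat.le_ceil (b - α)
    change b - α ≤ (n : ℝ) at this
    linarith
  have hq2 : n + α < b + 1 := by
    have := Nat.ceil_lt_add_one (a := b - α) (by linarith)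
    change (n : ℝ) < _ at this
    linarith
  have hint : a ^ 2 * c ^ 4 = Y := by
    rw [ha2, ← husq]; ring
  -- On the block k - 1/2 ≤ Y/u^2 ≤ k + 1/2. The finite difference involves Y/(u(u+1)), which is
  -- slightly smaller; the margin 3/4 absorbs this.
  have hs1 := norm_sum_sub_integral_le (ν := k) hY hb'0 hα hmn hp1 (by
    intro i hi hi'
    have h1 : b' ≤ i + α := by
      have : (m : ℝ) ≤ i := by exact_mod_cast hi
      linarith
    have h2 : (i : ℝ) + α < b := by
      have := Nat.lt_ceil.mp hi'
      linarith
    have hx0 : 0 < (i : ℝ) + α := by linarith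
    have h3 : Y / ((i + α) * (i + α + 1)) ≤ k + 1 / 2 := by
      rw [div_le_iff₀ (by positivity), ← hb'sq, mul_comm (b' ^ 2)]
      have : b' ^ 2 ≤ (i + α) * (i + α + 1) := by
        rw [sq]
        gcongr
        linarith
      gcongr
    have h4 : k - 3 / 4 ≤ Y / ((i + α) * (i + α + 1)) := by
      rw [le_div_iff₀ (by positivity), ← hbsq]
      have h5 : ((i : ℝ) + α) * (i + α + 1) ≤ b * (b + 1) := by gcongr
      have h6 : (k - 3 / 4) * (b * (b + 1)) ≤ b ^ 2 * (k - 1 / 2) := by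
        have : (k - 3 / 4) * (b + 1) ≤ b * (k - 1 / 2) := by linarith
        linarith [mul_le_mul_of_nonneg_left this hb0.le]
      have h7 : 0 ≤ k - 3 / 4 := by linarith
      exact (mul_le_mul_of_nonneg_left h5 h7).trans h6
    rw [abs_le]
    constructor <;> linarith)
  have hs2 := norm_integral_stationary_le ha0 hc0 (p := m + α) (p' := n + α) (by linarith)
    (by have : (m : ℝ) ≤ n := by exact_mod_cast hmn
        linarith) (by change (n : ℝ) + α ≤ 4 * u; linarith)
  rw [hint, ha2] at hs2
  have hvp : ∀ x : ℝ, 0 < x → a * (√x - c ^ 2 / √x) = a * (x - u) / √x := by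
    intro x hx
    have := Real.sqrt_pos.mpr hx
    have h2 := Real.sq_sqrt hx.le
    field_simp
    rw [h2]
  -- Rounding the ends of the block to indices moves them by less than 1. By `hν` this is small
  -- against the gaps of order u/k.
  have gap1 : u / (18 * k) ≤ u - (m + α) := by
    rw [div_le_iff₀ (by positivity)]
    have h1 : k * (m + α) ≤ k * (b' + 1) := by gcongr
    linarith
  have gap2 : u / (4 * k) ≤ (n + α) - u := by
    rw [div_le_iff₀ (by positivity)]
    have h1 : k * b ≤ k * (n + α) := by gcongr
    linarith
  have hpu : (m : ℝ) + α < u := by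
    have : 0 < u / (18 * k) := by positivity
    linarith
  have hqu : u < (n : ℝ) + α := by
    have : 0 < u / (4 * k) := by positivity
    linarith
  have hp0 : 0 < (m : ℝ) + α := by linarith
  have hq0 : 0 < (n : ℝ) + α := by linarith
  have hsp := Real.sqrt_pos.mpr hp0
  have hsq := Real.sqrt_pos.mpr hq0
  have hspc : √((m : ℝ) + α) ≤ c := by
    rw [Real.sqrt_le_left hc0.le]
    exact hpu.le
  have hsqc : √((n : ℝ) + α) ≤ 2 * c := by
    rw [Real.sqrt_le_left (by positivity), mul_pow, ← hu]
    linarith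
  have hfr := norm_sub_fresnel_limit_le hF
    (v₁ := a * (√((m : ℝ) + α) - c ^ 2 / √((m : ℝ) + α)))
    (v₂ := a * (√((n : ℝ) + α) - c ^ 2 / √((n : ℝ) + α)))
    (by rw [hvp _ hp0]
        exact div_neg_of_neg_of_pos (mul_neg_of_pos_of_neg ha0 (by linarith)) hsp)
    (by rw [hvp _ hq0]
        exact div_pos (mul_pos ha0 (by linarith)) hsq)
  have hfr2 : c / a * (1 / (a * (√((n : ℝ) + α) - c ^ 2 / √((n : ℝ) + α))) +
      1 / (-(a * (√((m : ℝ) + α) - c ^ 2 / √((m : ℝ) + α))))) ≤ 26 := by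
    rw [hvp _ hp0, hvp _ hq0, mul_add]
    have t1 : c / a * (1 / (a * ((n : ℝ) + α - u) / √((n : ℝ) + α))) ≤ 8 := by
      have : c / a * (1 / (a * ((n : ℝ) + α - u) / √((n : ℝ) + α))) =
          (c * √((n : ℝ) + α)) / (k * ((n : ℝ) + α - u)) := by
        rw [← ha2]; field_simp
      rw [this, div_le_iff₀ (mul_pos hk0 (by linarith))]
      rw [div_le_iff₀ (by positivity)] at gap2
      calc c * √((n : ℝ) + α) ≤ c * (2 * c) := by gcongr
        _ = 2 * u := by rw [hu]; ring
        _ ≤ _ := by linarith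
    have t2 : c / a * (1 / (-(a * ((m : ℝ) + α - u) / √((m : ℝ) + α)))) ≤ 18 := by
      have h0 : u - ((m : ℝ) + α) ≠ 0 := by linarith
      have : c / a * (1 / (-(a * ((m : ℝ) + α - u) / √((m : ℝ) + α)))) =
          (c * √((m : ℝ) + α)) / (k * (u - ((m : ℝ) + α))) := by
        rw [← ha2, show -(a * ((m : ℝ) + α - u) / √((m : ℝ) + α)) =
          a * (u - ((m : ℝ) + α)) / √((m : ℝ) + α) by ring]
        field_simp
      rw [this, div_le_iff₀ (mul_pos hk0 (by linarith))]
      rw [div_le_iff₀ (by positivity)] at gap1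
      calc c * √((m : ℝ) + α) ≤ c * c := by gcongr
        _ = u := by rw [hu]; ring
        _ ≤ _ := by linarith
    linarith
  have herr : 2 * Real.pi * (Y / b' ^ 3) * ((n : ℝ) - m) ≤ 20 := by
    have h1 : Y / b' ^ 3 ≤ 3 / 2 * k / b' := by
      rw [div_le_div_iff₀ (by positivity) hb'0, ← hb'sq]
      have : b' ^ 3 ≤ k * b' ^ 3 := le_mul_of_one_le_left (by positivity) hk1
      linarith
    have h2 : b - b' ≤ 3 / 2 * b' / k := by
      rw [le_div_iff₀ hk0]
      linarith
    have h5 : (n : ℝ) - m ≤ 3 / 2 * b' / k + 1 := by linarith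
    have h6 : 0 ≤ (n : ℝ) - m := by
      have : (m : ℝ) ≤ n := by exact_mod_cast hmn
      linarith
    have hpi := Real.pi_lt_d2
    have hpi0 := Real.pi_pos
    calc 2 * Real.pi * (Y / b' ^ 3) * ((n : ℝ) - m)
        ≤ 2 * 3.15 * (3 / 2 * k / b') * (3 / 2 * b' / k + 1) := by gcongr
      _ = 6.3 * (9 / 4 + 3 / 2 * (k / b')) := by field_simp; ring
      _ ≤ 6.3 * (9 / 4 + 3 / 2 * (1 / 100)) := by
          have : k / b' ≤ 1 / 100 := by
            rw [div_le_div_iff₀ hb'0 (by norm_num)]; linarith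
          gcongr
      _ ≤ 20 := by norm_num
  have hk6 : 6 / k ≤ 6 := div_le_self (by norm_num) hk1
  -- The integer multiple ki can be added to the phase for free; completing it to k(i + α) costs the
  -- factor e(-kα).
  have hsumeq : ∑ i ∈ Ico m n, e (Y / (i + α)) =
      e (-(k * α)) * ∑ i ∈ Ico m n, e (Y / (i + α) + k * (i + α)) := by
    rw [Finset.mul_sum]
    refine Finset.sum_congr rfl fun i _ => ?_
    rw [← e_add, show -(k * α) + (Y / (i + α) + k * (i + α)) =
      Y / (i + α) + (((ν + 1 : ℕ) * i : ℤ) : ℝ) by rw [hk]; push_cast; ring, e_add_int]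
  have hphase : e (2 * √(Y * k) - k * α) = e (-(k * α)) * e (2 * (k * u)) := by
    rw [← e_add]
    have : √(Y * k) = k * u := by
      rw [← husq, show u ^ 2 * k * k = (k * u) ^ 2 by ring, Real.sqrt_sq (by positivity)]
    rw [this]
    congr 1
    ring
  set S := ∑ i ∈ Ico m n, e (Y / (i + α) + k * (i + α)) with hS
  set I := ∫ x in (m + α : ℝ)..(n + α : ℝ), e (Y / x + k * x) with hI
  set Fr := fresnel (a * (√((n : ℝ) + α) - c ^ 2 / √((n : ℝ) + α))) -
    fresnel (a * (√((m : ℝ) + α) - c ^ 2 / √((m : ℝ) + α))) with hFr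
  rw [hsumeq, hphase]
  have hdecomp : e (-(k * α)) * S - ((c / a : ℝ) : ℂ) *
      (2 * F * (e (-(k * α)) * e (2 * (k * u)))) =
      e (-(k * α)) * ((S - I) + (I - e (2 * (k * u)) * ((c / a : ℝ) * Fr)) +
        e (2 * (k * u)) * ((c / a : ℝ) * (Fr - 2 * F))) := by ring
  rw [hdecomp, norm_mul, norm_e, one_mul]
  have hlast : ‖e (2 * (k * u)) * (((c / a : ℝ) : ℂ) * (Fr - 2 * F))‖ ≤ 26 := by
    rw [norm_mul, norm_e, one_mul, norm_mul, Complex.norm_real, Real.norm_eq_abs,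
      abs_of_pos (by positivity)]
    refine le_trans ?_ hfr2
    gcongr
  refine (norm_add_le _ _).trans ((add_le_add ((norm_add_le _ _).trans (add_le_add hs1 hs2))
    hlast).trans ?_)
  linarith

theorem sum_Ico_cutIndex (Y α : ℝ) (hY : 0 < Y) (f : ℕ → ℂ) {G H : ℕ} (hGH : G ≤ H) :
    ∑ n ∈ Ico (cutIndex Y α H) (cutIndex Y α G), f n =
      ∑ ν ∈ Ico G H, ∑ n ∈ Ico (cutIndex Y α (ν + 1)) (cutIndex Y α ν), f n := by
  induction H, hGH using Nat.le_induction with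
  | base => simp
  | succ H hH ih =>
    have h1 := Finset.sum_Ico_succ_top hH
      (fun ν => ∑ n ∈ Ico (cutIndex Y α (ν + 1)) (cutIndex Y α ν), f n)
    have h2 := Finset.sum_Ico_consecutive f (cutIndex_anti (α := α) hY (Nat.le_succ H))
      (cutIndex_anti (α := α) hY hH)
    rw [h1, ← ih, ← h2]
    ring

/-! ### Fourth differences and the dual sum -/

theorem mul_le_sub_of_hasDerivAt {f f' : ℝ → ℝ} {p q d m M : ℝ} (hd : 0 ≤ d)
    (h : ∀ x, p ≤ x → x ≤ q → HasDerivAt f (f' x) x)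
    (hb : ∀ x, p ≤ x → x ≤ q → m ≤ f' x ∧ f' x ≤ M) {x : ℝ} (hx : p ≤ x) (hxq : x + d ≤ q) :
    d * m ≤ f (x + d) - f x ∧ f (x + d) - f x ≤ d * M := by
  rcases hd.eq_or_lt with rfl | hd
  · simp
  obtain ⟨c, hc, hc'⟩ := exists_hasDerivAt_eq_slope f f' (show x < x + d by linarith)
    (fun y hy => (h y (by linarith [hy.1]) (by linarith [hy.2])).continuousAt.continuousWithinAt)
    (fun y hy => h y (by linarith [hy.1]) (by linarith [hy.2]))
  have h1 := hb c (by linarith [hc.1]) (by linarith [hc.2])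
  rw [add_sub_cancel_left, eq_div_iff hd.ne', mul_comm] at hc'
  rw [← hc']
  exact ⟨by gcongr; exact h1.1, by gcongr; exact h1.2⟩

theorem hasDerivAt_diff {f f' : ℝ → ℝ} {p q d : ℝ} (hd : 0 ≤ d)
    (h : ∀ x, p ≤ x → x ≤ q → HasDerivAt f (f' x) x) {x : ℝ} (hx : p ≤ x) (hxq : x + d ≤ q) :
    HasDerivAt (fun y => f (y + d) - f y) (f' (x + d) - f' x) x :=
  ((h (x + d) (by linarith) hxq).comp_add_const x d).sub (h x hx (by linarith))

/-- Bounds for a fourth difference in terms of the fourth derivative. -/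
theorem fourth_difference_mem {φ₀ φ₁ φ₂ φ₃ φ₄ : ℝ → ℝ} {p q d₁ d₂ m M : ℝ} (hd₁ : 0 ≤ d₁)
    (hd₂ : 0 ≤ d₂)
    (h₀ : ∀ x, p ≤ x → x ≤ q → HasDerivAt φ₀ (φ₁ x) x)
    (h₁ : ∀ x, p ≤ x → x ≤ q → HasDerivAt φ₁ (φ₂ x) x)
    (h₂ : ∀ x, p ≤ x → x ≤ q → HasDerivAt φ₂ (φ₃ x) x)
    (h₃ : ∀ x, p ≤ x → x ≤ q → HasDerivAt φ₃ (φ₄ x) x)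
    (hb : ∀ x, p ≤ x → x ≤ q → m ≤ φ₄ x ∧ φ₄ x ≤ M) {f : ℝ → ℝ}
    (hf : f = fun y => (φ₀ (y + d₂ + d₁) - φ₀ (y + d₂)) - (φ₀ (y + d₁) - φ₀ y))
    {x : ℝ} (hx : p ≤ x) (hxq : x + d₁ + d₂ + 2 ≤ q) :
    d₁ * d₂ * m ≤ (f (x + 1 + 1) - f (x + 1)) - (f (x + 1) - f x) ∧
      (f (x + 1 + 1) - f (x + 1)) - (f (x + 1) - f x) ≤ d₁ * d₂ * M := by
  -- The steps d₁, d₂, 1, 1 are peeled off one by one with the mean value theorem. Each trades one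
  -- derivative for one difference and shortens the interval by its step.
  have a3 : ∀ y, p ≤ y → y ≤ q - d₁ → d₁ * m ≤ φ₃ (y + d₁) - φ₃ y ∧
      φ₃ (y + d₁) - φ₃ y ≤ d₁ * M :=
    fun y hy hy' => mul_le_sub_of_hasDerivAt hd₁ h₃ hb hy (by linarith)
  have a2 := fun y (hy : p ≤ y) (hy' : y ≤ q - d₁) =>
    hasDerivAt_diff (x := y) hd₁ h₂ hy (by linarith)
  have a1 := fun y (hy : p ≤ y) (hy' : y ≤ q - d₁) =>
    hasDerivAt_diff (x := y) hd₁ h₁ hy (by linarith)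
  have a0 := fun y (hy : p ≤ y) (hy' : y ≤ q - d₁) =>
    hasDerivAt_diff (x := y) hd₁ h₀ hy (by linarith)
  have b2 := fun y (hy : p ≤ y) (hy' : y ≤ q - d₁ - d₂) =>
    mul_le_sub_of_hasDerivAt (x := y) hd₂ a2 a3 hy (by linarith)
  have b1 := fun y (hy : p ≤ y) (hy' : y ≤ q - d₁ - d₂) =>
    hasDerivAt_diff (x := y) hd₂ a1 hy (by linarith)
  have b0 := fun y (hy : p ≤ y) (hy' : y ≤ q - d₁ - d₂) =>
    hasDerivAt_diff (x := y) hd₂ a0 hy (by linarith)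
  have c1 := fun y (hy : p ≤ y) (hy' : y ≤ q - d₁ - d₂ - 1) =>
    mul_le_sub_of_hasDerivAt (x := y) zero_le_one b1 b2 hy (by linarith)
  have c0 := fun y (hy : p ≤ y) (hy' : y ≤ q - d₁ - d₂ - 1) =>
    hasDerivAt_diff (x := y) zero_le_one b0 hy (by linarith)
  have d0 := mul_le_sub_of_hasDerivAt (x := x) zero_le_one c0 c1 hx (by linarith)
  simp only [one_mul] at d0
  rw [hf]
  constructor
  · linarith [d0.1]
  · linarith [d0.2]

theorem hasDerivAt_const_mul_rpow (c r : ℝ) {x : ℝ} (hx : 0 < x) :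
    HasDerivAt (fun y : ℝ => c * y ^ r) (c * r * x ^ (r - 1)) x := by
  have := (Real.hasDerivAt_rpow_const (p := r) (Or.inl hx.ne')).const_mul c
  rwa [← mul_assoc] at this

theorem rpow_neg_seven_halves {x : ℝ} (hx : 0 < x) : x ^ (-(7 / 2) : ℝ) = ((√x) ^ 7)⁻¹ := by
  rw [Real.rpow_neg hx.le, Real.sqrt_eq_rpow, ← Real.rpow_natCast, ← Real.rpow_mul hx.le]
  norm_num

/-- The dual sum of the van der Corput transform, estimated by the fourth derivative test. -/
theorem norm_dual_sum_le {t w α : ℝ} (ht : 0 < t) (hw : 0 < w) {G K : ℕ}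
    (hG : t ^ 16 / 4 ≤ (G : ℝ) + 1) (hK : (G : ℝ) + K + 3 ≤ 5 * t ^ 16) :
    ‖∑ i ∈ range K, e (2 * √(t ^ 16 * w ^ 32 * ((G : ℝ) + i + 1)) - ((G : ℝ) + i + 1) * α)‖ ≤
      1000 * (t ^ 13 * w + t ^ 18 / w ^ 2) := by
  set r := t ^ 8 * w ^ 16 with hr
  have hr0 : 0 < r := by positivity
  -- The sign is reversed, which leaves the modulus of the sum unchanged, because the fourth
  -- derivative of √x is negative.
  set φ : ℝ → ℝ := fun x => -2 * r * x ^ (1 / 2 : ℝ) with hφ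
  set g : ℕ → ℝ := fun i => φ ((G : ℝ) + i + 1) + ((G : ℝ) + i + 1) * α with hg
  have hgeq : ∀ i : ℕ, 2 * √(t ^ 16 * w ^ 32 * ((G : ℝ) + i + 1)) - ((G : ℝ) + i + 1) * α =
      -g i := by
    intro i
    have h1 : √(t ^ 16 * w ^ 32 * ((G : ℝ) + i + 1)) = r * √((G : ℝ) + i + 1) := by
      rw [show t ^ 16 * w ^ 32 * ((G : ℝ) + i + 1) = r ^ 2 * ((G : ℝ) + i + 1) by rw [hr]; ring,
        Real.sqrt_mul (by positivity), Real.sqrt_sq hr0.le]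
    simp only [hg, hφ]
    rw [h1, Real.sqrt_eq_rpow]
    ring
  simp_rw [hgeq]
  rw [norm_sum_e_neg]
  -- On t^16/4 ≤ x ≤ 5t^16 the fourth derivative (15/8)rx^(-7/2) has order r t^(-56) = w^16/t^48,
  -- that is η^4 up to constants.
  set η := w ^ 4 / (4 * t ^ 12) with hη
  have hη0 : 0 < η := by positivity
  have hη4 : η ^ 4 = w ^ 16 / (256 * t ^ 48) := by
    rw [hη]; field_simp; norm_num
  have hfour := norm_sum_e_pow_four_le g K hη0 (A := 100000) (by norm_num) (by
    intro d₁ d₂ i h1 h2 h3 f hf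
    have hd1 : (1 : ℝ) ≤ d₁ := by exact_mod_cast h1
    have hd2 : (1 : ℝ) ≤ d₂ := by exact_mod_cast h2
    have hp : 0 < t ^ 16 / 4 := by positivity
    have hmem := fourth_difference_mem (φ₀ := φ) (p := t ^ 16 / 4) (q := 5 * t ^ 16)
      (d₁ := d₁) (d₂ := d₂) (m := η ^ 4) (M := 100000 * η ^ 4) (by linarith) (by linarith)
      (fun x hx _ => hasDerivAt_const_mul_rpow _ _ (hp.trans_le hx))
      (fun x hx _ => hasDerivAt_const_mul_rpow _ _ (hp.trans_le hx))
      (fun x hx _ => hasDerivAt_const_mul_rpow _ _ (hp.trans_le hx))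
      (fun x hx _ => hasDerivAt_const_mul_rpow _ _ (hp.trans_le hx))
      (fun x hx hx' => by
        have hx0 : 0 < x := hp.trans_le hx
        have hpow : -2 * r * (1 / 2) * (1 / 2 - 1) * (1 / 2 - 1 - 1) * (1 / 2 - 1 - 1 - 1) *
            x ^ ((1 / 2 : ℝ) - 1 - 1 - 1 - 1) = 15 / 8 * r * ((√x) ^ 7)⁻¹ := by
          rw [← rpow_neg_seven_halves hx0,
            show (1 / 2 : ℝ) - 1 - 1 - 1 - 1 = -(7 / 2) by norm_num]
          ring
        rw [hpow]
        have hs0 : 0 < √x := Real.sqrt_pos.mpr hx0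
        have hs1 : √x ≤ 2.24 * t ^ 8 := by
          rw [Real.sqrt_le_left (by positivity)]
          have : 0 < t ^ 16 := by positivity
          nlinarith
        have hs2 : t ^ 8 / 2 ≤ √x := by
          apply Real.le_sqrt_of_sq_le
          calc (t ^ 8 / 2) ^ 2 = t ^ 16 / 4 := by ring
            _ ≤ x := hx
        have hu : (√x) ^ 7 ≤ (2.24 * t ^ 8) ^ 7 := by gcongr
        have hl : (t ^ 8 / 2) ^ 7 ≤ (√x) ^ 7 := by gcongr
        have hs7 : 0 < (√x) ^ 7 := by positivity
        rw [hη4, ← div_eq_mul_inv]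
        constructor
        · rw [div_le_div_iff₀ (by positivity) hs7]
          calc w ^ 16 * (√x) ^ 7 ≤ w ^ 16 * (2.24 * t ^ 8) ^ 7 := by gcongr
            _ = 2.24 ^ 7 * (w ^ 16 * t ^ 56) := by ring
            _ ≤ 480 * (w ^ 16 * t ^ 56) := by gcongr; norm_num
            _ = 15 / 8 * r * (256 * t ^ 48) := by rw [hr]; ring
        · rw [← mul_div_assoc, div_le_div_iff₀ hs7 (by positivity)]
          calc 15 / 8 * r * (256 * t ^ 48) = 61440 * (w ^ 16 * (t ^ 8 / 2) ^ 7) := by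
                rw [hr]; ring
            _ ≤ 100000 * (w ^ 16 * (√x) ^ 7) := by gcongr; norm_num
            _ = _ := by ring)
      rfl (x := (G : ℝ) + i + 1) (by have := Nat.cast_nonneg (α := ℝ) i; linarith) (by
        have : (i : ℝ) + d₁ + d₂ + 1 ≤ K := by exact_mod_cast h3
        linarith)
    have key : (f (i + 1 + 1) - f (i + 1)) - (f (i + 1) - f i) =
        ((φ ((G : ℝ) + i + 1 + 1 + 1 + d₂ + d₁) - φ ((G : ℝ) + i + 1 + 1 + 1 + d₂)) -
          (φ ((G : ℝ) + i + 1 + 1 + 1 + d₁) - φ ((G : ℝ) + i + 1 + 1 + 1)) -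
        ((φ ((G : ℝ) + i + 1 + 1 + d₂ + d₁) - φ ((G : ℝ) + i + 1 + 1 + d₂)) -
          (φ ((G : ℝ) + i + 1 + 1 + d₁) - φ ((G : ℝ) + i + 1 + 1)))) -
        (((φ ((G : ℝ) + i + 1 + 1 + d₂ + d₁) - φ ((G : ℝ) + i + 1 + 1 + d₂)) -
          (φ ((G : ℝ) + i + 1 + 1 + d₁) - φ ((G : ℝ) + i + 1 + 1))) -
        ((φ ((G : ℝ) + i + 1 + d₂ + d₁) - φ ((G : ℝ) + i + 1 + d₂)) -
          (φ ((G : ℝ) + i + 1 + d₁) - φ ((G : ℝ) + i + 1)))) := by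
      rw [hf]
      simp only [hg]
      push_cast
      ring_nf
    rw [key]
    refine ⟨hmem.1, hmem.2.trans (le_of_eq (by ring))⟩)
  have hK0 : (0 : ℝ) ≤ K := Nat.cast_nonneg _
  have hK5 : (K : ℝ) ≤ 5 * t ^ 16 := by
    have := Nat.cast_nonneg (α := ℝ) G
    linarith
  apply le_of_pow_le_pow_left₀ (n := 4) (by norm_num) (by positivity)
  set A := t ^ 13 * w with hA
  set B := t ^ 18 / w ^ 2 with hB
  have hA0 : 0 < A := by positivity
  have hB0 : 0 < B := by positivity
  have h1 : (K : ℝ) ^ 4 * η ≤ 160 * A ^ 4 := by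
    calc (K : ℝ) ^ 4 * η ≤ (5 * t ^ 16) ^ 4 * η := by gcongr
      _ = 625 / 4 * A ^ 4 := by rw [hη, hA]; field_simp; norm_num
      _ ≤ 160 * A ^ 4 := by gcongr; norm_num
  have h2 : (K : ℝ) ^ 3 / η ^ 2 ≤ 2000 * B ^ 4 := by
    calc (K : ℝ) ^ 3 / η ^ 2 ≤ (5 * t ^ 16) ^ 3 / η ^ 2 := by gcongr
      _ = 2000 * B ^ 4 := by rw [hη, hB]; field_simp; ring
  have h3 : A ^ 4 + B ^ 4 ≤ (A + B) ^ 4 := by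
    have : 0 ≤ 4 * A ^ 3 * B + 6 * A ^ 2 * B ^ 2 + 4 * A * B ^ 3 := by positivity
    nlinarith
  have hA4 : 0 < A ^ 4 := by positivity
  have hB4 : 0 < B ^ 4 := by positivity
  rw [mul_pow]
  linarith

/-- The second derivative test for the phase `Y / u` with `u` of size `J`. -/
theorem norm_sum_e_div_le_of_second_diff {t w α : ℝ} (ht : 0 < t) (hw : 0 < w) {J m n : ℕ}
    (hJ : 2 ≤ J) (hwJ : w ^ 16 = J) (hα : 0 ≤ α) (hα2 : α ≤ 2) (hm : (J : ℝ) / 2 ≤ m)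
    (hn : n ≤ J + 1) :
    ‖∑ i ∈ Ico m n, e (t ^ 16 * w ^ 32 / (i + α))‖ ≤
      100000 * (((n - m : ℕ) : ℝ) * (t ^ 8 / w ^ 8) + w ^ 8 / t ^ 8) := by
  set Y := t ^ 16 * w ^ 32 with hY
  have hY0 : 0 < Y := by positivity
  have hJ0 : (2 : ℝ) ≤ J := by exact_mod_cast hJ
  -- The second difference 2Y/(v(v+1)(v+2)), v = i + α, is at least 2Y/(2J·3J·4J) = l and at most
  -- 2Y/(J/2)^3 = 192l.
  set l := Y / (12 * (J : ℝ) ^ 3) with hl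
  have hl0 : 0 < l := by positivity
  have hdiff : ∀ i : ℕ, m ≤ i → i < n →
      (Y / ((i + 1 + 1 : ℕ) + α) - Y / ((i + 1 : ℕ) + α)) -
        (Y / ((i + 1 : ℕ) + α) - Y / (i + α)) =
        2 * Y / ((i + α) * (i + α + 1) * (i + α + 2)) := by
    intro i hi hi'
    have h1 : (m : ℝ) ≤ i := by exact_mod_cast hi
    have h2 : 0 < (i : ℝ) + α := by linarith
    push_cast
    rw [show (i : ℝ) + 1 + 1 + α = i + α + 2 by ring, show (i : ℝ) + 1 + α = i + α + 1 by ring]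
    field_simp
    ring
  have htest := norm_sum_e_le_of_second_diff (fun i : ℕ => Y / ((i : ℝ) + α)) m n (A := 192) hl0
    (by norm_num) (by
      intro i hi hi'
      have h1 : (m : ℝ) ≤ i := by exact_mod_cast hi
      have h2 : 0 < (i : ℝ) + α := by linarith
      have h3 : (i : ℝ) ≤ J := by exact_mod_cast (by omega : i ≤ J)
      refine le_of_le_of_eq ?_ (hdiff i hi hi').symm
      rw [hl, div_le_div_iff₀ (by positivity) (by positivity)]
      have h4 : ((i : ℝ) + α) * (i + α + 1) * (i + α + 2) ≤
          (2 * J) * (3 * J) * (4 * J) := by gcongr <;> linarith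
      calc Y * (((i : ℝ) + α) * (i + α + 1) * (i + α + 2)) ≤
          Y * ((2 * J) * (3 * J) * (4 * J)) := by gcongr
        _ = _ := by ring) (by
      intro i hi hi'
      have h1 : (m : ℝ) ≤ i := by exact_mod_cast hi
      have h2 : 0 < (i : ℝ) + α := by linarith
      refine le_of_eq_of_le (hdiff i hi hi') ?_
      rw [hl, ← mul_div_assoc, div_le_div_iff₀ (by positivity) (by positivity)]
      have h4 : ((J : ℝ) / 2) * (J / 2) * (J / 2) ≤
          ((i : ℝ) + α) * (i + α + 1) * (i + α + 2) := by gcongr <;> linarith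
      calc 2 * Y * (12 * (J : ℝ) ^ 3) = 192 * Y * (((J : ℝ) / 2) * (J / 2) * (J / 2)) := by ring
        _ ≤ _ := by gcongr)
  refine htest.trans ?_
  have hs1 : √l ≤ t ^ 8 / w ^ 8 / 3 := by
    rw [Real.sqrt_le_left (by positivity), hl, ← hwJ, hY]
    rw [div_div, div_pow, div_le_div_iff₀ (by positivity) (by positivity)]
    have : 0 < t ^ 16 * w ^ 48 := by positivity
    nlinarith
  have hs2 : t ^ 8 / w ^ 8 / 4 ≤ √l := by
    apply Real.le_sqrt_of_sq_le
    rw [hl, ← hwJ, hY, div_div, div_pow, div_le_div_iff₀ (by positivity) (by positivity)]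
    have : 0 < t ^ 16 * w ^ 48 := by positivity
    nlinarith
  have hs3 : 1 / √l ≤ 4 * (w ^ 8 / t ^ 8) := by
    calc 1 / √l ≤ 1 / (t ^ 8 / w ^ 8 / 4) := by gcongr
      _ = _ := by field_simp
  have h5 : (0 : ℝ) ≤ ((n - m : ℕ) : ℝ) := Nat.cast_nonneg _
  have h6 : ((n - m : ℕ) : ℝ) * √l ≤ ((n - m : ℕ) : ℝ) * (t ^ 8 / w ^ 8) / 3 := by
    rw [mul_div_assoc]
    gcongr
  have h7 : 0 ≤ ((n - m : ℕ) : ℝ) * (t ^ 8 / w ^ 8) := by positivity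
  have h8 : 0 < w ^ 8 / t ^ 8 := by positivity
  linarith

/-! ### An exponential sum estimate for Y/u with exponents (5/16, 9/16) -/

/-- The van der Corput transform, away from the ends of the range. -/
theorem norm_middle_sum_le {F : ℂ} (hF : ∀ v : ℝ, 0 < v → ‖fresnel v - F‖ ≤ 1 / v)
    {t w α : ℝ} (ht : 0 < t) (hw : 0 < w) (hα : 0 ≤ α) (hα2 : α ≤ 2) {G K : ℕ}
    (hG : t ^ 16 / 4 ≤ (G : ℝ) + 1) (hK : (G : ℝ) + K + 3 ≤ 5 * t ^ 16)
    (hH : 100 * ((G : ℝ) + K) ≤ halfPoint (t ^ 16 * w ^ 32) (G + K)) :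
    ‖∑ n ∈ Ico (cutIndex (t ^ 16 * w ^ 32) α (G + K)) (cutIndex (t ^ 16 * w ^ 32) α G),
        e (t ^ 16 * w ^ 32 / (n + α))‖ ≤
      6000 * ‖F‖ * (t ^ 5 * w ^ 9 + t ^ 10 * w ^ 6) + 8000 * t ^ 16 := by
  set Y := t ^ 16 * w ^ 32 with hY
  have hY0 : 0 < Y := by positivity
  have hKt : (K : ℝ) ≤ 5 * t ^ 16 := by
    have := Nat.cast_nonneg (α := ℝ) G
    linarith
  rcases Nat.eq_zero_or_pos K with rfl | hKpos
  · simp only [Nat.add_zero, Finset.Ico_self, Finset.sum_empty, norm_zero]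
    positivity
  obtain ⟨k, rfl⟩ : ∃ k, K = k + 1 := ⟨K - 1, by omega⟩
  rw [sum_Ico_cutIndex Y α hY0 _ (Nat.le_add_right G (k + 1)), Finset.sum_Ico_eq_sum_range,
    Nat.add_sub_cancel_left]
  set ρ : ℕ → ℝ := fun i => √√(Y / ((G : ℝ) + i + 1)) / √((G : ℝ) + i + 1) with hρ
  set z : ℕ → ℂ := fun i => e (2 * √(Y * ((G : ℝ) + i + 1)) - ((G : ℝ) + i + 1) * α) with hz
  have hblock : ∀ i ∈ range (k + 1),
      ‖∑ n ∈ Ico (cutIndex Y α (G + i + 1)) (cutIndex Y α (G + i)), e (Y / (n + α)) -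
        (ρ i : ℂ) * (2 * F * z i)‖ ≤ 1600 := by
    intro i hi
    rw [Finset.mem_range] at hi
    have h1 := norm_block_sub_le hF hY0 hα hα2 (G + i) (by
      have h2 := halfPoint_anti hY0 (show G + i + 1 ≤ G + (k + 1) by omega)
      have h3 : ((G + i : ℕ) : ℝ) + 1 ≤ (G : ℝ) + (k + 1 : ℕ) := by
        exact_mod_cast (by omega : G + i + 1 ≤ G + (k + 1))
      linarith)
    rw [Nat.cast_add] at h1
    exact h1
  have hρpos : ∀ i, 0 < ρ i := by
    intro i
    simp only [hρ]
    apply div_pos <;> apply Real.sqrt_pos.mpr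
    · apply Real.sqrt_pos.mpr
      positivity
    · positivity
  have hρanti : ∀ i, ρ (i + 1) ≤ ρ i := by
    intro i
    simp only [hρ]
    push_cast
    gcongr <;> linarith
  -- The stationary phase weights decrease, so summation by parts removes them at the cost of the
  -- largest, which is O(w^8/t^8).
  have hab := norm_sum_mul_le_of_abel (Nat.zero_le k) (fun i => (ρ i : ℂ)) z (fun i => -ρ i)
    (M := 1000 * (t ^ 13 * w + t ^ 18 / w ^ 2)) (W := ρ k)
    (by
      intro j _ hj
      rw [Nat.Ico_zero_eq_range]
      apply norm_dual_sum_le ht hw hG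
      have : (j : ℝ) ≤ (k + 1 : ℕ) := by exact_mod_cast hj
      linarith)
    (by rw [Complex.norm_real, Real.norm_eq_abs, abs_of_pos (hρpos k)])
    (by
      intro i _ _
      rw [← Complex.ofReal_sub, Complex.norm_real, Real.norm_eq_abs, abs_sub_comm,
        abs_of_nonneg (sub_nonneg.mpr (hρanti i))]
      linarith)
  rw [Nat.Ico_zero_eq_range] at hab
  have hρ0 : ρ 0 ≤ 3 * (w ^ 8 / t ^ 8) := by
    have h1 : Y / ((G : ℝ) + (0 : ℕ) + 1) ≤ 4 * w ^ 32 := by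
      rw [div_le_iff₀ (by positivity), hY, Nat.cast_zero, add_zero]
      calc t ^ 16 * w ^ 32 = 4 * w ^ 32 * (t ^ 16 / 4) := by ring
        _ ≤ _ := by gcongr
    have h2 : √(Y / ((G : ℝ) + (0 : ℕ) + 1)) ≤ 2 * w ^ 16 := by
      rw [Real.sqrt_le_left (by positivity)]
      exact h1.trans (le_of_eq (by ring))
    have h3 : √√(Y / ((G : ℝ) + (0 : ℕ) + 1)) ≤ 3 / 2 * w ^ 8 := by
      rw [Real.sqrt_le_left (by positivity)]
      refine h2.trans ?_
      have : 0 < w ^ 16 := by positivity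
      nlinarith
    have h4 : t ^ 8 / 2 ≤ √((G : ℝ) + (0 : ℕ) + 1) := by
      apply Real.le_sqrt_of_sq_le
      rw [Nat.cast_zero, add_zero]
      exact le_trans (le_of_eq (by ring)) hG
    calc ρ 0 ≤ (3 / 2 * w ^ 8) / (t ^ 8 / 2) := by
          simp only [hρ]
          gcongr
      _ = _ := by field_simp
  have hsplit : ∑ i ∈ range (k + 1), ∑ n ∈ Ico (cutIndex Y α (G + i + 1)) (cutIndex Y α (G + i)),
      e (Y / (n + α)) = ∑ i ∈ range (k + 1),
        (∑ n ∈ Ico (cutIndex Y α (G + i + 1)) (cutIndex Y α (G + i)), e (Y / (n + α)) -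
          (ρ i : ℂ) * (2 * F * z i)) + 2 * F * ∑ i ∈ range (k + 1), (ρ i : ℂ) * z i := by
    rw [Finset.mul_sum, ← Finset.sum_add_distrib]
    exact Finset.sum_congr rfl fun i _ => by ring
  rw [hsplit]
  refine (norm_add_le _ _).trans ?_
  have hp1 : ‖∑ i ∈ range (k + 1),
        (∑ n ∈ Ico (cutIndex Y α (G + i + 1)) (cutIndex Y α (G + i)), e (Y / (n + α)) -
          (ρ i : ℂ) * (2 * F * z i))‖ ≤ 8000 * t ^ 16 := by
    refine (norm_sum_le _ _).trans ((Finset.sum_le_sum hblock).trans ?_)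
    rw [Finset.sum_const, Finset.card_range, nsmul_eq_mul]
    linarith
  have hp2 : ‖2 * F * ∑ i ∈ range (k + 1), (ρ i : ℂ) * z i‖ ≤
      6000 * ‖F‖ * (t ^ 5 * w ^ 9 + t ^ 10 * w ^ 6) := by
    rw [norm_mul, norm_mul, Complex.norm_ofNat]
    have h1 : ‖∑ i ∈ range (k + 1), (ρ i : ℂ) * z i‖ ≤
        1000 * (t ^ 13 * w + t ^ 18 / w ^ 2) * (3 * (w ^ 8 / t ^ 8)) := by
      refine hab.trans ?_
      gcongr
      linarith
    calc 2 * ‖F‖ * ‖∑ i ∈ range (k + 1), (ρ i : ℂ) * z i‖ ≤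
        2 * ‖F‖ * (1000 * (t ^ 13 * w + t ^ 18 / w ^ 2) * (3 * (w ^ 8 / t ^ 8))) := by gcongr
      _ = _ := by field_simp; ring
  linarith

set_option maxHeartbeats 1000000 in
/-- An analogue for the phase `Y / u` of the estimate given by the exponent pair
`(5 / 16, 9 / 16)`. -/
theorem exists_norm_sum_e_div_le_pow : ∃ C : ℝ, 0 < C ∧ ∀ (t w α : ℝ) (J : ℕ), 0 < t → 0 < w →
    2 ≤ J → w ^ 16 = J → 1 / 4 ≤ t ^ 16 → 0 ≤ α → α ≤ 2 →
    ‖∑ n ∈ Ico (J / 2 + 1) (J + 1), e (t ^ 16 * w ^ 32 / (n + α))‖ ≤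
      C * (t ^ 5 * w ^ 9 + t ^ 10 * w ^ 6) := by
  obtain ⟨F, hF⟩ := exists_fresnel_limit
  refine ⟨6000 * ‖F‖ + 800000, by positivity, ?_⟩
  intro t w α J ht hw hJ hwJ ht4 hα hα2
  have hJ0 : (2 : ℝ) ≤ J := by exact_mod_cast hJ
  have hF0 : 0 ≤ ‖F‖ := norm_nonneg F
  set P := t ^ 5 * w ^ 9 with hP
  set R := t ^ 10 * w ^ 6 with hR
  have hP0 : 0 < P := by positivity
  have hR0 : 0 < R := by positivity
  have hFP : 0 ≤ ‖F‖ * (P + R) := by positivity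
  have hw1 : 1 ≤ w := by
    by_contra hcon
    push Not at hcon
    have : w ^ 16 ≤ 1 := pow_le_one₀ hw.le hcon.le
    linarith
  have hMhalf : (J : ℝ) / 2 ≤ ((J / 2 + 1 : ℕ) : ℝ) := by
    have : (J : ℝ) ≤ 2 * ((J / 2 + 1 : ℕ) : ℝ) := by exact_mod_cast (by omega)
    linarith
  have hMhalf' : ((J / 2 + 1 : ℕ) : ℝ) ≤ (J : ℝ) / 2 + 1 := by
    have : 2 * ((J / 2 + 1 : ℕ) : ℝ) ≤ (J : ℝ) + 2 := by exact_mod_cast (by omega)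
    linarith
  -- Throughout, t^16 = Y/J^2 and w^16 = J. If J < 1000 Y/J^2 the trivial bound J = w^10 w^6 is
  -- already O(t^10 w^6).
  rcases lt_or_ge (w ^ 16) (1000 * t ^ 16) with hA | hA
  · have hwt : w ≤ 2 * t := by
      apply le_of_pow_le_pow_left₀ (n := 16) (by norm_num) (by positivity)
      rw [mul_pow]
      have : 0 < t ^ 16 := by positivity
      linarith
    refine (norm_sum_e_le_card _ _).trans ?_
    rw [Nat.card_Ico]
    have h1 : ((J + 1 - (J / 2 + 1) : ℕ) : ℝ) ≤ J := by exact_mod_cast (by omega)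
    have h2 : (J : ℝ) ≤ 1024 * R := by
      calc (J : ℝ) = w ^ 10 * w ^ 6 := by rw [← hwJ]; ring
        _ ≤ (2 * t) ^ 10 * w ^ 6 := by gcongr
        _ = 1024 * R := by rw [hR]; ring
    linarith
  -- If Y/J^2 is bounded there are too few stationary points for a transform; the second derivative
  -- test suffices.
  rcases le_or_gt t (4 / 3) with hB | hB
  · have h1 := norm_sum_e_div_le_of_second_diff (m := J / 2 + 1) (n := J + 1) ht hw hJ hwJ hα hα2
      hMhalf le_rfl
    refine h1.trans ?_
    have h2 : ((J + 1 - (J / 2 + 1) : ℕ) : ℝ) ≤ w ^ 16 := by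
      rw [hwJ]; exact_mod_cast (by omega)
    have h3 : ((J + 1 - (J / 2 + 1) : ℕ) : ℝ) * (t ^ 8 / w ^ 8) ≤ 3 * P := by
      calc _ ≤ w ^ 16 * (t ^ 8 / w ^ 8) := by gcongr
        _ = t ^ 5 * w ^ 8 * t ^ 3 := by field_simp
        _ ≤ t ^ 5 * w ^ 8 * (4 / 3) ^ 3 := by gcongr
        _ ≤ t ^ 5 * (w ^ 8 * w) * 3 := by
            have : w ^ 8 ≤ w ^ 8 * w := le_mul_of_one_le_right (by positivity) hw1
            have h5 : t ^ 5 * w ^ 8 ≤ t ^ 5 * (w ^ 8 * w) := by gcongr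
            have : 0 < t ^ 5 * w ^ 8 := by positivity
            nlinarith
        _ = 3 * P := by rw [hP]; ring
    have h4 : w ^ 8 / t ^ 8 ≤ 4 * P := by
      have h5 : 1 / 4 ≤ t ^ 13 := by
        rcases le_total 1 t with h | h
        · have := one_le_pow₀ h (n := 13)
          linarith
        · exact ht4.trans (pow_le_pow_of_le_one ht.le h (by norm_num))
      rw [div_le_iff₀ (by positivity)]
      calc w ^ 8 ≤ w ^ 8 * w := le_mul_of_one_le_right (by positivity) hw1
        _ = 4 * (1 / 4) * w ^ 9 := by ring
        _ ≤ 4 * t ^ 13 * w ^ 9 := by gcongr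
        _ = _ := by rw [hP]; ring
    linarith
  have ht1 : 1 ≤ t := by linarith
  set L := t ^ 16 with hL
  set V := (J : ℝ) with hV
  have hL99 : 99 ≤ L := by
    calc (99 : ℝ) ≤ (4 / 3) ^ 16 := by norm_num
      _ ≤ t ^ 16 := by gcongr
  have hVL : 1000 * L ≤ V := by rw [← hwJ]; exact hA
  have hY : L * w ^ 32 = L * V ^ 2 := by rw [← hwJ]; ring
  have hY0 : 0 < L * w ^ 32 := by positivity
  set M := J / 2 + 1 with hM
  set Y := L * w ^ 32 with hYdef
  set u₁ := (M : ℝ) + α with hu₁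
  set u₂ := V + 1 + α with hu₂
  have hu₁l : V / 2 ≤ u₁ := by linarith
  have hu₁u : u₁ ≤ 0.51 * V := by linarith
  have hu₂l : V ≤ u₂ := by linarith
  have hu₂u : u₂ ≤ 1.01 * V := by linarith
  have hV0 : 0 < V := by linarith
  have hu₁0 : 0 < u₁ := by linarith
  have hu₂0 : 0 < u₂ := by linarith
  -- `Z₁` and `Z₂` are the values of Y/u^2 at the two ends of the range. Rounding with the shift 1/2
  -- selects the blocks lying wholly inside it, with dual index from about L to about 4L.
  set Z₁ := Y / u₁ ^ 2 with hZ₁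
  set Z₂ := Y / u₂ ^ 2 with hZ₂
  have hZ₁Y : Z₁ * u₁ ^ 2 = Y := by rw [hZ₁]; field_simp
  have hZ₂Y : Z₂ * u₂ ^ 2 = Y := by rw [hZ₂]; field_simp
  have hZ₁u : Z₁ ≤ 4 * L := by
    rw [hZ₁, hY, div_le_iff₀ (by positivity)]
    calc L * V ^ 2 = 4 * L * (V / 2) ^ 2 := by ring
      _ ≤ _ := by gcongr
  have hZ₁l : 3.8 * L ≤ Z₁ := by
    rw [hZ₁, hY, le_div_iff₀ (by positivity)]
    calc 3.8 * L * u₁ ^ 2 ≤ 3.8 * L * (0.51 * V) ^ 2 := by gcongr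
      _ = 0.98838 * (L * V ^ 2) := by ring
      _ ≤ _ := by
        have : 0 < L * V ^ 2 := by positivity
        linarith
  have hZ₂u : Z₂ ≤ L := by
    rw [hZ₂, hY, div_le_iff₀ (by positivity)]
    gcongr
  have hZ₂l : L / 1.03 ≤ Z₂ := by
    rw [hZ₂, hY, le_div_iff₀ (by positivity)]
    calc L / 1.03 * u₂ ^ 2 ≤ L / 1.03 * (1.01 * V) ^ 2 := by gcongr
      _ = (1.01 ^ 2 / 1.03) * (L * V ^ 2) := by ring
      _ ≤ 1 * (L * V ^ 2) := by gcongr; norm_num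
      _ = _ := one_mul _
  have hZ₂half : L / 2 ≤ Z₂ := by
    refine le_trans ?_ hZ₂l
    gcongr
    norm_num
  set H := ⌊Z₁ - 1 / 2⌋₊ with hH
  set G := ⌈Z₂ - 1 / 2⌉₊ with hG
  have hH1 : (H : ℝ) + 1 / 2 ≤ Z₁ := by
    have := Nat.floor_le (show 0 ≤ Z₁ - 1 / 2 by linarith)
    linarith
  have hH2 : Z₁ - 1 < (H : ℝ) + 1 / 2 := by
    have := Nat.lt_floor_add_one (Z₁ - 1 / 2)
    linarith
  have hG1 : Z₂ ≤ (G : ℝ) + 1 / 2 := by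
    have := Nat.le_ceil (Z₂ - 1 / 2)
    linarith
  have hG2 : (G : ℝ) + 1 / 2 < Z₂ + 1 := by
    have := Nat.ceil_lt_add_one (show 0 ≤ Z₂ - 1 / 2 by linarith)
    linarith
  have hGH : G ≤ H := by
    have : (G : ℝ) ≤ H := by linarith
    exact_mod_cast this
  have hhH := halfPoint_sq hY0 H
  have hhG := halfPoint_sq hY0 G
  have hpH := halfPoint_pos hY0 H
  have hpG := halfPoint_pos hY0 G
  have hhalfH : u₁ ≤ halfPoint Y H := by
    apply le_of_sq_le_sq _ hpH.le
    have h0 : 0 < (H : ℝ) + 1 / 2 := by positivity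
    refine le_of_mul_le_mul_right ?_ h0
    rw [hhH, ← hZ₁Y, mul_comm]
    gcongr
  have hhalfG : halfPoint Y G ≤ u₂ := by
    apply le_of_sq_le_sq _ hu₂0.le
    have h0 : 0 < (G : ℝ) + 1 / 2 := by positivity
    refine le_of_mul_le_mul_right ?_ h0
    rw [hhG, ← hZ₂Y, mul_comm]
    gcongr
  have hhalfH' : halfPoint Y H ≤ u₁ * (1 + 1 / Z₁) := by
    apply le_of_sq_le_sq _ (by positivity)
    have h0 : 0 < Z₁ - 1 := by linarith
    refine le_of_mul_le_mul_right ?_ h0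
    calc halfPoint Y H ^ 2 * (Z₁ - 1) ≤ halfPoint Y H ^ 2 * (H + 1 / 2) := by gcongr
      _ = Z₁ * u₁ ^ 2 := by rw [hhH, hZ₁Y]
      _ ≤ ((1 + 1 / Z₁) ^ 2 * (Z₁ - 1)) * u₁ ^ 2 := by
          gcongr
          have hz : 0 < Z₁ := by linarith
          have : (1 + 1 / Z₁) ^ 2 * (Z₁ - 1) - Z₁ = 1 - 1 / Z₁ - (1 / Z₁) ^ 2 := by
            field_simp; ring
          have hz2 : 1 / Z₁ ≤ 1 / 2 := by gcongr; linarith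
          have hz3 : 0 < 1 / Z₁ := by positivity
          nlinarith
      _ = _ := by ring
  have hhalfG' : u₂ * (1 - 1 / Z₂) ≤ halfPoint Y G := by
    apply le_of_sq_le_sq _ hpG.le
    have h0 : 0 < Z₂ + 1 := by linarith
    refine le_of_mul_le_mul_right ?_ h0
    have hz : 0 < Z₂ := by linarith
    calc (u₂ * (1 - 1 / Z₂)) ^ 2 * (Z₂ + 1) = ((1 - 1 / Z₂) ^ 2 * (Z₂ + 1)) * u₂ ^ 2 := by ring
      _ ≤ Z₂ * u₂ ^ 2 := by
          gcongr
          have : (1 - 1 / Z₂) ^ 2 * (Z₂ + 1) - Z₂ = -1 - 1 / Z₂ + (1 / Z₂) ^ 2 := by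
            field_simp; ring
          have hz2 : 1 / Z₂ ≤ 1 / 2 := by gcongr; linarith
          have hz3 : 0 < 1 / Z₂ := by positivity
          nlinarith
      _ = halfPoint Y G ^ 2 * (G + 1 / 2) := by rw [hhG, hZ₂Y]
      _ ≤ _ := by gcongr
  have hcutH : M ≤ cutIndex Y α H := by
    have h1 := Nat.le_ceil (halfPoint Y H - α)
    have : (M : ℝ) ≤ (cutIndex Y α H : ℝ) := le_trans (by linarith) h1
    exact_mod_cast this
  have hcutG : cutIndex Y α G ≤ J + 1 := by
    apply Nat.ceil_le.mpr
    push_cast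
    linarith
  have hcutHG : cutIndex Y α H ≤ cutIndex Y α G := cutIndex_anti hY0 hGH
  rw [← Finset.sum_Ico_consecutive _ hcutH (hcutHG.trans hcutG),
    ← Finset.sum_Ico_consecutive _ hcutHG hcutG]
  have hwt : t ≤ w := by
    apply le_of_pow_le_pow_left₀ (n := 16) (by norm_num) hw.le
    change L ≤ w ^ 16
    rw [hwJ]; linarith
  have hVL' : V / L = w ^ 16 / t ^ 16 := by rw [← hwJ]
  have h1VL : 1 ≤ V / L := by rw [le_div_iff₀ (by linarith)]; linarith
  -- The incomplete block at either end has at most 2V/L terms, short enough for the second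
  -- derivative test.
  have hedge : ∀ m n : ℕ, M ≤ m → n ≤ J + 1 → ((n - m : ℕ) : ℝ) ≤ 2 * (V / L) →
      ‖∑ i ∈ Ico m n, e (Y / (i + α))‖ ≤ 300000 * P := by
    intro m n hm hn hmn
    have hmM : (M : ℝ) ≤ m := by exact_mod_cast hm
    have h1 := norm_sum_e_div_le_of_second_diff (m := m) (n := n) ht hw hJ hwJ hα hα2
      (hMhalf.trans hmM) hn
    refine h1.trans ?_
    have h2 : ((n - m : ℕ) : ℝ) * (t ^ 8 / w ^ 8) ≤ 2 * (w ^ 8 / t ^ 8) := by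
      calc _ ≤ 2 * (V / L) * (t ^ 8 / w ^ 8) := by gcongr
        _ = _ := by rw [hVL']; field_simp
    have h3 : w ^ 8 / t ^ 8 ≤ P := by
      calc w ^ 8 / t ^ 8 ≤ w ^ 8 / 1 := by gcongr; exact one_le_pow₀ ht1
        _ = 1 * (w ^ 8 * 1) := by ring
        _ ≤ t ^ 5 * (w ^ 8 * w) := by gcongr; exact one_le_pow₀ ht1
        _ = P := by rw [hP]; ring
    linarith
  have hE1 := hedge M (cutIndex Y α H) le_rfl (hcutHG.trans hcutG) (by
    rw [Nat.cast_sub hcutH]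
    have h1 := Nat.ceil_lt_add_one (show 0 ≤ halfPoint Y H - α by linarith)
    change (cutIndex Y α H : ℝ) < _ at h1
    have h2 : u₁ * (1 / Z₁) ≤ V / L := by
      rw [mul_one_div, div_le_div_iff₀ (by linarith) (by linarith)]
      calc u₁ * L ≤ 0.51 * V * L := by gcongr
        _ ≤ V * (3.8 * L) := by
          have : 0 < V * L := by positivity
          linarith
        _ ≤ V * Z₁ := by gcongr
    linarith)
  have hE2 := hedge (cutIndex Y α G) (J + 1) (hcutH.trans hcutHG) le_rfl (by
    rw [Nat.cast_sub hcutG]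
    have h1 := Nat.le_ceil (halfPoint Y G - α)
    change _ ≤ (cutIndex Y α G : ℝ) at h1
    have h2 : u₂ * (1 / Z₂) ≤ 2 * (V / L) := by
      rw [mul_one_div, ← mul_div_assoc, div_le_div_iff₀ (by linarith) (by linarith)]
      calc u₂ * L ≤ 1.01 * V * L := by gcongr
        _ = 1.01 * (V * L) := by ring
        _ ≤ 2 / 1.03 * (V * L) := by gcongr; norm_num
        _ = 2 * V * (L / 1.03) := by ring
        _ ≤ 2 * V * Z₂ := by gcongr
    push_cast
    linarith)
  have hmid := norm_middle_sum_le hF ht hw hα hα2 (G := G) (K := H - G) (by linarith) (by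
    rw [Nat.cast_sub hGH]; linarith) (by
    rw [Nat.add_sub_cancel' hGH, Nat.cast_sub hGH]
    linarith)
  rw [Nat.add_sub_cancel' hGH] at hmid
  -- The O(1) errors of the O(t^16) blocks are covered by the second term of the bound.
  have ht16 : t ^ 16 ≤ R := by
    calc t ^ 16 = t ^ 10 * t ^ 6 := by ring
      _ ≤ t ^ 10 * w ^ 6 := by gcongr
  refine (norm_add_le _ _).trans ((add_le_add hE1 ((norm_add_le _ _).trans
    (add_le_add hmid hE2))).trans ?_)
  linarith

/-- Passage to real exponents: t and w are the sixteenth roots of Y/J^2 and J, introduced above so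
that only natural powers occur there. -/
theorem exists_norm_sum_e_div_le : ∃ C : ℝ, 0 < C ∧ ∀ (Y α : ℝ) (J : ℕ), 2 ≤ J →
    (J : ℝ) ^ 2 ≤ 4 * Y → 0 ≤ α → α ≤ 2 →
    ‖∑ n ∈ Ioc (J / 2) J, e (Y / (n + α))‖ ≤
      C * ((Y / (J : ℝ) ^ 2) ^ (5 / 16 : ℝ) * (J : ℝ) ^ (9 / 16 : ℝ) +
        (Y / (J : ℝ) ^ 2) ^ (5 / 8 : ℝ) * (J : ℝ) ^ (3 / 8 : ℝ)) := by
  obtain ⟨C, hC, h⟩ := exists_norm_sum_e_div_le_pow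
  refine ⟨C, hC, fun Y α J hJ hY hα hα2 => ?_⟩
  have hJ0 : (0 : ℝ) < J := by exact_mod_cast (by omega : 0 < J)
  have hL0 : 1 / 4 ≤ Y / (J : ℝ) ^ 2 := by
    rw [le_div_iff₀ (by positivity)]; linarith
  have hL : 0 < Y / (J : ℝ) ^ 2 := by linarith
  have hpow : ∀ (x : ℝ), 0 < x → ∀ k : ℕ, (x ^ (1 / 16 : ℝ)) ^ k = x ^ ((k : ℝ) / 16) := by
    intro x hx k
    rw [← Real.rpow_natCast, ← Real.rpow_mul hx.le]
    congr 1
    ring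
  have h16 : ∀ (x : ℝ), 0 < x → (x ^ (1 / 16 : ℝ)) ^ 16 = x := by
    intro x hx
    rw [hpow x hx]
    norm_num
  have h1 := h ((Y / (J : ℝ) ^ 2) ^ (1 / 16 : ℝ)) ((J : ℝ) ^ (1 / 16 : ℝ)) α J (by positivity)
    (by positivity) hJ (h16 _ hJ0) (by rw [h16 _ hL]; exact hL0) hα hα2
  have h2 : (((J : ℝ) ^ (1 / 16 : ℝ)) ^ 32) = (J : ℝ) ^ 2 := by
    rw [show 32 = 16 * 2 by norm_num, pow_mul, h16 _ hJ0]
  rw [h16 _ hL, h2, div_mul_cancel₀ _ (by positivity), hpow _ hL, hpow _ hL, hpow _ hJ0,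
    hpow _ hJ0] at h1
  have hIco : Ioc (J / 2) J = Ico (J / 2 + 1) (J + 1) := by
    ext n
    rw [Finset.mem_Ioc, Finset.mem_Ico]
    omega
  rw [hIco]
  norm_num at h1 ⊢
  exact h1

/-! ### From exponential sums to sawtooth sums -/

/-- The sawtooth function `t - [t] - 1 / 2`. -/
noncomputable def sawtooth (t : ℝ) : ℝ := Int.fract t - 1 / 2

/-- Half the periodic second Bernoulli function, a primitive of the sawtooth function. -/
noncomputable def sawtoothPrimitive (t : ℝ) : ℝ := (Int.fract t ^ 2 - Int.fract t + 1 / 6) / 2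

theorem abs_sawtooth_le (t : ℝ) : |sawtooth t| ≤ 1 / 2 := by
  rw [sawtooth, abs_le]
  constructor <;> linarith [Int.fract_nonneg t, Int.fract_lt_one t]

theorem floor_eq_sub_sawtooth (t : ℝ) : (⌊t⌋ : ℝ) = t - 1 / 2 - sawtooth t := by
  rw [sawtooth, Int.fract]; ring

/-- The sawtooth has slope 1 and only downward jumps, so ψ(t) ≤ ψ(t - v) + v for v ≥ 0; integrating
over 0 ≤ v ≤ δ gives the claim. This one-sided regularity replaces a truncated Fourier expansion of
ψ. -/
theorem sawtooth_upper {δ : ℝ} (h0 : 0 < δ) (h1 : δ ≤ 1) (t : ℝ) :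
    δ * sawtooth t ≤ -(sawtoothPrimitive (t + -δ) - sawtoothPrimitive t) + δ ^ 2 := by
  have a := Int.fract_nonneg t
  have b := Int.fract_lt_one t
  rw [sawtoothPrimitive, sawtoothPrimitive, sawtooth]
  set u := Int.fract t with hu
  rcases le_or_gt δ u with h | h
  · have hf : Int.fract (t + -δ) = u - δ := by
      rw [Int.fract_eq_iff]
      exact ⟨by linarith, by linarith, ⌊t⌋, by rw [hu, Int.fract]; ring⟩
    rw [hf]
    nlinarith
  · have hf : Int.fract (t + -δ) = u - δ + 1 := by
      rw [Int.fract_eq_iff]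
      exact ⟨by linarith, by linarith, ⌊t⌋ - 1, by rw [hu, Int.fract]; push_cast; ring⟩
    rw [hf]
    nlinarith

theorem sawtooth_lower {δ : ℝ} (h0 : 0 < δ) (h1 : δ ≤ 1) (t : ℝ) :
    sawtoothPrimitive (t + δ) - sawtoothPrimitive t - δ ^ 2 ≤ δ * sawtooth t := by
  have a := Int.fract_nonneg t
  have b := Int.fract_lt_one t
  rw [sawtoothPrimitive, sawtoothPrimitive, sawtooth]
  set u := Int.fract t with hu
  rcases lt_or_ge (u + δ) 1 with h | h
  · have hf : Int.fract (t + δ) = u + δ := by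
      rw [Int.fract_eq_iff]
      exact ⟨by linarith, by linarith, ⌊t⌋, by rw [hu, Int.fract]; ring⟩
    rw [hf]
    nlinarith
  · have hf : Int.fract (t + δ) = u + δ - 1 := by
      rw [Int.fract_eq_iff]
      exact ⟨by linarith, by linarith, ⌊t⌋ + 1, by rw [hu, Int.fract]; push_cast; ring⟩
    rw [hf]
    nlinarith

theorem re_e (t : ℝ) : (e t).re = Real.cos (2 * Real.pi * t) := by
  unfold e
  rw [show 2 * (Real.pi : ℂ) * Complex.I * t = ((2 * Real.pi * t : ℝ) : ℂ) * Complex.I by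
    push_cast; ring, Complex.exp_ofReal_mul_I_re]

theorem hasSum_sawtoothPrimitive (t : ℝ) :
    HasSum (fun h : ℕ => 1 / (2 * Real.pi ^ 2) * (1 / (h : ℝ) ^ 2 * (e (h * t)).re))
      (sawtoothPrimitive t) := by
  have h1 := hasSum_one_div_nat_pow_mul_cos one_ne_zero (x := Int.fract t)
    ⟨Int.fract_nonneg t, (Int.fract_lt_one t).le⟩
  have h2 := h1.mul_left (1 / (2 * Real.pi ^ 2))
  have hpi := Real.pi_pos
  have hfun : (fun h : ℕ => 1 / (2 * Real.pi ^ 2) * (1 / (h : ℝ) ^ 2 * (e (h * t)).re)) =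
      fun h : ℕ => 1 / (2 * Real.pi ^ 2) * (1 / (h : ℝ) ^ (2 * 1) *
        Real.cos (2 * Real.pi * h * Int.fract t)) := by
    funext h
    have h3 : e (h * t) = e (h * Int.fract t) := by
      rw [← e_add_int (h * Int.fract t) (h * ⌊t⌋)]
      congr 1
      rw [Int.fract]
      push_cast
      ring
    rw [h3, re_e]
    ring_nf
  rw [hfun]
  have hb : (Polynomial.map (algebraMap ℚ ℝ) (Polynomial.bernoulli (2 * 1))).eval (Int.fract t) =
      Int.fract t ^ 2 - Int.fract t + 1 / 6 := by
    simp [Polynomial.bernoulli_def, Finset.sum_range_succ, bernoulli_eq_bernoulli'_of_ne_one]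
    ring
  have hval : sawtoothPrimitive t = 1 / (2 * Real.pi ^ 2) *
      ((-1) ^ (1 + 1) * (2 * Real.pi) ^ (2 * 1) / 2 / (2 * 1).factorial *
        (Polynomial.map (algebraMap ℚ ℝ) (Polynomial.bernoulli (2 * 1))).eval (Int.fract t)) := by
    rw [hb, sawtoothPrimitive]
    norm_num [Nat.factorial]
    field_simp
  rw [hval]
  exact h2

/-- The shift by σ multiplies the h-th Fourier term by e(hσ) - 1, which is O(min(1, h|σ|)); with the
coefficient 1/h^2 this is the kernel min(1/h^2, |σ|/h). At h = 0 the kernel is 0, as division by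
zero gives 0. -/
theorem abs_sum_sawtoothPrimitive_sub_le {ι : Type*} (s : Finset ι) (τ : ι → ℝ) (σ : ℝ) {c : ℝ}
    {B : ℕ → ℝ} (hB : ∀ h : ℕ, 1 ≤ h → ‖∑ i ∈ s, e (h * τ i)‖ ≤ B h)
    (hsum : ∀ K, ∑ h ∈ range K, min (1 / (h : ℝ) ^ 2) (|σ| / h) * B h ≤ c)
    (hB0 : ∀ h, 0 ≤ B h) :
    |∑ i ∈ s, (sawtoothPrimitive (τ i + σ) - sawtoothPrimitive (τ i))| ≤ c := by
  have h1 : HasSum (fun h : ℕ => ∑ i ∈ s,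
      (1 / (2 * Real.pi ^ 2) * (1 / (h : ℝ) ^ 2 * (e (h * (τ i + σ))).re) -
        1 / (2 * Real.pi ^ 2) * (1 / (h : ℝ) ^ 2 * (e (h * τ i)).re)))
      (∑ i ∈ s, (sawtoothPrimitive (τ i + σ) - sawtoothPrimitive (τ i))) :=
    hasSum_sum fun i _ => (hasSum_sawtoothPrimitive _).sub (hasSum_sawtoothPrimitive _)
  have hk0 : ∀ h : ℕ, 0 ≤ min (1 / (h : ℝ) ^ 2) (|σ| / h) * B h := fun h =>
    mul_nonneg (le_min (by positivity) (by positivity)) (hB0 h)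
  have hs := summable_of_sum_range_le hk0 hsum
  have hle := Real.tsum_le_of_sum_range_le hk0 hsum
  rw [← Real.norm_eq_abs]
  refine (h1.norm_le_of_bounded hs.hasSum fun h => ?_).trans hle
  rcases Nat.eq_zero_or_pos h with rfl | hh
  · simp
  have hh0 : (0 : ℝ) < h := by exact_mod_cast hh
  have heq : ∑ i ∈ s, (1 / (2 * Real.pi ^ 2) * (1 / (h : ℝ) ^ 2 * (e (h * (τ i + σ))).re) -
        1 / (2 * Real.pi ^ 2) * (1 / (h : ℝ) ^ 2 * (e (h * τ i)).re)) =
      1 / (2 * Real.pi ^ 2) * (1 / (h : ℝ) ^ 2) *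
        ((e (h * σ) - 1) * ∑ i ∈ s, e (h * τ i)).re := by
    rw [Finset.mul_sum, Complex.re_sum, Finset.mul_sum]
    refine Finset.sum_congr rfl fun i _ => ?_
    rw [show (h : ℝ) * (τ i + σ) = h * σ + h * τ i by ring, e_add, sub_mul, one_mul,
      Complex.sub_re]
    ring
  rw [heq, norm_mul, Real.norm_eq_abs, abs_of_nonneg (by positivity), Real.norm_eq_abs]
  have h2 : |((e (h * σ) - 1) * ∑ i ∈ s, e (h * τ i)).re| ≤ ‖e (h * σ) - 1‖ * B h := by
    refine (Complex.abs_re_le_norm _).trans ?_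
    rw [norm_mul]
    gcongr
    exact hB h hh
  have h3 : ‖e (h * σ) - 1‖ ≤ 2 := by
    refine (norm_sub_le _ _).trans ?_
    rw [norm_e, norm_one]; norm_num
  have h4 : ‖e (h * σ) - 1‖ ≤ 2 * Real.pi * (h * |σ|) := by
    have := norm_e_sub_le (h * σ) 0
    rwa [e_zero, sub_zero, abs_mul, abs_of_pos hh0] at this
  have hpi := Real.pi_gt_three
  have h5 : 1 / (2 * Real.pi ^ 2) * (1 / (h : ℝ) ^ 2) * ‖e (h * σ) - 1‖ ≤
      min (1 / (h : ℝ) ^ 2) (|σ| / h) := by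
    apply le_min
    · calc 1 / (2 * Real.pi ^ 2) * (1 / (h : ℝ) ^ 2) * ‖e (h * σ) - 1‖
          ≤ 1 / (2 * 3 ^ 2) * (1 / (h : ℝ) ^ 2) * 2 := by gcongr
        _ ≤ 1 / (h : ℝ) ^ 2 := by
          have : 0 < 1 / (h : ℝ) ^ 2 := by positivity
          linarith
    · calc 1 / (2 * Real.pi ^ 2) * (1 / (h : ℝ) ^ 2) * ‖e (h * σ) - 1‖
          ≤ 1 / (2 * Real.pi ^ 2) * (1 / (h : ℝ) ^ 2) * (2 * Real.pi * (h * |σ|)) := by gcongr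
        _ = 1 / Real.pi * (|σ| / h) := by field_simp
        _ ≤ 1 * (|σ| / h) := by
          gcongr
          rw [div_le_one (by linarith)]
          linarith
        _ = _ := one_mul _
  calc _ ≤ 1 / (2 * Real.pi ^ 2) * (1 / (h : ℝ) ^ 2) * (‖e (h * σ) - 1‖ * B h) := by gcongr
    _ = (1 / (2 * Real.pi ^ 2) * (1 / (h : ℝ) ^ 2) * ‖e (h * σ) - 1‖) * B h := by ring
    _ ≤ _ := by
      gcongr
      exact hB0 h

theorem abs_sum_sawtooth_le {ι : Type*} (s : Finset ι) (τ : ι → ℝ) {δ c : ℝ} (h0 : 0 < δ)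
    (h1 : δ ≤ 1) {B : ℕ → ℝ} (hB : ∀ h : ℕ, 1 ≤ h → ‖∑ i ∈ s, e (h * τ i)‖ ≤ B h)
    (hsum : ∀ K, ∑ h ∈ range K, min (1 / (h : ℝ) ^ 2) (δ / h) * B h ≤ δ * c)
    (hB0 : ∀ h, 0 ≤ B h) :
    |∑ i ∈ s, sawtooth (τ i)| ≤ δ * s.card + c := by
  have a1 := abs_sum_sawtoothPrimitive_sub_le s τ (-δ) hB (c := δ * c)
    (by rw [abs_neg, abs_of_pos h0]; exact hsum) hB0
  have a2 := abs_sum_sawtoothPrimitive_sub_le s τ δ hB (c := δ * c)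
    (by rw [abs_of_pos h0]; exact hsum) hB0
  have b1 : δ * ∑ i ∈ s, sawtooth (τ i) ≤
      -(∑ i ∈ s, (sawtoothPrimitive (τ i + -δ) - sawtoothPrimitive (τ i))) + δ ^ 2 * s.card := by
    rw [Finset.mul_sum]
    refine (Finset.sum_le_sum fun i _ => sawtooth_upper h0 h1 (τ i)).trans (le_of_eq ?_)
    rw [Finset.sum_add_distrib, Finset.sum_neg_distrib, Finset.sum_const, nsmul_eq_mul]
    ring
  have b2 : ∑ i ∈ s, (sawtoothPrimitive (τ i + δ) - sawtoothPrimitive (τ i)) - δ ^ 2 * s.card ≤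
      δ * ∑ i ∈ s, sawtooth (τ i) := by
    rw [Finset.mul_sum]
    refine le_trans (le_of_eq ?_) (Finset.sum_le_sum fun i _ => sawtooth_lower h0 h1 (τ i))
    rw [Finset.sum_sub_distrib _ (fun _ => δ ^ 2), Finset.sum_const, nsmul_eq_mul]
    ring
  have c1 := abs_le.mp a1
  have c2 := abs_le.mp a2
  rw [abs_le]
  constructor
  · refine le_of_mul_le_mul_left ?_ h0
    linarith [c2.1]
  · refine le_of_mul_le_mul_left ?_ h0
    linarith [c1.1]

theorem sum_rpow_sub_one_le {k : ℝ} (hk : 0 < k) (hk1 : k < 1) (n : ℕ) :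
    ∑ i ∈ range n, ((i : ℝ) + 1) ^ (k - 1) ≤ (n : ℝ) ^ k / k := by
  induction n with
  | zero => simp [Real.zero_rpow hk.ne']
  | succ n ih =>
    rw [Finset.sum_range_succ]
    have h1 : k * ((n : ℝ) + 1) ^ (k - 1) ≤ ((n : ℝ) + 1) ^ k - (n : ℝ) ^ k := by
      rcases Nat.eq_zero_or_pos n with rfl | hn
      · simp [Real.zero_rpow hk.ne', hk1.le]
      · have hn0 : (0 : ℝ) < n := by exact_mod_cast hn
        have := (mul_le_sub_of_hasDerivAt (f := fun x : ℝ => x ^ k) (p := n) (q := n + 1)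
          (d := 1) (x := n) (m := k * ((n : ℝ) + 1) ^ (k - 1)) (M := k * (n : ℝ) ^ (k - 1))
          zero_le_one
          (fun x hx _ => Real.hasDerivAt_rpow_const (Or.inl (hn0.trans_le hx).ne'))
          (fun x hx hx' => ⟨by
            have := Real.rpow_le_rpow_of_nonpos (hn0.trans_le hx) hx' (by linarith : k - 1 ≤ 0)
            gcongr, by
            have := Real.rpow_le_rpow_of_nonpos hn0 hx (by linarith : k - 1 ≤ 0)
            gcongr⟩) le_rfl le_rfl).1
        linarith
    push_cast
    rw [le_div_iff₀ hk] at ih ⊢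
    nlinarith

theorem sum_rpow_sub_two_le {k : ℝ} (hk1 : k < 1) {H : ℕ} (hH : 1 ≤ H) (n : ℕ) :
    ∑ i ∈ range n, ((H : ℝ) + i + 1) ^ (k - 2) ≤
      ((H : ℝ) ^ (k - 1) - ((H : ℝ) + n) ^ (k - 1)) / (1 - k) := by
  have hk : 0 < 1 - k := by linarith
  induction n with
  | zero => simp
  | succ n ih =>
    rw [Finset.sum_range_succ]
    have hn0 : (0 : ℝ) < (H : ℝ) + n := by
      have : (1 : ℝ) ≤ H := by exact_mod_cast hH
      positivity
    have := (mul_le_sub_of_hasDerivAt (f := fun x : ℝ => x ^ (k - 1)) (p := H + n)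
      (q := H + n + 1) (d := 1) (x := H + n) (m := (k - 1) * ((H : ℝ) + n) ^ (k - 1 - 1))
      (M := (k - 1) * ((H : ℝ) + n + 1) ^ (k - 1 - 1)) zero_le_one
      (fun x hx _ => Real.hasDerivAt_rpow_const (Or.inl (hn0.trans_le hx).ne'))
      (fun x hx hx' => ⟨mul_le_mul_of_nonpos_left
          (Real.rpow_le_rpow_of_nonpos hn0 hx (by linarith)) (by linarith),
        mul_le_mul_of_nonpos_left (Real.rpow_le_rpow_of_nonpos (hn0.trans_le hx) hx' (by linarith))
          (by linarith)⟩) le_rfl le_rfl).2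
    rw [show k - 1 - 1 = k - 2 by ring] at this
    push_cast
    rw [← add_assoc]
    rw [le_div_iff₀ hk] at ih ⊢
    nlinarith

/-- The kernel changes form at h = 1/δ. The sum of δh^(k-1) below it and of h^(k-2) above it both
have order δ^(1-k), since 0 < k < 1. -/
theorem sum_kernel_mul_rpow_le {k δ : ℝ} (hk : 0 < k) (hk1 : k < 1) (h0 : 0 < δ) (h1 : δ ≤ 1)
    (K : ℕ) : ∑ h ∈ range K, min (1 / (h : ℝ) ^ 2) (δ / h) * (h : ℝ) ^ k ≤
      (1 / k + 2 / (1 - k)) * δ ^ (1 - k) := by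
  set H := ⌊1 / δ⌋₊ with hH
  have hinv : 1 ≤ 1 / δ := by rw [le_div_iff₀ h0]; linarith
  have hH1 : 1 ≤ H := Nat.le_floor (by simpa using hinv)
  have hH1' : (1 : ℝ) ≤ H := by exact_mod_cast hH1
  have hHle : (H : ℝ) ≤ 1 / δ := Nat.floor_le (by positivity)
  have hHge : 1 / (2 * δ) ≤ H := by
    have h2 : 1 / δ < H + 1 := Nat.lt_floor_add_one _
    rw [show 1 / (2 * δ) = 1 / δ / 2 by field_simp]
    linarith
  set f : ℕ → ℝ := fun h => min (1 / (h : ℝ) ^ 2) (δ / h) * (h : ℝ) ^ k with hf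
  have hf0 : ∀ h, 0 ≤ f h := fun h =>
    mul_nonneg (le_min (by positivity) (by positivity)) (by positivity)
  have hle1 : ∑ h ∈ range K, f h ≤ ∑ h ∈ range (1 + (H + K)), f h :=
    Finset.sum_le_sum_of_subset_of_nonneg (Finset.range_mono (by omega)) fun i _ _ => hf0 i
  have hA : ∑ i ∈ range H, f (1 + i) ≤ δ ^ (1 - k) / k := by
    calc ∑ i ∈ range H, f (1 + i) ≤ ∑ i ∈ range H, δ * ((i : ℝ) + 1) ^ (k - 1) := by
          refine Finset.sum_le_sum fun i _ => ?_
          have hi : (0 : ℝ) < (i : ℝ) + 1 := by positivity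
          simp only [hf]
          push_cast
          rw [add_comm 1 (i : ℝ), Real.rpow_sub_one hi.ne']
          calc _ ≤ δ / ((i : ℝ) + 1) * ((i : ℝ) + 1) ^ k := by
                gcongr
                exact min_le_right _ _
            _ = _ := by ring
      _ = δ * ∑ i ∈ range H, ((i : ℝ) + 1) ^ (k - 1) := by rw [Finset.mul_sum]
      _ ≤ δ * ((H : ℝ) ^ k / k) := by
          gcongr
          exact sum_rpow_sub_one_le hk hk1 H
      _ ≤ δ * ((1 / δ) ^ k / k) := by gcongr
      _ = δ ^ (1 - k) / k := by
          rw [one_div, Real.inv_rpow h0.le, Real.rpow_sub h0, Real.rpow_one]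
          ring
  have hB : ∑ i ∈ range K, f (1 + (H + i)) ≤ 2 * δ ^ (1 - k) / (1 - k) := by
    have hk' : 0 < 1 - k := by linarith
    calc ∑ i ∈ range K, f (1 + (H + i)) ≤ ∑ i ∈ range K, ((H : ℝ) + i + 1) ^ (k - 2) := by
          refine Finset.sum_le_sum fun i _ => ?_
          have hi : (0 : ℝ) < (H : ℝ) + i + 1 := by positivity
          simp only [hf]
          push_cast
          rw [add_comm 1 ((H : ℝ) + i), Real.rpow_sub hi, Real.rpow_two]
          calc _ ≤ 1 / ((H : ℝ) + i + 1) ^ 2 * ((H : ℝ) + i + 1) ^ k := by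
                gcongr
                exact min_le_left _ _
            _ = _ := by ring
      _ ≤ ((H : ℝ) ^ (k - 1) - ((H : ℝ) + K) ^ (k - 1)) / (1 - k) := sum_rpow_sub_two_le hk1 hH1 K
      _ ≤ (H : ℝ) ^ (k - 1) / (1 - k) := by
          gcongr
          have : 0 ≤ ((H : ℝ) + K) ^ (k - 1) := by positivity
          linarith
      _ ≤ (2 * δ ^ (1 - k)) / (1 - k) := by
          gcongr
          calc (H : ℝ) ^ (k - 1) ≤ (1 / (2 * δ)) ^ (k - 1) :=
                Real.rpow_le_rpow_of_nonpos (by positivity) hHge (by linarith)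
            _ = 2 ^ (1 - k) * δ ^ (1 - k) := by
                rw [one_div, Real.inv_rpow (by positivity), ← Real.rpow_neg (by positivity),
                  neg_sub, Real.mul_rpow (by norm_num) h0.le]
            _ ≤ 2 ^ (1 : ℝ) * δ ^ (1 - k) := by
                gcongr
                · norm_num
                · linarith
            _ = _ := by rw [Real.rpow_one]
  rw [Finset.sum_range_add, Finset.sum_range_add, Finset.sum_range_one] at hle1
  have hf00 : f 0 = 0 := by simp [hf]
  rw [hf00, zero_add] at hle1
  refine hle1.trans ((add_le_add hA hB).trans (le_of_eq ?_))
  ring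

/-- A sum of sawtooth values, from bounds with two power terms for the exponential sums. -/
theorem exists_abs_sum_sawtooth_le {k₁ k₂ : ℝ} (h1 : 0 < k₁) (h1' : k₁ < 1) (h2 : 0 < k₂)
    (h2' : k₂ < 1) : ∃ C : ℝ, 0 < C ∧ ∀ (s : Finset ℕ) (τ : ℕ → ℝ) (N D₁ D₂ : ℝ), 0 < N →
    (s.card : ℝ) ≤ N → 0 < D₁ → 0 < D₂ →
    (∀ h : ℕ, 1 ≤ h → ‖∑ i ∈ s, e (h * τ i)‖ ≤ D₁ * (h : ℝ) ^ k₁ + D₂ * (h : ℝ) ^ k₂) →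
    |∑ i ∈ s, sawtooth (τ i)| ≤
      C * (N * ((D₁ / N) ^ (1 / (k₁ + 1)) + (D₂ / N) ^ (1 / (k₂ + 1)))) := by
  set c₁ := 1 / k₁ + 2 / (1 - k₁) with hc₁
  set c₂ := 1 / k₂ + 2 / (1 - k₂) with hc₂
  have hk1 : 0 < 1 - k₁ := by linarith
  have hk2 : 0 < 1 - k₂ := by linarith
  have hc₁0 : 0 < c₁ := by positivity
  have hc₂0 : 0 < c₂ := by positivity
  refine ⟨1 + c₁ + c₂, by positivity, fun s τ N D₁ D₂ hN hs hD₁ hD₂ hB => ?_⟩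
  set δ₁ := (D₁ / N) ^ (1 / (k₁ + 1)) with hδ₁
  set δ₂ := (D₂ / N) ^ (1 / (k₂ + 1)) with hδ₂
  have hδ₁0 : 0 < δ₁ := by positivity
  have hδ₂0 : 0 < δ₂ := by positivity
  -- Each δᵢ balances Dᵢδ^(-kᵢ) against Nδ. At their sum both terms are dominated by Nδ; if it
  -- exceeds 1, the trivial bound suffices.
  set δ := δ₁ + δ₂ with hδ
  have hδ0 : 0 < δ := by positivity
  rcases le_or_gt δ 1 with hδ1 | hδ1
  swap
  · have htriv : |∑ i ∈ s, sawtooth (τ i)| ≤ s.card := by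
      refine (Finset.abs_sum_le_sum_abs _ _).trans ?_
      refine (Finset.sum_le_sum fun i _ => (abs_sawtooth_le (τ i)).trans
        (by norm_num : (1 : ℝ) / 2 ≤ 1)).trans ?_
      simp
    refine htriv.trans (hs.trans ?_)
    calc N = 1 * (N * 1) := by ring
      _ ≤ (1 + c₁ + c₂) * (N * δ) := by gcongr; linarith
  have hpow : ∀ k D : ℝ, 0 < k → 0 < D → ∀ d, d = (D / N) ^ (1 / (k + 1)) → d ≤ δ →
      D * δ ^ (-k) ≤ N * δ := by
    intro k D hk hD d hd hdδ
    have hd0 : 0 < d := by rw [hd]; positivity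
    have h3 : d ^ (k + 1) = D / N := by
      rw [hd, ← Real.rpow_mul (by positivity), one_div_mul_cancel (by positivity), Real.rpow_one]
    have h4 : D = N * (d ^ k * d) := by
      rw [← Real.rpow_add_one hd0.ne', h3]; field_simp
    calc D * δ ^ (-k) ≤ D * d ^ (-k) := by
          exact mul_le_mul_of_nonneg_left
            (Real.rpow_le_rpow_of_nonpos hd0 hdδ (by linarith)) hD.le
      _ = N * d * (d ^ k * d ^ (-k)) := by rw [h4]; ring
      _ = N * d := by rw [← Real.rpow_add hd0, add_neg_cancel, Real.rpow_zero, mul_one]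
      _ ≤ N * δ := by gcongr
  have hp1 := hpow k₁ D₁ h1 hD₁ δ₁ hδ₁ (by linarith)
  have hp2 := hpow k₂ D₂ h2 hD₂ δ₂ hδ₂ (by linarith)
  have hmain := abs_sum_sawtooth_le s τ hδ0 hδ1 hB
    (c := c₁ * (D₁ * δ ^ (-k₁)) + c₂ * (D₂ * δ ^ (-k₂))) (by
      intro K
      have e1 := sum_kernel_mul_rpow_le h1 h1' hδ0 hδ1 K
      have e2 := sum_kernel_mul_rpow_le h2 h2' hδ0 hδ1 K
      have hsplit : ∑ h ∈ range K, min (1 / (h : ℝ) ^ 2) (δ / h) *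
          (D₁ * (h : ℝ) ^ k₁ + D₂ * (h : ℝ) ^ k₂) =
          D₁ * ∑ h ∈ range K, min (1 / (h : ℝ) ^ 2) (δ / h) * (h : ℝ) ^ k₁ +
          D₂ * ∑ h ∈ range K, min (1 / (h : ℝ) ^ 2) (δ / h) * (h : ℝ) ^ k₂ := by
        rw [Finset.mul_sum, Finset.mul_sum, ← Finset.sum_add_distrib]
        exact Finset.sum_congr rfl fun h _ => by ring
      rw [hsplit]
      have f1 : δ ^ (1 - k₁) = δ * δ ^ (-k₁) := by
        rw [sub_eq_add_neg, Real.rpow_add hδ0, Real.rpow_one]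
      have f2 : δ ^ (1 - k₂) = δ * δ ^ (-k₂) := by
        rw [sub_eq_add_neg, Real.rpow_add hδ0, Real.rpow_one]
      rw [f1] at e1
      rw [f2] at e2
      calc _ ≤ D₁ * (c₁ * (δ * δ ^ (-k₁))) + D₂ * (c₂ * (δ * δ ^ (-k₂))) := by gcongr
        _ = _ := by ring) (fun h => by positivity)
  refine hmain.trans ?_
  calc δ * s.card + (c₁ * (D₁ * δ ^ (-k₁)) + c₂ * (D₂ * δ ^ (-k₂)))
      ≤ δ * N + (c₁ * (N * δ) + c₂ * (N * δ)) := by gcongr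
    _ = (1 + c₁ + c₂) * (N * δ) := by ring

/-! ### Using the exponent pair hypothesis -/

theorem modelPhase_two (y : ℝ) : modelPhase y 2 = fun u => -y * (u + 0)⁻¹ := by
  funext u
  rw [modelPhase, if_neg (by norm_num), show (1 : ℝ) - 2 = -1 by norm_num, Real.rpow_neg_one,
    add_zero]
  ring

theorem iteratedDeriv_neg_mul_inv (y α : ℝ) (p : ℕ) (u : ℝ) :
    iteratedDeriv p (fun u : ℝ => -y * (u + α)⁻¹) u =
      -y * ((-1) ^ p * p.factorial) * ((u + α)⁻¹) ^ (p + 1) := by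
  rw [iteratedDeriv_const_mul_field, iteratedDeriv_comp_add_const (f := fun u : ℝ => u⁻¹),
    iteratedDeriv_eq_iterate]
  have h := iter_deriv_inv (𝕜 := ℝ) p (u + α)
  have h2 : (fun u : ℝ => u⁻¹) = Inv.inv := rfl
  simp only [h2]
  rw [h, show (-1 - (p : ℤ)) = -((p + 1 : ℕ) : ℤ) by push_cast; ring, zpow_neg, zpow_natCast,
    inv_pow]
  ring

/-- The p-th derivatives of -Y/(u+α) and of the model -Y/u have ratio (u/(u+α))^(p+1). Bernoulli's
inequality puts it within (p+1)α/(u+α) of 1, so a bounded shift is harmless once N is large. -/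
theorem isAdmissiblePhase_neg_mul_inv {Y α ε N a b : ℝ} {P : ℕ} (hα : 0 ≤ α)
    (hN : 0 < N) (hab : a < b) (ha : N ≤ a) (hb : b ≤ 2 * N)
    (hε : (P + 1) * α ≤ ε * N) :
    IsAdmissiblePhase N P Y 2 ε a b (fun u => -Y * (u + α)⁻¹) := by
  have hcd : ∀ (n : WithTop ℕ∞) (u : ℝ), u ∈ Set.Icc a b →
      ContDiffAt ℝ n (fun u : ℝ => -Y * (u + α)⁻¹) u := by
    intro n u hu
    have : u + α ≠ 0 := by linarith [hu.1]
    exact contDiffAt_const.mul ((contDiffAt_id.add contDiffAt_const).inv this)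
  refine ⟨hab, Set.Icc_subset_Icc ha hb, fun u hu => (hcd _ u hu).contDiffWithinAt, ?_⟩
  intro p _ hp u hu
  have hu0 : 0 < u := by linarith [hu.1]
  rw [iteratedDerivWithin_eq_iteratedDeriv (uniqueDiffOn_Icc hab) (hcd _ u hu) hu, modelPhase_two,
    iteratedDeriv_neg_mul_inv, iteratedDeriv_neg_mul_inv, ← mul_sub, add_zero]
  generalize -Y * ((-1) ^ p * (p.factorial : ℝ)) = c
  rw [abs_mul, abs_mul, mul_left_comm]
  refine mul_le_mul_of_nonneg_left ?_ (abs_nonneg c)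
  have h1 : (u + α)⁻¹ ^ (p + 1) ≤ u⁻¹ ^ (p + 1) := by
    gcongr
    linarith
  rw [abs_sub_comm, abs_of_nonneg (sub_nonneg.2 h1), abs_of_pos (by positivity)]
  have h2 : (u + α)⁻¹ = u⁻¹ * (u / (u + α)) := by field_simp
  have h3 : 1 - ε ≤ (u / (u + α)) ^ (p + 1) := by
    have hb := one_add_mul_le_pow (a := -(α / (u + α))) (by
      have : α / (u + α) ≤ 1 := (div_le_one (by positivity)).2 (by linarith)
      linarith) (p + 1)
    have h4 : 1 + -(α / (u + α)) = u / (u + α) := by field_simp; ring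
    rw [h4] at hb
    refine le_trans ?_ hb
    have h5 : ((p + 1 : ℕ) : ℝ) * (α / (u + α)) ≤ ε := by
      rw [mul_div_assoc', div_le_iff₀ (by positivity)]
      have hp' : (p : ℝ) ≤ P := by exact_mod_cast hp
      have hε0 : 0 ≤ ε := by
        by_contra hneg
        push Not at hneg
        have : 0 ≤ (P + 1) * α := by positivity
        nlinarith
      calc ((p + 1 : ℕ) : ℝ) * α ≤ (P + 1) * α := by push_cast; gcongr
        _ ≤ ε * N := hε
        _ ≤ ε * (u + α) := by gcongr; linarith [hu.1]
    linarith
  rw [h2, mul_pow]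
  have h6 : 0 ≤ u⁻¹ ^ (p + 1) := by positivity
  nlinarith

/-- With k = 0 the bound does not grow with y, while y can be chosen to make every phase an integer.
Then there is no cancellation at all. -/
theorem one_le_of_isExponentPair_zero {l : ℝ} (h : IsExponentPair 0 l) : 1 ≤ l := by
  obtain ⟨⟨-, -, hl, -⟩, h⟩ := h
  obtain ⟨P, hP, ε, hε, C, hC⟩ := h 2 (by norm_num)
  by_contra hlt
  push Not at hlt
  have key : ∀ M : ℕ, 1 ≤ M → (M : ℝ) ^ (1 - l) ≤ 2 * |C| := by
    intro M hM
    have hM0 : (0 : ℝ) < M := by exact_mod_cast hM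
    have hM1 : (1 : ℝ) ≤ M := by exact_mod_cast hM
    -- Every n ≤ 2M divides (2M)!, so y/n is an integer; the factor M^2 makes L = yM^(-2) equal to
    -- (2M)! ≥ 1.
    set y : ℝ := (2 * M).factorial * (M : ℝ) ^ 2 with hy
    have hfac : (1 : ℝ) ≤ (2 * M).factorial := by exact_mod_cast Nat.factorial_pos _
    have hy0 : 0 < y := by positivity
    have hadm := isAdmissiblePhase_neg_mul_inv (Y := y) (α := 0) (ε := ε) (N := M) (a := M)
      (b := 2 * M) (P := P) le_rfl hM0 (by linarith) le_rfl le_rfl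
      (by rw [mul_zero]; positivity)
    have hb := hC M y hM0 hy0 M (2 * M) _ hadm
    have hfl : ⌊(2 * (M : ℝ))⌋₊ = 2 * M := by
      rw [show (2 * (M : ℝ)) = ((2 * M : ℕ) : ℝ) by push_cast; ring, Nat.floor_natCast]
    rw [Nat.floor_natCast, hfl] at hb
    have hone : ∀ n ∈ Ioc M (2 * M), e (-y * ((n : ℝ) + 0)⁻¹) = 1 := by
      intro n hn
      rw [mem_Ioc] at hn
      obtain ⟨d, hd⟩ := Nat.dvd_factorial (by omega : 0 < n) hn.2
      have hn0 : (n : ℝ) ≠ 0 := by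
        have : n ≠ 0 := by omega
        exact_mod_cast this
      have : -y * ((n : ℝ) + 0)⁻¹ = ((-(d * M ^ 2 : ℕ) : ℤ) : ℝ) := by
        rw [hy, hd]
        push_cast
        field_simp
        ring
      rw [this, e_int]
    rw [sum_congr rfl hone, sum_const, Nat.card_Ioc, nsmul_one, Complex.norm_natCast,
      Real.rpow_zero, one_mul] at hb
    have hL : (y * (M : ℝ) ^ (-2 : ℝ))⁻¹ ≤ 1 := by
      apply inv_le_one_of_one_le₀
      rw [Real.rpow_neg hM0.le, show ((2 : ℝ)) = ((2 : ℕ) : ℝ) by norm_num, Real.rpow_natCast, hy,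
        mul_assoc, mul_inv_cancel₀ (by positivity), mul_one]
      exact hfac
    have h1l : 1 ≤ (M : ℝ) ^ l := Real.one_le_rpow hM1 (by linarith)
    have h2 : (M : ℝ) ≤ 2 * |C| * (M : ℝ) ^ l := by
      calc (M : ℝ) = ((2 * M - M : ℕ) : ℝ) := by congr 1; omega
        _ ≤ _ := hb
        _ ≤ |C| * ((M : ℝ) ^ l + (y * (M : ℝ) ^ (-2 : ℝ))⁻¹) := by
          gcongr
          exact le_abs_self C
        _ ≤ |C| * ((M : ℝ) ^ l + (M : ℝ) ^ l) := by gcongr; linarith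
        _ = _ := by ring
    rw [Real.rpow_sub hM0, Real.rpow_one, div_le_iff₀ (by positivity)]
    exact h2
  have ht := (tendsto_rpow_atTop (by linarith : 0 < 1 - l)).comp tendsto_natCast_atTop_atTop
  obtain ⟨M, hM, hM'⟩ := ((ht.eventually_gt_atTop (2 * |C|)).and
    (Filter.eventually_ge_atTop 1)).exists
  exact absurd (key M hM') (not_le.2 hM)

/-- The exponential sum bound that an exponent pair provides for shifted reciprocals. -/
theorem exists_norm_sum_e_div_le_of_isExponentPair {k l : ℝ} (h : IsExponentPair k l) :
    ∃ (C : ℝ) (J₀ : ℕ), 0 < C ∧ 2 ≤ J₀ ∧ ∀ (Y α : ℝ) (J : ℕ), J₀ ≤ J → (J : ℝ) ^ 2 ≤ 4 * Y →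
      0 ≤ α → α ≤ 2 →
      ‖∑ n ∈ Ioc (J / 2) J, e (Y / (n + α))‖ ≤ C * ((Y / (J : ℝ) ^ 2) ^ k * (J : ℝ) ^ l) := by
  obtain ⟨⟨hk0, hk1, hl0, hl1⟩, h⟩ := h
  obtain ⟨P, hP, ε, hε, C, hC⟩ := h 2 (by norm_num)
  -- With N = J/2 and α ≤ 2, admissibility requires 2(P+1) ≤ εJ/2.
  refine ⟨8 * (|C| + 1), max 2 ⌈4 * (P + 1) / ε⌉₊, by positivity, le_max_left _ _, ?_⟩
  intro Y α J hJ hJY hα hα2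
  have hJ2 : 2 ≤ J := (le_max_left _ _).trans hJ
  have hJε : 4 * (P + 1) / ε ≤ J := (Nat.le_ceil _).trans (by
    exact_mod_cast (le_max_right _ _).trans hJ)
  have hJ2' : (2 : ℝ) ≤ J := by exact_mod_cast hJ2
  have hY : 0 < Y := by nlinarith
  rw [div_le_iff₀ hε] at hJε
  have hadm := isAdmissiblePhase_neg_mul_inv (Y := Y) (α := α) (ε := ε) (N := (J : ℝ) / 2)
    (a := (J : ℝ) / 2) (b := J) (P := P) hα (by linarith) (by linarith) le_rfl (by linarith) (by
      have : (P + 1) * α ≤ (P + 1) * 2 := by gcongr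
      linarith)
  have hb := hC (J / 2) Y (by linarith) hY _ _ _ hadm
  rw [Nat.floor_natCast, Nat.floor_div_ofNat, Nat.floor_natCast] at hb
  have hsum : ‖∑ n ∈ Ioc (J / 2) J, e (-Y * ((n : ℝ) + α)⁻¹)‖ =
      ‖∑ n ∈ Ioc (J / 2) J, e (Y / (n + α))‖ := by
    rw [← norm_sum_e_neg]
    simp only [neg_mul, neg_neg, div_eq_mul_inv]
  have hL : Y * ((J : ℝ) / 2) ^ (-2 : ℝ) = 4 * (Y / (J : ℝ) ^ 2) := by
    rw [Real.rpow_neg (by positivity), show ((2 : ℝ)) = ((2 : ℕ) : ℝ) by norm_num,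
      Real.rpow_natCast]
    field_simp
    norm_num
  have hL1 : 1 ≤ 4 * (Y / (J : ℝ) ^ 2) := by
    rw [mul_div_assoc', le_div_iff₀ (by positivity)]
    linarith
  rw [hL] at hb
  refine hsum.symm.le.trans (hb.trans ?_)
  have hk4 : (4 : ℝ) ^ k ≤ 4 := by
    calc (4 : ℝ) ^ k ≤ 4 ^ (1 : ℝ) := Real.rpow_le_rpow_of_exponent_le (by norm_num) (by linarith)
      _ = 4 := Real.rpow_one _
  have hmain : (4 * (Y / (J : ℝ) ^ 2)) ^ k * ((J : ℝ) / 2) ^ l ≤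
      4 * ((Y / (J : ℝ) ^ 2) ^ k * (J : ℝ) ^ l) := by
    rw [Real.mul_rpow (by norm_num) (by positivity), mul_assoc]
    gcongr
    linarith
  -- Since J^2 ≤ 4Y, the quantity L is at least 1, and the term 1/L is absorbed by the main one.
  have hinv : (4 * (Y / (J : ℝ) ^ 2))⁻¹ ≤
      (4 * (Y / (J : ℝ) ^ 2)) ^ k * ((J : ℝ) / 2) ^ l := by
    refine (inv_le_one_of_one_le₀ hL1).trans ?_
    exact one_le_mul_of_one_le_of_one_le (Real.one_le_rpow hL1 hk0)
      (Real.one_le_rpow (by linarith) (by linarith))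
  calc _ ≤ |C| * ((4 * (Y / (J : ℝ) ^ 2)) ^ k * ((J : ℝ) / 2) ^ l +
        (4 * (Y / (J : ℝ) ^ 2))⁻¹) := by
        gcongr
        exact le_abs_self C
    _ ≤ (|C| + 1) * (4 * ((Y / (J : ℝ) ^ 2) ^ k * (J : ℝ) ^ l) +
        4 * ((Y / (J : ℝ) ^ 2) ^ k * (J : ℝ) ^ l)) := by
        gcongr
        · linarith
        · exact hinv.trans hmain
    _ = _ := by ring

/-! ### Dyadic summation and the sawtooth estimate -/

/-- Summation of dyadic block bounds; blocks below `M` are estimated trivially. -/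
theorem exists_le_of_dyadic (K : ℝ) {γ₁ γ₂ : ℝ} (hK : 0 ≤ K) (h1 : 0 < γ₁) (h2 : 0 < γ₂) :
    ∃ c : ℝ, 0 < c ∧ ∀ (S : ℕ → ℝ) (M A B : ℝ), 0 < M → 0 ≤ A → 0 ≤ B → (∀ J, S J ≤ J) →
      ∀ J : ℕ, (∀ i : ℕ, i ≤ J → M ≤ i →
        S i ≤ S (i / 2) + K * (A * (i : ℝ) ^ γ₁ + B * (i : ℝ) ^ (-γ₂))) →
      S J ≤ M + c * (A * (J : ℝ) ^ γ₁ + B * M ^ (-γ₂)) := by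
  have p1 : (1 : ℝ) < 2 ^ γ₁ := Real.one_lt_rpow (by norm_num) h1
  have p2 : (1 : ℝ) < 2 ^ γ₂ := Real.one_lt_rpow (by norm_num) h2
  have q1 : 0 < 1 - (2 ^ γ₁ : ℝ)⁻¹ := by
    have := inv_lt_one_of_one_lt₀ p1
    linarith
  -- The constant `c₁` solves c₁2^(-γ₁) + K = c₁, the fixed point of the halving recursion.
  set c₁ := K / (1 - (2 ^ γ₁ : ℝ)⁻¹) with hc₁
  set c₂ := K / (2 ^ γ₂ - 1) + K with hc₂
  have hq2 : (0 : ℝ) < 2 ^ γ₂ - 1 := by linarith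
  have hc₁0 : 0 ≤ c₁ := by positivity
  have hc₂0 : 0 ≤ c₂ := by positivity
  have r1 : c₁ * (2 ^ γ₁ : ℝ)⁻¹ + K = c₁ := by
    have : c₁ * (1 - (2 ^ γ₁ : ℝ)⁻¹) = K := by
      rw [hc₁, div_mul_cancel₀ _ q1.ne']
    linarith
  have r2 : K ≤ c₂ * (2 ^ γ₂ - 1) := by
    rw [hc₂, add_mul, div_mul_cancel₀ _ hq2.ne']
    nlinarith
  have r3 : K ≤ c₂ := by
    rw [hc₂]
    have : 0 ≤ K / (2 ^ γ₂ - 1) := by positivity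
    linarith
  refine ⟨c₁ + 2 * c₂ + 1, by positivity, ?_⟩
  intro S M A B hM hA hB htriv
  -- For the term with negative exponent the small blocks dominate; subtracting J^(-γ₂) in the claim
  -- makes the induction close, because this quantity grows by 2^γ₂ when J is halved.
  have key : ∀ J : ℕ, (∀ i : ℕ, i ≤ J → M ≤ i →
        S i ≤ S (i / 2) + K * (A * (i : ℝ) ^ γ₁ + B * (i : ℝ) ^ (-γ₂))) → M ≤ J →
      S J ≤ M + c₁ * (A * (J : ℝ) ^ γ₁) + c₂ * B * (2 * M ^ (-γ₂) - (J : ℝ) ^ (-γ₂)) := by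
    intro J
    induction J using Nat.strong_induction_on with
    | _ J ih =>
      intro hS hMJ
      have hJ0 : (0 : ℝ) < J := by linarith
      have hJ0' : 0 < J := by exact_mod_cast hJ0
      have hstep := hS J le_rfl hMJ
      have hJγ : (0 : ℝ) < (J : ℝ) ^ γ₁ := by positivity
      have hMJγ : (J : ℝ) ^ (-γ₂) ≤ M ^ (-γ₂) :=
        Real.rpow_le_rpow_of_nonpos hM hMJ (by linarith)
      rcases lt_or_ge (((J / 2 : ℕ) : ℝ)) M with hlt | hge
      · have t1 := (htriv (J / 2)).trans hlt.le
        have t2 : K * (A * (J : ℝ) ^ γ₁) ≤ c₁ * (A * (J : ℝ) ^ γ₁) := by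
          gcongr
          have : 0 ≤ c₁ * (2 ^ γ₁ : ℝ)⁻¹ := by positivity
          linarith
        have t3 : K * (B * (J : ℝ) ^ (-γ₂)) ≤ c₂ * B * (2 * M ^ (-γ₂) - (J : ℝ) ^ (-γ₂)) := by
          calc K * (B * (J : ℝ) ^ (-γ₂)) ≤ c₂ * (B * (J : ℝ) ^ (-γ₂)) := by gcongr
            _ = c₂ * B * (J : ℝ) ^ (-γ₂) := by ring
            _ ≤ _ := by gcongr; linarith
        linarith
      · have t1 := ih (J / 2) (by omega) (fun i hi => hS i (by omega)) hge
        have hhalf : ((J / 2 : ℕ) : ℝ) ≤ (J : ℝ) / 2 := Nat.cast_div_le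
        have hj20 : (0 : ℝ) < ((J / 2 : ℕ) : ℝ) := by linarith
        have t2 : ((J / 2 : ℕ) : ℝ) ^ γ₁ ≤ (J : ℝ) ^ γ₁ * (2 ^ γ₁ : ℝ)⁻¹ := by
          calc ((J / 2 : ℕ) : ℝ) ^ γ₁ ≤ ((J : ℝ) / 2) ^ γ₁ := by gcongr
            _ = _ := by rw [Real.div_rpow hJ0.le (by norm_num), div_eq_mul_inv]
        have t3 : (J : ℝ) ^ (-γ₂) * 2 ^ γ₂ ≤ ((J / 2 : ℕ) : ℝ) ^ (-γ₂) := by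
          calc (J : ℝ) ^ (-γ₂) * 2 ^ γ₂ = ((J : ℝ) / 2) ^ (-γ₂) := by
                rw [Real.div_rpow hJ0.le (by norm_num), Real.rpow_neg (by norm_num : (0 : ℝ) ≤ 2),
                  div_inv_eq_mul]
            _ ≤ _ := Real.rpow_le_rpow_of_nonpos hj20 hhalf (by linarith)
        have u1 : c₁ * (A * ((J / 2 : ℕ) : ℝ) ^ γ₁) + K * (A * (J : ℝ) ^ γ₁) ≤
            c₁ * (A * (J : ℝ) ^ γ₁) := by
          calc _ ≤ c₁ * (A * ((J : ℝ) ^ γ₁ * (2 ^ γ₁ : ℝ)⁻¹)) + K * (A * (J : ℝ) ^ γ₁) := by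
                gcongr
            _ = (c₁ * (2 ^ γ₁ : ℝ)⁻¹ + K) * (A * (J : ℝ) ^ γ₁) := by ring
            _ = _ := by rw [r1]
        have u2 : c₂ * B * (2 * M ^ (-γ₂) - ((J / 2 : ℕ) : ℝ) ^ (-γ₂)) +
            K * (B * (J : ℝ) ^ (-γ₂)) ≤ c₂ * B * (2 * M ^ (-γ₂) - (J : ℝ) ^ (-γ₂)) := by
          have v1 : K * (B * (J : ℝ) ^ (-γ₂)) ≤
              (c₂ * (2 ^ γ₂ - 1)) * (B * (J : ℝ) ^ (-γ₂)) := by gcongr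
          have v2 : c₂ * B * ((J : ℝ) ^ (-γ₂) * 2 ^ γ₂) ≤
              c₂ * B * ((J / 2 : ℕ) : ℝ) ^ (-γ₂) := by gcongr
          linarith
        linarith
  intro J hS
  have hMγ : 0 < M ^ (-γ₂) := by positivity
  have hJγ : 0 ≤ (J : ℝ) ^ γ₁ := by positivity
  have hJγ' : 0 ≤ (J : ℝ) ^ (-γ₂) := by positivity
  have a1 := mul_nonneg hA hJγ
  have a2 := mul_nonneg hB hMγ.le
  rcases lt_or_ge (J : ℝ) M with hlt | hge
  · refine ((htriv J).trans hlt.le).trans ?_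
    have : 0 ≤ (c₁ + 2 * c₂ + 1) * (A * (J : ℝ) ^ γ₁ + B * M ^ (-γ₂)) := by positivity
    linarith
  · refine (key J hS hge).trans ?_
    have b1 : c₁ * (A * (J : ℝ) ^ γ₁) ≤ (c₁ + 2 * c₂ + 1) * (A * (J : ℝ) ^ γ₁) := by
      gcongr
      linarith
    have b2 : c₂ * B * (2 * M ^ (-γ₂) - (J : ℝ) ^ (-γ₂)) ≤
        (c₁ + 2 * c₂ + 1) * (B * M ^ (-γ₂)) := by
      calc _ ≤ c₂ * B * (2 * M ^ (-γ₂)) := by gcongr; linarith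
        _ = (2 * c₂) * (B * M ^ (-γ₂)) := by ring
        _ ≤ _ := by gcongr; linarith
    linarith

theorem mul_rpow_block {k l C X J : ℝ} (hk : 0 < k) (hC : 0 < C) (hX : 0 < X) (hJ : 0 < J) :
    J * ((C * ((X / J ^ 2) ^ k * J ^ l)) / J) ^ (1 / (k + 1)) =
      C ^ (1 / (k + 1)) * (X ^ (k / (k + 1)) * J ^ ((l - k) / (k + 1))) := by
  have h1 : (C * ((X / J ^ 2) ^ k * J ^ l)) / J = C * (X ^ k * J ^ (l - 2 * k - 1)) := by
    rw [Real.div_rpow hX.le (by positivity), ← Real.rpow_natCast J 2, ← Real.rpow_mul hJ.le,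
      Real.rpow_sub hJ, Real.rpow_sub hJ, Real.rpow_one]
    push_cast
    field_simp
  rw [h1, Real.mul_rpow hC.le (by positivity), Real.mul_rpow (by positivity) (by positivity),
    ← Real.rpow_mul hX.le, ← Real.rpow_mul hJ.le]
  have h2 : J * J ^ ((l - 2 * k - 1) * (1 / (k + 1))) = J ^ ((l - k) / (k + 1)) := by
    nth_rewrite 1 [← Real.rpow_one J]
    rw [← Real.rpow_add hJ]
    congr 1
    field_simp
    ring
  rw [← h2, mul_one_div k]
  ring

theorem exists_abs_sum_sawtooth_block_le {k₁ k₂ C : ℝ} (l₁ l₂ : ℝ) (h1 : 0 < k₁) (h1' : k₁ < 1)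
    (h2 : 0 < k₂) (h2' : k₂ < 1) (hC : 0 < C) : ∃ K : ℝ, 0 < K ∧ ∀ (X α c : ℝ) (J : ℕ),
    0 < X → 0 < J → (∀ h : ℕ, 1 ≤ h → ‖∑ n ∈ Ioc (J / 2) J, e (h * X / (n + α))‖ ≤
      C * ((h * X / (J : ℝ) ^ 2) ^ k₁ * (J : ℝ) ^ l₁ +
        (h * X / (J : ℝ) ^ 2) ^ k₂ * (J : ℝ) ^ l₂)) →
    |∑ n ∈ Ioc (J / 2) J, sawtooth (X / (n + α) + c)| ≤
      K * (X ^ (k₁ / (k₁ + 1)) * (J : ℝ) ^ ((l₁ - k₁) / (k₁ + 1)) +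
        X ^ (k₂ / (k₂ + 1)) * (J : ℝ) ^ ((l₂ - k₂) / (k₂ + 1))) := by
  obtain ⟨c₀, hc₀, hc⟩ := exists_abs_sum_sawtooth_le h1 h1' h2 h2'
  refine ⟨c₀ * (C ^ (1 / (k₁ + 1)) + C ^ (1 / (k₂ + 1))), by positivity, ?_⟩
  intro X α c J hX hJ hexp
  have hJ0 : (0 : ℝ) < J := by exact_mod_cast hJ
  have hb := hc (Ioc (J / 2) J) (fun n => X / (n + α) + c) J
    (C * ((X / (J : ℝ) ^ 2) ^ k₁ * (J : ℝ) ^ l₁)) (C * ((X / (J : ℝ) ^ 2) ^ k₂ * (J : ℝ) ^ l₂))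
    hJ0 (by rw [Nat.card_Ioc]; exact_mod_cast Nat.sub_le _ _) (by positivity) (by positivity) (by
      intro h hh
      have hh0 : (0 : ℝ) < h := by exact_mod_cast hh
      -- The constant c only contributes a factor of modulus 1, so the bound is uniform in it.
      have hfac : ∑ n ∈ Ioc (J / 2) J, e (h * (X / (n + α) + c)) =
          e (h * c) * ∑ n ∈ Ioc (J / 2) J, e (h * X / (n + α)) := by
        rw [Finset.mul_sum]
        refine sum_congr rfl fun n _ => ?_
        rw [← e_add]
        congr 1
        ring
      rw [hfac, norm_mul, norm_e, one_mul]
      refine (hexp h hh).trans (le_of_eq ?_)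
      rw [mul_div_assoc, Real.mul_rpow hh0.le (by positivity), Real.mul_rpow hh0.le (by positivity)]
      ring)
  refine hb.trans ?_
  rw [mul_add (J : ℝ), mul_rpow_block h1 hC hX hJ0, mul_rpow_block h2 hC hX hJ0, mul_assoc]
  refine mul_le_mul_of_nonneg_left ?_ hc₀.le
  rw [add_mul, mul_add, mul_add]
  have t1 : 0 ≤ C ^ (1 / (k₁ + 1)) * (X ^ (k₂ / (k₂ + 1)) * (J : ℝ) ^ ((l₂ - k₂) / (k₂ + 1))) := by
    positivity
  have t2 : 0 ≤ C ^ (1 / (k₂ + 1)) * (X ^ (k₁ / (k₁ + 1)) * (J : ℝ) ^ ((l₁ - k₁) / (k₁ + 1))) := by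
    positivity
  linarith

theorem abs_sum_sawtooth_le_natCast (J : ℕ) (τ : ℕ → ℝ) : |∑ n ∈ Ioc 0 J, sawtooth (τ n)| ≤ J := by
  calc _ ≤ ∑ n ∈ Ioc 0 J, |sawtooth (τ n)| := abs_sum_le_sum_abs _ _
    _ ≤ ∑ n ∈ Ioc 0 J, (1 : ℝ) :=
      sum_le_sum fun i _ => (abs_sawtooth_le (τ i)).trans (by norm_num)
    _ = J := by simp

theorem abs_sum_sawtooth_le_half_add (J : ℕ) (τ : ℕ → ℝ) :
    |∑ n ∈ Ioc 0 J, sawtooth (τ n)| ≤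
      |∑ n ∈ Ioc 0 (J / 2), sawtooth (τ n)| + |∑ n ∈ Ioc (J / 2) J, sawtooth (τ n)| := by
  rw [← sum_Ioc_consecutive (fun n => sawtooth (τ n)) (Nat.zero_le _) (Nat.div_le_self J 2)]
  exact abs_add_le _ _

theorem natCast_le_two_mul_sqrt {J : ℕ} {X : ℝ} (h : (J : ℝ) ^ 2 ≤ 4 * X) : (J : ℝ) ≤ 2 * √X := by
  refine abs_le_of_sq_le_sq' ?_ (by positivity) |>.2
  have hX : 0 ≤ X := by nlinarith [sq_nonneg (J : ℝ)]
  rw [mul_pow, Real.sq_sqrt hX]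
  linarith

theorem rpow_mul_rpow_le {X J a b θ : ℝ} (hX : 0 < X) (hJ : 0 ≤ J) (hJX : J ≤ 2 * √X)
    (hb : 0 ≤ b) (hb1 : b ≤ 1) (hθ : a + b / 2 = θ) : X ^ a * J ^ b ≤ 2 * X ^ θ := by
  calc X ^ a * J ^ b ≤ X ^ a * (2 * √X) ^ b := by gcongr
    _ = 2 ^ b * X ^ θ := by
      rw [Real.mul_rpow (by norm_num) (by positivity), Real.sqrt_eq_rpow, ← Real.rpow_mul hX.le,
        ← hθ, Real.rpow_add hX]
      ring_nf
    _ ≤ 2 ^ (1 : ℝ) * X ^ θ := by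
      gcongr
      norm_num
    _ = _ := by rw [Real.rpow_one]

theorem exists_abs_sum_sawtooth_div_le_of_lt {k l : ℝ} (h : IsExponentPair k l) (hk : 0 < k)
    (hkl : k < l) : ∃ C : ℝ, 0 < C ∧ ∀ (X α c : ℝ) (J : ℕ), 0 < X → 0 ≤ α → α ≤ 2 →
      (J : ℝ) ^ 2 ≤ 4 * X →
      |∑ n ∈ Ioc 0 J, sawtooth (X / (n + α) + c)| ≤ C * (X ^ ((k + l) / (2 * k + 2)) + 1) := by
  have hk1 : k ≤ 1 / 2 := h.1.2.1
  have hl1 : l ≤ 1 := h.1.2.2.2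
  obtain ⟨C, J₀, hC, hJ₀, hexp⟩ := exists_norm_sum_e_div_le_of_isExponentPair h
  obtain ⟨K, hK, hblock⟩ := exists_abs_sum_sawtooth_block_le l l hk (by linarith) hk
    (by linarith) hC
  have hγ : 0 < (l - k) / (k + 1) := div_pos (by linarith) (by linarith)
  -- The two-term block bound is used with the same pair twice, hence 2K. The decreasing term is
  -- absent: it gets coefficient 0 and a dummy exponent 1.
  obtain ⟨c₀, hc₀, hdy⟩ := exists_le_of_dyadic (2 * K) (by positivity) hγ one_pos
  refine ⟨J₀ + 2 * c₀, by positivity, ?_⟩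
  intro X α c J hX hα hα2 hJX
  have hJ₀' : (0 : ℝ) < J₀ := by
    have : 0 < J₀ := by omega
    exact_mod_cast this
  have hmain := hdy (fun J => |∑ n ∈ Ioc 0 J, sawtooth (X / (n + α) + c)|) J₀ (X ^ (k / (k + 1))) 0
    hJ₀' (by positivity) le_rfl (fun J => abs_sum_sawtooth_le_natCast J _) J (by
      intro i hi hi0
      have hi0' : J₀ ≤ i := by exact_mod_cast hi0
      have hij : (i : ℝ) ≤ J := by exact_mod_cast hi
      have hiX : (i : ℝ) ^ 2 ≤ 4 * X := by
        refine le_trans ?_ hJX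
        gcongr
      refine (abs_sum_sawtooth_le_half_add i _).trans (add_le_add le_rfl ?_)
      refine (hblock X α c i hX (by omega) fun n hn => ?_).trans (le_of_eq (by ring))
      have hn1 : (1 : ℝ) ≤ n := by exact_mod_cast hn
      have := hexp (n * X) α i hi0' (by nlinarith) hα hα2
      refine this.trans ?_
      gcongr
      have : 0 ≤ (n * X / (i : ℝ) ^ 2) ^ k * (i : ℝ) ^ l := by positivity
      linarith)
  refine hmain.trans ?_
  rw [zero_mul, add_zero]
  have hp := rpow_mul_rpow_le (a := k / (k + 1)) (b := (l - k) / (k + 1))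
    (θ := (k + l) / (2 * k + 2)) hX (Nat.cast_nonneg J) (natCast_le_two_mul_sqrt hJX) hγ.le
    ((div_le_one (by linarith)).2 (by linarith)) (by field_simp; ring)
  have hXθ : 0 < X ^ ((k + l) / (2 * k + 2)) := by positivity
  calc _ ≤ J₀ + c₀ * (2 * X ^ ((k + l) / (2 * k + 2))) := by gcongr
    _ ≤ _ := by nlinarith [mul_pos hJ₀' hXθ]

/-- The pair (5/16, 9/16) gives blocks X^(5/21) J^(4/21), at most of order X^(1/3) at J = 2√X. The
extra pair (5/8, 3/8) gives X^(5/13) J^(-2/13), which is at most X^(1/3) as soon as J ≥ X^(1/3). -/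
theorem exists_abs_sum_sawtooth_div_le_third : ∃ C : ℝ, 0 < C ∧ ∀ (X α c : ℝ) (J : ℕ), 0 < X →
    0 ≤ α → α ≤ 2 → (J : ℝ) ^ 2 ≤ 4 * X →
    |∑ n ∈ Ioc 0 J, sawtooth (X / (n + α) + c)| ≤ C * (X ^ (1 / 3 : ℝ) + 1) := by
  obtain ⟨C, hC, hexp⟩ := exists_norm_sum_e_div_le
  obtain ⟨K, hK, hblock⟩ := exists_abs_sum_sawtooth_block_le (k₁ := 5 / 16) (k₂ := 5 / 8) (9 / 16)
    (3 / 8) (by norm_num) (by norm_num) (by norm_num) (by norm_num) hC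
  norm_num only at hblock
  obtain ⟨c₀, hc₀, hdy⟩ := exists_le_of_dyadic K hK.le (γ₁ := 4 / 21) (γ₂ := 2 / 13)
    (by norm_num) (by norm_num)
  refine ⟨2 + 3 * c₀, by positivity, ?_⟩
  intro X α c J hX hα hα2 hJX
  -- Blocks below X^(1/3) are estimated trivially; the 2 ensures that the exponential sum bound
  -- applies to the rest.
  set M := 2 + X ^ (1 / 3 : ℝ) with hM
  have hX3 : 0 < X ^ (1 / 3 : ℝ) := by positivity
  have hmain := hdy (fun J => |∑ n ∈ Ioc 0 J, sawtooth (X / (n + α) + c)|) M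
    (X ^ (5 / 21 : ℝ)) (X ^ (5 / 13 : ℝ))
    (by positivity) (by positivity) (by positivity) (fun J => abs_sum_sawtooth_le_natCast J _) J (by
      intro i hi hi0
      have hi0' : 2 ≤ i := by
        have : (2 : ℝ) ≤ i := by linarith
        exact_mod_cast this
      have hij : (i : ℝ) ≤ J := by exact_mod_cast hi
      have hiX : (i : ℝ) ^ 2 ≤ 4 * X := by
        refine le_trans ?_ hJX
        gcongr
      refine (abs_sum_sawtooth_le_half_add i _).trans (add_le_add le_rfl ?_)
      refine (hblock X α c i hX (by omega) fun n hn => ?_)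
      have hn1 : (1 : ℝ) ≤ n := by exact_mod_cast hn
      exact hexp (n * X) α i hi0' (by nlinarith) hα hα2)
  refine hmain.trans ?_
  have hp := rpow_mul_rpow_le (a := 5 / 21) (b := 4 / 21)
    (θ := 1 / 3) hX (Nat.cast_nonneg J) (natCast_le_two_mul_sqrt hJX) (by norm_num)
    (by norm_num) (by norm_num)
  have hq : X ^ (5 / 13 : ℝ) * M ^ (-(2 / 13) : ℝ) ≤ X ^ (1 / 3 : ℝ) := by
    calc _ ≤ X ^ (5 / 13 : ℝ) * (X ^ (1 / 3 : ℝ)) ^ (-(2 / 13) : ℝ) := by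
          refine mul_le_mul_of_nonneg_left ?_ (by positivity)
          exact Real.rpow_le_rpow_of_nonpos hX3 (by linarith) (by norm_num)
      _ = _ := by
          rw [← Real.rpow_mul hX.le, ← Real.rpow_add hX]
          norm_num
  calc _ ≤ M + c₀ * (2 * X ^ (1 / 3 : ℝ) + X ^ (1 / 3 : ℝ)) := by gcongr
    _ ≤ _ := by rw [hM]; nlinarith

/-- The sawtooth sum estimate underlying both asymptotic formulas. -/
theorem exists_abs_sum_sawtooth_div_le {k l : ℝ} (h : IsExponentPair k l) :
    ∃ C : ℝ, 0 < C ∧ ∀ (X α c : ℝ) (J : ℕ), 0 < X → 0 ≤ α → α ≤ 2 →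
      ((J : ℝ) ^ 2 ≤ 4 * X ∨ J ≤ 1) →
      |∑ n ∈ Ioc 0 J, sawtooth (X / (n + α) + c)| ≤ C * (X ^ ((k + l) / (2 * k + 2)) + 1) := by
  obtain ⟨hk0, hk1, hl0, hl1⟩ := h.1
  suffices hs : ∃ C : ℝ, 0 < C ∧ ∀ (X α c : ℝ) (J : ℕ), 0 < X → 0 ≤ α → α ≤ 2 →
      (J : ℝ) ^ 2 ≤ 4 * X →
      |∑ n ∈ Ioc 0 J, sawtooth (X / (n + α) + c)| ≤ C * (X ^ ((k + l) / (2 * k + 2)) + 1) by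
    obtain ⟨C, hC, hs⟩ := hs
    refine ⟨C + 1, by positivity, fun X α c J hX hα hα2 hJ => ?_⟩
    have hXθ : 0 < X ^ ((k + l) / (2 * k + 2)) := by positivity
    rcases hJ with hJ | hJ
    · refine (hs X α c J hX hα hα2 hJ).trans ?_
      gcongr
      linarith
    · refine (abs_sum_sawtooth_le_natCast J _).trans ?_
      have : (J : ℝ) ≤ 1 := by exact_mod_cast hJ
      nlinarith [mul_pos hC hXθ]
  rcases hk0.eq_or_lt with rfl | hk
  · have hl : l = 1 := le_antisymm hl1 (one_le_of_isExponentPair_zero h)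
    refine ⟨2, by norm_num, fun X α c J hX _ _ hJ => ?_⟩
    refine (abs_sum_sawtooth_le_natCast J _).trans ((natCast_le_two_mul_sqrt hJ).trans ?_)
    rw [Real.sqrt_eq_rpow, hl]
    norm_num
  rcases lt_or_ge k l with hlt | hge
  · exact exists_abs_sum_sawtooth_div_le_of_lt h hk hlt
  -- From k ≤ 1/2 ≤ l and l ≤ k both are 1/2; summing the blocks of this pair directly would cost a
  -- logarithm.
  · have hk2 : k = 1 / 2 := by linarith
    have hl2 : l = 1 / 2 := by linarith
    have hθ : (k + l) / (2 * k + 2) = 1 / 3 := by rw [hk2, hl2]; norm_num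
    rw [hθ]
    exact exists_abs_sum_sawtooth_div_le_third

/-! ### The hyperbola method in residue classes -/

/-- The indicator function of the reals whose integer part is congruent to `a` modulo `q`. -/
noncomputable def floorIndicator (q : ℕ) (a : ℤ) (t : ℝ) : ℝ := if ⌊t⌋ ≡ a [ZMOD q] then 1 else 0

theorem natFloor_eq_sub_sawtooth {t : ℝ} (ht : 0 ≤ t) : (⌊t⌋₊ : ℝ) = t - 1 / 2 - sawtooth t := by
  rw [natCast_floor_eq_intCast_floor ht, floor_eq_sub_sawtooth]

theorem ediv_sub_ediv_pred {q : ℤ} (hq : 0 < q) (m : ℤ) :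
    m / q - (m - 1) / q = if q ∣ m then 1 else 0 := by
  have h1 := Int.mul_ediv_add_emod m q
  have h2 := Int.emod_nonneg m hq.ne'
  have h3 := Int.emod_lt_of_pos m hq
  split_ifs with h
  · have h4 : m % q = 0 := Int.emod_eq_zero_of_dvd h
    have h5 : (m - 1) / q = m / q - 1 := by
      rw [Int.ediv_eq_iff_of_pos hq]
      constructor <;> nlinarith
    omega
  · have h4 : m % q ≠ 0 := fun h0 => h (Int.dvd_of_emod_eq_zero h0)
    have h4' : 1 ≤ m % q := by omega
    have h5 : (m - 1) / q = m / q := by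
      rw [Int.ediv_eq_iff_of_pos hq]
      constructor <;> nlinarith
    omega

theorem floorIndicator_eq {q : ℕ} (hq : 1 ≤ q) (a : ℤ) (t : ℝ) :
    floorIndicator q a t = 1 / q - sawtooth ((t - a) / q) + sawtooth ((t - a - 1) / q) := by
  have hq0 : (0 : ℝ) < q := by exact_mod_cast hq
  have h1 : floorIndicator q a t = (⌊(t - a) / q⌋ : ℝ) - ⌊(t - a - 1) / q⌋ := by
    rw [Int.floor_div_natCast, Int.floor_div_natCast, Int.floor_sub_one, Int.floor_sub_intCast,
      ← Int.cast_sub, ediv_sub_ediv_pred (by exact_mod_cast hq), floorIndicator]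
    have hiff : ⌊t⌋ ≡ a [ZMOD q] ↔ (q : ℤ) ∣ ⌊t⌋ - a := by
      rw [Int.modEq_comm]
      exact Int.modEq_iff_dvd
    simp only [hiff]
    split_ifs <;> simp
  rw [h1, floor_eq_sub_sawtooth, floor_eq_sub_sawtooth]
  field_simp
  ring

theorem abs_sum_floorIndicator_sub_le {x E : ℝ} {q : ℕ} (hq : 1 ≤ q) (a : ℤ) {B : ℕ}
    (hE : ∀ c : ℝ, |∑ n ∈ Ioc 0 B, sawtooth (x / q / (n + 0) + c)| ≤ E) :
    |∑ n ∈ Ioc 0 B, floorIndicator q a (x / n) - B / q| ≤ 2 * E := by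
  have hq0 : (0 : ℝ) < q := by exact_mod_cast hq
  have h1 : ∑ n ∈ Ioc 0 B, floorIndicator q a (x / n) - B / q =
      ∑ n ∈ Ioc 0 B, sawtooth (x / q / (n + 0) + -(a + 1) / q) -
        ∑ n ∈ Ioc 0 B, sawtooth (x / q / (n + 0) + -a / q) := by
    have h2 : ∀ n ∈ Ioc 0 B, floorIndicator q a (x / n) = 1 / q +
        (sawtooth (x / q / (n + 0) + -(a + 1) / q) - sawtooth (x / q / (n + 0) + -a / q)) := by
      intro n _
      rw [floorIndicator_eq hq, add_zero, div_right_comm x, ← add_div, ← add_div]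
      ring_nf
    rw [sum_congr rfl h2, sum_add_distrib, sum_sub_distrib, sum_const, Nat.card_Ioc, nsmul_eq_mul]
    simp only [tsub_zero]
    ring
  rw [h1]
  refine (abs_sub _ _).trans ?_
  linarith [hE (-(a + 1) / q), hE (-a / q)]

/-- Comparison with the telescoping series of 1/((m+qi)(m+q(i+1))), whose sum is 1/(qm). Each term
of the given series dominates the corresponding telescoping term and, after the first, is dominated
by the preceding one. -/
theorem summable_and_tsum_progression_bounds {m q : ℝ} (hm : 0 < m) (hq : 1 ≤ q) :
    Summable (fun i : ℕ => 1 / ((m + q * i) * (m + q * i + 1))) ∧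
    1 / (q * m) ≤ ∑' i : ℕ, 1 / ((m + q * i) * (m + q * i + 1)) ∧
    ∑' i : ℕ, 1 / ((m + q * i) * (m + q * i + 1)) ≤ 1 / (q * m) + 1 / (m * (m + 1)) := by
  have hq0 : 0 < q := by linarith
  have hpos : ∀ i : ℕ, 0 ≤ 1 / ((m + q * i) * (m + q * i + 1)) := fun i => by positivity
  have htel : ∀ n : ℕ, (1 / (m + q * n) - 1 / (m + q * (n + 1 : ℕ))) / q =
      1 / ((m + q * n) * (m + q * (n + 1 : ℕ))) := by
    intro n
    push_cast
    field_simp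
    ring
  have hup : ∀ n : ℕ, ∑ i ∈ range (n + 1), 1 / ((m + q * i) * (m + q * i + 1)) ≤
      1 / (m * (m + 1)) + (1 / m - 1 / (m + q * n)) / q := by
    intro n
    induction n with
    | zero => simp
    | succ n ih =>
      rw [sum_range_succ]
      have h1 : 1 / ((m + q * (n + 1 : ℕ)) * (m + q * (n + 1 : ℕ) + 1)) ≤
          1 / ((m + q * n) * (m + q * (n + 1 : ℕ))) := by
        refine one_div_le_one_div_of_le (by positivity) ?_
        rw [mul_comm]
        refine mul_le_mul_of_nonneg_left ?_ (by positivity)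
        push_cast
        nlinarith
      rw [← htel] at h1
      refine (add_le_add ih h1).trans (le_of_eq ?_)
      ring
  have hlow : ∀ n : ℕ, (1 / m - 1 / (m + q * n)) / q ≤
      ∑ i ∈ range n, 1 / ((m + q * i) * (m + q * i + 1)) := by
    intro n
    induction n with
    | zero => simp
    | succ n ih =>
      rw [sum_range_succ]
      have h1 : 1 / ((m + q * n) * (m + q * (n + 1 : ℕ))) ≤
          1 / ((m + q * n) * (m + q * n + 1)) := by
        refine one_div_le_one_div_of_le (by positivity) ?_
        refine mul_le_mul_of_nonneg_left ?_ (by positivity)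
        push_cast
        nlinarith
      rw [← htel] at h1
      refine le_trans (le_of_eq ?_) (add_le_add ih h1)
      ring
  have hup' : ∀ n : ℕ, ∑ i ∈ range n, 1 / ((m + q * i) * (m + q * i + 1)) ≤
      1 / (q * m) + 1 / (m * (m + 1)) := by
    intro n
    have h1 : ∑ i ∈ range n, 1 / ((m + q * i) * (m + q * i + 1)) ≤
        ∑ i ∈ range (n + 1), 1 / ((m + q * i) * (m + q * i + 1)) := by
      rw [sum_range_succ]
      linarith [hpos n]
    refine h1.trans ((hup n).trans ?_)
    have h2 : (1 / m - 1 / (m + q * n)) / q = 1 / (q * m) - 1 / (m + q * n) / q := by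
      field_simp
    have h3 : 0 ≤ 1 / (m + q * n) / q := by positivity
    linarith
  have hs := summable_of_sum_range_le hpos hup'
  refine ⟨hs, ?_, Real.tsum_le_of_sum_range_le hpos hup'⟩
  have hlim : Filter.Tendsto (fun n : ℕ => (1 / m - 1 / (m + q * n)) / q) Filter.atTop
      (nhds ((1 / m - 0) / q)) := by
    refine (Filter.Tendsto.const_sub _ ?_).div_const _
    simp only [one_div]
    refine Filter.Tendsto.inv_tendsto_atTop ?_
    exact Filter.tendsto_atTop_add_const_left _ _
      (tendsto_natCast_atTop_atTop.const_mul_atTop hq0)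
  have h4 : (1 / m - 0) / q = 1 / (q * m) := by field_simp; ring
  rw [h4] at hlim
  exact le_of_tendsto hlim (Filter.Eventually.of_forall fun n =>
    (hlow n).trans (hs.sum_le_tsum _ fun i _ => hpos i))

theorem progressionSum_eq_tsum {q r : ℕ} (hr : 1 ≤ r) (hrq : r ≤ q) :
    progressionSum q r = ∑' j : ℕ, 1 / (((r : ℝ) + q * j) * (r + q * j + 1)) := by
  have hinj : Function.Injective fun j : ℕ => r + q * j := by
    intro i j hij
    have : q * i = q * j := by simpa using hij
    exact Nat.eq_of_mul_eq_mul_left (by omega) this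
  rw [progressionSum, ← hinj.tsum_eq]
  · refine tsum_congr fun j => ?_
    rw [progressionTerm, if_pos]
    · push_cast
      rfl
    · refine ⟨by omega, ?_⟩
      push_cast
      exact (Int.modEq_iff_dvd.2 ⟨j, by ring⟩ : (r : ℤ) ≡ r + q * j [ZMOD q]).symm
  · intro n hn
    rw [Function.mem_support, progressionTerm, ne_eq, ite_eq_right_iff, Classical.not_imp] at hn
    obtain ⟨⟨hn1, hmod⟩, -⟩ := hn
    obtain ⟨d, hd⟩ := Int.modEq_iff_dvd.1 hmod.symm
    have hd0 : 0 ≤ d := by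
      by_contra hneg
      push Not at hneg
      have : (q : ℤ) * d ≤ -q := by nlinarith
      omega
    refine ⟨d.toNat, ?_⟩
    have : ((r + q * d.toNat : ℕ) : ℤ) = n := by
      push_cast
      rw [Int.toNat_of_nonneg hd0]
      linarith
    exact_mod_cast this

theorem filter_natFloor_div_eq {x : ℝ} (hx : 0 ≤ x) (B : ℕ) {m : ℕ} (hm : 1 ≤ m) :
    (Ioc B ⌊x⌋₊).filter (fun n : ℕ => ⌊x / n⌋₊ = m) =
      Ioc (max B ⌊x / (m + 1)⌋₊) ⌊x / m⌋₊ := by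
  have hm0 : (0 : ℝ) < m := by exact_mod_cast hm
  ext n
  rw [mem_filter, mem_Ioc, mem_Ioc, max_lt_iff]
  rcases Nat.eq_zero_or_pos n with rfl | hn
  · simp
  have hn0 : (0 : ℝ) < n := by exact_mod_cast hn
  rw [Nat.floor_eq_iff (by positivity), Nat.le_floor_iff (by positivity),
    Nat.le_floor_iff (by positivity), Nat.floor_lt (by positivity), le_div_iff₀ hn0,
    div_lt_iff₀ hn0, le_div_iff₀ hm0, div_lt_iff₀ (by positivity), mul_comm (m : ℝ),
    mul_comm (m + 1 : ℝ)]
  constructor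
  · rintro ⟨⟨h1, -⟩, h2, h3⟩
    exact ⟨⟨h1, h3⟩, h2⟩
  · rintro ⟨⟨h1, h3⟩, h2⟩
    refine ⟨⟨h1, ?_⟩, h2, h3⟩
    have : (1 : ℝ) ≤ m := by exact_mod_cast hm
    nlinarith

theorem floorIndicator_eq_sum {q r : ℕ} (hr : 1 ≤ r) (hrq : r ≤ q) {t : ℝ} (ht : 1 ≤ t) {J : ℕ}
    (hJ : ⌊t⌋₊ < J) :
    floorIndicator q r t = ∑ j ∈ range J, if ⌊t⌋₊ = r + q * j then (1 : ℝ) else 0 := by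
  have hfl : ⌊t⌋ = (⌊t⌋₊ : ℤ) := (Int.natCast_floor_eq_floor (by linarith)).symm
  have h1 : 1 ≤ ⌊t⌋₊ := Nat.le_floor (by exact_mod_cast ht)
  rw [floorIndicator, hfl]
  generalize ⌊t⌋₊ = m at h1 hJ
  split_ifs with h
  · obtain ⟨d, hd⟩ := Int.modEq_iff_dvd.1 h.symm
    have hd0 : 0 ≤ d := by
      by_contra hneg
      push Not at hneg
      have : (q : ℤ) * d ≤ -q := by nlinarith
      omega
    lift d to ℕ using hd0
    have hm : m = r + q * d := by zify; linarith
    have hdJ : d < J := by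
      have : d ≤ q * d := Nat.le_mul_of_pos_left d (by omega)
      omega
    rw [sum_eq_single_of_mem d (mem_range.2 hdJ), if_pos hm]
    intro j _ hj
    rw [if_neg]
    intro hm'
    have : q * j = q * d := by omega
    exact hj (Nat.eq_of_mul_eq_mul_left (by omega) this)
  · refine (sum_eq_zero fun j _ => if_neg ?_).symm
    rintro rfl
    apply h
    push_cast
    exact (Int.modEq_iff_dvd.2 ⟨j, by ring⟩ : (r : ℤ) ≡ r + q * j [ZMOD q]).symm

/-- The progression starts at j = 0 while the sawtooth estimate starts at index 1; the extra term
costs 1/2. -/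
theorem abs_sum_range_sawtooth_le {E : ℝ} {τ : ℕ → ℝ} {J : ℕ} (hE0 : 0 ≤ E)
    (hE : ∀ K, J = K + 1 → |∑ n ∈ Ioc 0 K, sawtooth (τ n)| ≤ E) :
    |∑ j ∈ range J, sawtooth (τ j)| ≤ E + 1 / 2 := by
  rcases J with _ | K
  · simp only [range_zero, sum_empty, abs_zero]
    linarith
  have h1 : ∑ j ∈ range (K + 1), sawtooth (τ j) =
      sawtooth (τ 0) + ∑ n ∈ Ioc 0 K, sawtooth (τ n) := by
    induction K with
    | zero => simp
    | succ K ih =>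
      rw [sum_range_succ, sum_Ioc_succ_top (Nat.zero_le K), ← add_assoc]
      congr 1
      clear ih hE
      induction K with
      | zero => simp
      | succ K ih => rw [sum_range_succ, ih, sum_Ioc_succ_top (Nat.zero_le K), ← add_assoc]
  rw [h1]
  refine (abs_add_le _ _).trans ?_
  linarith [hE K rfl, abs_sawtooth_le (τ 0)]

/-- Here m is the first member of the progression with B(m+1) > x. Then m + 1 > x/B ≥ B, while m
exceeds x/B by at most q, so cutting the series at m instead of x/B changes it by O(1) after
multiplication by x. -/
theorem tail_estimates {x q m B : ℝ} (hq : 1 ≤ q) (hm : 1 ≤ m) (hB : 1 ≤ B)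
    (hBx : B ^ 2 ≤ x) (h1 : x < B * (m + 1)) (h2 : B * m ≤ x + B * q) :
    x / (m * (m + 1)) ≤ 2 ∧ |x / (q * m) - B / q| ≤ 2 := by
  have hm0 : 0 < m := by linarith
  have hq0 : 0 < q := by linarith
  have hBm : B < m + 1 := by
    have : B * B < B * (m + 1) := by nlinarith
    exact lt_of_mul_lt_mul_left this (by linarith)
  constructor
  · rw [div_le_iff₀ (by positivity)]
    nlinarith
  · have h3 : x / (q * m) - B / q = (x - B * m) / (q * m) := by field_simp
    rw [h3, abs_div, abs_of_pos (by positivity : 0 < q * m), div_le_iff₀ (by positivity), abs_le]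
    have h4 : B * q ≤ 2 * (q * m) := by
      have : B ≤ 2 * m := by linarith
      nlinarith
    have h5 : B ≤ B * q := by nlinarith
    constructor <;> linarith

theorem abs_sum_floorIndicator_tail_sub_le {x E : ℝ} {q r B : ℕ} (hx : 1 ≤ x) (hr : 1 ≤ r)
    (hrq : r ≤ q) (hB : 1 ≤ B) (hBx : (B : ℝ) ^ 2 ≤ x) (hBX : x / q ≤ 4 * (B : ℝ) ^ 2)
    (hE0 : 0 ≤ E) (hE : ∀ (α : ℝ) (J : ℕ), 0 ≤ α → α ≤ 2 → (J : ℝ) ^ 2 ≤ 4 * (x / q) →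
      |∑ n ∈ Ioc 0 J, sawtooth (x / q / (n + α))| ≤ E) :
    |∑ n ∈ Ioc B ⌊x⌋₊, floorIndicator q r (x / n) - (x * progressionSum q r - B / q)|
      ≤ 2 * E + 5 := by
  have hq : 1 ≤ q := hr.trans hrq
  have hq0 : (0 : ℝ) < q := by exact_mod_cast hq
  have hq1 : (1 : ℝ) ≤ q := by exact_mod_cast hq
  have hB1 : (1 : ℝ) ≤ B := by exact_mod_cast hB
  have hB0 : (0 : ℝ) < B := by linarith
  have hr1 : (1 : ℝ) ≤ r := by exact_mod_cast hr
  have hrq' : (r : ℝ) ≤ q := by exact_mod_cast hrq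
  have hx0 : 0 < x := by linarith
  set m : ℕ → ℕ := fun j => r + q * j with hm
  have hmcast : ∀ j, (m j : ℝ) = r + q * j := fun j => by simp [hm]
  have hm1 : ∀ j, 1 ≤ m j := fun j => by simp only [hm]; omega
  have hm1' : ∀ j, (1 : ℝ) ≤ m j := fun j => by exact_mod_cast hm1 j
  have hex : ∃ j, x < B * (m j + 1) := by
    obtain ⟨j, hj⟩ := exists_nat_gt x
    refine ⟨j, ?_⟩
    have h1 : (j : ℝ) ≤ q * j := le_mul_of_one_le_left (Nat.cast_nonneg j) hq1
    have h2 : (j : ℝ) < m j + 1 := by rw [hmcast]; linarith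
    have h3 : (m j + 1 : ℝ) ≤ B * (m j + 1) := le_mul_of_one_le_left (by positivity) hB1
    linarith
  -- For j < J every n with [x/n] = m j exceeds B. At j = J the condition n > B may cut some off,
  -- leaving at most 2, and for j > J none remain.
  obtain ⟨J, hJ, hJmin⟩ : ∃ J, x < B * (m J + 1) ∧ ∀ j < J, B * ((m j : ℝ) + 1) ≤ x := by
    classical
    exact ⟨Nat.find hex, Nat.find_spec hex, fun j hj => not_lt.1 (Nat.find_min hex hj)⟩
  have hmJ : (B : ℝ) * m J ≤ x + B * q := by
    rcases J with _ | K
    · have h1 : (m 0 : ℝ) ≤ q := by rw [hmcast]; simpa using hrq'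
      have h2 : (B : ℝ) * m 0 ≤ B * q := by gcongr
      linarith
    · have h1 := hJmin K (by omega)
      have h2 : (m (K + 1) : ℝ) = m K + q := by rw [hmcast, hmcast]; push_cast; ring
      rw [h2]
      nlinarith
  obtain ⟨hsmall, hmid⟩ := tail_estimates hq1 (hm1' J) hB1 hBx hJ hmJ
  set c : ℕ → ℝ := fun j => ((Ioc B ⌊x⌋₊).filter (fun n : ℕ => ⌊x / n⌋₊ = m j)).card with hc
  have hcard : ∀ j, c j = ((⌊x / m j⌋₊ - max B ⌊x / (m j + 1)⌋₊ : ℕ) : ℝ) := fun j => by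
    rw [hc]
    dsimp only
    rw [filter_natFloor_div_eq hx0.le B (hm1 j), Nat.card_Ioc]
  have hG : ∑ n ∈ Ioc B ⌊x⌋₊, floorIndicator q r (x / n) =
      ∑ j ∈ range (J + (1 + ⌊x⌋₊)), c j := by
    have h1 : ∀ n ∈ Ioc B ⌊x⌋₊, floorIndicator q r (x / n) =
        ∑ j ∈ range (J + (1 + ⌊x⌋₊)), if ⌊x / n⌋₊ = m j then (1 : ℝ) else 0 := by
      intro n hn
      rw [mem_Ioc] at hn
      have hn1 : (1 : ℝ) ≤ n := by
        have : 1 ≤ n := by omega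
        exact_mod_cast this
      have hnx : (n : ℝ) ≤ x := (Nat.le_floor_iff hx0.le).1 hn.2
      refine floorIndicator_eq_sum hr hrq ((one_le_div (by linarith)).2 hnx) ?_
      have : ⌊x / n⌋₊ ≤ ⌊x⌋₊ := Nat.floor_le_floor (div_le_self hx0.le hn1)
      omega
    rw [sum_congr rfl h1, sum_comm]
    refine sum_congr rfl fun j _ => ?_
    rw [sum_boole]
  have hzero : ∀ i, c (J + (1 + i)) = 0 := by
    intro i
    rw [hcard, Nat.cast_eq_zero, Nat.sub_eq_zero_iff_le]
    refine le_trans (Nat.floor_le_of_le ?_) (le_max_left _ _)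
    have h1 : (m J : ℝ) + 1 ≤ m (J + (1 + i)) := by
      rw [hmcast, hmcast]
      push_cast
      have : (0 : ℝ) ≤ q * i := by positivity
      linarith
    rw [div_le_iff₀ (by linarith [hm1' (J + (1 + i))])]
    nlinarith
  have hcJ0 : 0 ≤ c J := Nat.cast_nonneg _
  have hcJ : c J ≤ 2 := by
    rw [hcard]
    rcases le_total ⌊x / m J⌋₊ (max B ⌊x / (m J + 1)⌋₊) with h | h
    · rw [Nat.sub_eq_zero_of_le h]
      norm_num
    · rw [Nat.cast_sub h]
      have h1 : (B : ℝ) ≤ (max B ⌊x / (m J + 1)⌋₊ : ℕ) := by exact_mod_cast le_max_left _ _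
      have h2 : (⌊x / m J⌋₊ : ℝ) ≤ x / m J := Nat.floor_le (by positivity)
      have h3 : x / (m J + 1) ≤ B := by
        rw [div_le_iff₀ (by positivity)]
        exact hJ.le
      have h4 : x / m J - x / (m J + 1) = x / (m J * (m J + 1)) := by
        have := hm1' J
        field_simp
        ring
      linarith
  have hpoint : ∀ j, (m j : ℝ) = q * (j + r / q) := fun j => by
    rw [hmcast]; field_simp; ring
  have hcj : ∀ j ∈ range J, c j = x * (1 / (((r : ℝ) + q * j) * (r + q * j + 1))) +
      (sawtooth (x / q / (j + (r / q + 1 / q))) - sawtooth (x / q / (j + r / q))) := by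
    intro j hj
    have h1 := hJmin j (mem_range.1 hj)
    have h2 : B ≤ ⌊x / (m j + 1)⌋₊ := by
      rw [Nat.le_floor_iff (by positivity), le_div_iff₀ (by positivity)]
      exact h1
    have hmj := hm1' j
    have h3 : ⌊x / (m j + 1)⌋₊ ≤ ⌊x / m j⌋₊ := by
      apply Nat.floor_le_floor
      gcongr
      linarith
    rw [hcard, max_eq_right h2, Nat.cast_sub h3, natFloor_eq_sub_sawtooth (by positivity),
      natFloor_eq_sub_sawtooth (by positivity)]
    have h4 : x / m j = x / q / (j + r / q) := by rw [hpoint, div_div]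
    have h5 : x / (m j + 1) = x / q / (j + (r / q + 1 / q)) := by
      rw [hpoint, div_div]
      congr 1
      field_simp
      ring
    have h6 : x / m j - x / (m j + 1) = x * (1 / (((r : ℝ) + q * j) * (r + q * j + 1))) := by
      rw [← hmcast]
      field_simp
      ring
    rw [← h6, h4, h5]
    ring
  -- From B(m K + 1) ≤ x and m K ≥ qK follows BK ≤ x/q; with B^2 ≥ (x/q)/4 this bounds K by 2√(x/q).
  have hKsq : ∀ K, J = K + 1 → (K : ℝ) ^ 2 ≤ 4 * (x / q) := by
    intro K hK
    have h1 := hJmin K (by omega)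
    rw [hmcast] at h1
    have h2 : (B : ℝ) * K ≤ x / q := by
      rw [le_div_iff₀ hq0]
      nlinarith
    have h3 : ((B : ℝ) * K) ^ 2 ≤ (x / q) ^ 2 := by gcongr
    have h4 : (x / q) ^ 2 ≤ x / q * (4 * (B : ℝ) ^ 2) := by
      rw [sq]
      gcongr
    have h5 : (B : ℝ) ^ 2 * (K : ℝ) ^ 2 ≤ (B : ℝ) ^ 2 * (4 * (x / q)) := by nlinarith
    exact le_of_mul_le_mul_left h5 (by positivity)
  have hα : (r : ℝ) / q ≤ 1 := (div_le_one hq0).2 hrq'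
  have hq' : 1 / (q : ℝ) ≤ 1 := (div_le_one hq0).2 hq1
  have hs1 := abs_sum_range_sawtooth_le (τ := fun j => x / q / (j + r / q)) (J := J) hE0
    fun K hK => hE (r / q) K (by positivity) (by linarith) (hKsq K hK)
  have hs2 := abs_sum_range_sawtooth_le (τ := fun j => x / q / (j + (r / q + 1 / q))) (J := J) hE0
    fun K hK => hE (r / q + 1 / q) K (by positivity) (by linarith) (hKsq K hK)
  obtain ⟨hsum, -, -⟩ := summable_and_tsum_progression_bounds (m := r) (q := q) (by linarith) hq1
  obtain ⟨-, ht1, ht2⟩ := summable_and_tsum_progression_bounds (m := m J) (q := q)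
    (by linarith [hm1' J]) hq1
  have hprog := hsum.sum_add_tsum_nat_add J
  have hshift : ∀ i : ℕ, 1 / (((r : ℝ) + q * (i + J : ℕ)) * (r + q * (i + J : ℕ) + 1)) =
      1 / (((m J : ℝ) + q * i) * (m J + q * i + 1)) := by
    intro i
    rw [hmcast]
    push_cast
    congr 1
    ring
  simp only [hshift] at hprog
  rw [progressionSum_eq_tsum hr hrq, ← hprog, hG, sum_range_add, sum_range_add, sum_range_one,
    sum_congr rfl hcj, sum_add_distrib, ← mul_sum, sum_sub_distrib,
    sum_eq_zero (s := range ⌊x⌋₊) fun i _ => hzero i, add_zero, add_zero]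
  set t := ∑' i : ℕ, 1 / (((m J : ℝ) + q * i) * (m J + q * i + 1))
  have ht1' : x / (q * m J) ≤ x * t := by
    rw [div_eq_mul_one_div]
    gcongr
  have ht2' : x * t ≤ x / (q * m J) + x / (m J * (m J + 1)) := by
    rw [div_eq_mul_one_div, div_eq_mul_one_div x (m J * (m J + 1) : ℝ), ← mul_add]
    gcongr
  rw [abs_le] at hs1 hs2 hmid ⊢
  constructor <;> linarith [hs1.1, hs1.2, hs2.1, hs2.2, hmid.1, hmid.2]

/-! ### The set of quotients -/

theorem abs_card_filter_modEq_sub_le {q : ℕ} (hq : 1 ≤ q) (a : ℤ) {R : ℕ} (hR : 1 ≤ R) :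
    |(((Ico (1 : ℤ) R).filter fun m : ℤ => m ≡ a [ZMOD q]).card : ℝ) - R / q| ≤ 2 := by
  have hq0 : (0 : ℚ) < q := by exact_mod_cast hq
  have hq1 : (1 : ℚ) ≤ q := by exact_mod_cast hq
  have hR1 : (1 : ℚ) ≤ R := by exact_mod_cast hR
  have h := Int.Ico_filter_modEq_card (1 : ℤ) R (by exact_mod_cast hq : (0 : ℤ) < q) a
  set u : ℚ := ((R : ℤ) - a) / ((q : ℤ) : ℚ) with hu
  set v : ℚ := (((1 : ℤ) : ℚ) - a) / ((q : ℤ) : ℚ) with hv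
  have huv : u - v = (R : ℚ) / q - 1 / q := by
    rw [hu, hv]
    push_cast
    ring
  have h1q : 0 ≤ 1 / (q : ℚ) ∧ 1 / (q : ℚ) ≤ 1 := ⟨by positivity, (div_le_one hq0).2 hq1⟩
  have hRq : 1 / (q : ℚ) ≤ (R : ℚ) / q := by gcongr
  have hmain : |(((Ico (1 : ℤ) R).filter fun m : ℤ => m ≡ a [ZMOD q]).card : ℚ) - R / q| ≤ 2 := by
    have h2 : (((Ico (1 : ℤ) R).filter fun m : ℤ => m ≡ a [ZMOD q]).card : ℚ) =
        max ((⌈u⌉ : ℚ) - ⌈v⌉) 0 := by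
      rw [← Int.cast_natCast, h]
      push_cast
      rfl
    rw [h2, abs_le]
    have a1 := Int.le_ceil u
    have a2 := Int.ceil_lt_add_one u
    have a3 := Int.le_ceil v
    have a4 := Int.ceil_lt_add_one v
    constructor
    · have := le_max_left ((⌈u⌉ : ℚ) - ⌈v⌉) 0
      linarith
    · have : max ((⌈u⌉ : ℚ) - ⌈v⌉) 0 ≤ R / q + 2 := max_le (by linarith) (by linarith)
      linarith
  have hreal : (((|(((Ico (1 : ℤ) R).filter fun m : ℤ => m ≡ a [ZMOD q]).card : ℚ) - R / q| : ℚ)) :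
      ℝ) ≤ ((2 : ℚ) : ℝ) := Rat.cast_le.2 hmain
  push_cast at hreal
  exact hreal

/-- For n < n' ≤ R one has nn' ≤ R^2 ≤ x, so x/n and x/n' differ by at least 1. -/
theorem floor_div_strictAnti {x : ℝ} {R n n' : ℕ} (hRx : (R : ℝ) ^ 2 ≤ x) (hn : 1 ≤ n)
    (hnn : n < n') (hR : n' ≤ R) : ⌊x / n'⌋ < ⌊x / n⌋ := by
  have h0 : (0 : ℝ) < n := by exact_mod_cast hn
  have h1 : (n : ℝ) + 1 ≤ n' := by exact_mod_cast hnn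
  have h2 : (n' : ℝ) ≤ R := by exact_mod_cast hR
  have h0' : (0 : ℝ) < n' := by linarith
  have h3 : x / n' + 1 ≤ x / n := by
    rw [div_add_one h0'.ne', div_le_div_iff₀ h0' h0]
    have h4 : (n : ℝ) * n' ≤ x := by nlinarith
    nlinarith
  have h5 := Int.floor_le_floor h3
  rw [Int.floor_add_one] at h5
  omega

/-- The witness is n = [x/m]. From (m+1)^2 ≤ x it follows that n ≥ m, so x < (n+1)m gives x/n < m +
1. -/
theorem exists_floor_div_eq {x : ℝ} {R m : ℕ} (hRx : (R : ℝ) ^ 2 ≤ x) (hm : 1 ≤ m)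
    (hmR : m < R) : ∃ n ∈ Icc 1 ⌊x⌋₊, ⌊x / (n : ℝ)⌋ = (m : ℤ) := by
  have hm1 : (1 : ℝ) ≤ m := by exact_mod_cast hm
  have hmR' : (m : ℝ) + 1 ≤ R := by exact_mod_cast hmR
  have hx : (m + 1 : ℝ) ^ 2 ≤ x := le_trans (by gcongr) hRx
  have hx0 : 0 < x := by nlinarith
  have h1 : (1 : ℝ) ≤ x / m := by rw [le_div_iff₀ (by linarith)]; nlinarith
  have hn1 : 1 ≤ ⌊x / m⌋₊ := Nat.le_floor (by exact_mod_cast h1)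
  have hn0 : (0 : ℝ) < ⌊x / m⌋₊ := by exact_mod_cast hn1
  refine ⟨⌊x / m⌋₊, mem_Icc.2 ⟨hn1, Nat.floor_le_floor (div_le_self hx0.le hm1)⟩, ?_⟩
  have h2 := Nat.floor_le (by linarith : 0 ≤ x / m)
  have h3 := Nat.lt_floor_add_one (x / m)
  rw [le_div_iff₀ (by linarith)] at h2
  rw [div_lt_iff₀ (by linarith)] at h3
  rw [Int.floor_eq_iff, Int.cast_natCast]
  refine ⟨by rw [le_div_iff₀ hn0]; linarith, ?_⟩
  rw [div_lt_iff₀ hn0]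
  nlinarith

theorem abs_countSet_sub_le {x : ℝ} {q : ℕ} (hq : 1 ≤ q) (a : ℤ) {R : ℕ} (hR : 1 ≤ R)
    (hRx : (R : ℝ) ^ 2 ≤ x) (hxR : x < ((R : ℝ) + 1) ^ 2) :
    |(countSet x q a : ℝ) - (R / q + ∑ n ∈ Ioc 0 R, floorIndicator q a (x / n))| ≤ 3 := by
  have hR1 : (1 : ℝ) ≤ R := by exact_mod_cast hR
  have hx0 : 0 < x := by nlinarith
  have hRfl : R ≤ ⌊x⌋₊ := Nat.le_floor (by nlinarith)
  set p : ℤ → Prop := fun m => m ≡ a [ZMOD q] with hp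
  set D := (Ico (1 : ℤ) R).filter p with hD
  set A := ((Ioc 0 R).image fun n : ℕ => ⌊x / n⌋).filter p with hA
  have hAcard : (A.card : ℝ) = ∑ n ∈ Ioc 0 R, floorIndicator q a (x / n) := by
    have hinj : Set.InjOn (fun n : ℕ => ⌊x / n⌋) (Ioc 0 R : Finset ℕ) := by
      intro n hn n' hn' heq
      rw [mem_coe, mem_Ioc] at hn hn'
      dsimp only at heq
      rcases lt_trichotomy n n' with h | h | h
      · exact absurd heq (floor_div_strictAnti hRx (by omega) h hn'.2).ne'
      · exact h
      · exact absurd heq (floor_div_strictAnti hRx (by omega) h hn.2).ne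
    rw [hA, filter_image, card_image_of_injOn (hinj.mono (by
      rw [coe_subset]; exact filter_subset _ _))]
    simp only [floorIndicator, hp]
    rw [sum_boole]
  have hge : ∀ n ∈ Ioc 0 R, (R : ℤ) ≤ ⌊x / (n : ℝ)⌋ := by
    intro n hn
    rw [mem_Ioc] at hn
    have h1 : (0 : ℝ) < n := by exact_mod_cast hn.1
    have h2 : (n : ℝ) ≤ R := by exact_mod_cast hn.2
    rw [Int.le_floor, Int.cast_natCast, le_div_iff₀ h1]
    nlinarith
  have hdisj : Disjoint D A := by
    rw [Finset.disjoint_left]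
    intro m hmD hmA
    rw [hD, mem_filter, mem_Ico] at hmD
    rw [hA, mem_filter, mem_image] at hmA
    obtain ⟨⟨n, hn, rfl⟩, -⟩ := hmA
    have := hge n hn
    omega
  have hsub : D ∪ A ⊆ (quotientSet x).filter p := by
    refine union_subset ?_ ?_
    · refine filter_subset_filter _ fun m hm => ?_
      rw [mem_Ico] at hm
      obtain ⟨n, hn, hmn⟩ := exists_floor_div_eq (m := m.toNat) hRx (by omega) (by omega)
      rw [quotientSet, mem_image]
      exact ⟨n, hn, by rw [hmn]; omega⟩
    · refine filter_subset_filter _ (image_subset_image fun n hn => ?_)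
      rw [mem_Ioc] at hn
      rw [mem_Icc]
      omega
  -- For n > R the quotient lies between 1 and R. Only the value R may fall outside both parts,
  -- which costs at most 1.
  have hsup : (quotientSet x).filter p ⊆ insert (R : ℤ) (D ∪ A) := by
    intro m hm
    rw [mem_filter, quotientSet, mem_image] at hm
    obtain ⟨⟨n, hn, rfl⟩, hpm⟩ := hm
    rw [mem_Icc] at hn
    rw [mem_insert, mem_union]
    rcases le_or_gt n R with h | h
    · exact Or.inr (Or.inr (mem_filter.2 ⟨mem_image_of_mem _ (mem_Ioc.2 ⟨hn.1, h⟩), hpm⟩))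
    · have h1 : (R : ℝ) + 1 ≤ n := by exact_mod_cast h
      have h2 : (n : ℝ) ≤ x := (Nat.le_floor_iff hx0.le).1 hn.2
      have h3 : 1 ≤ ⌊x / (n : ℝ)⌋ := by
        rw [Int.le_floor, Int.cast_one, le_div_iff₀ (by linarith)]
        linarith
      have h4 : ⌊x / (n : ℝ)⌋ < (R : ℤ) + 1 := by
        rw [Int.floor_lt]
        push_cast
        rw [div_lt_iff₀ (by linarith)]
        nlinarith
      rcases eq_or_ne ⌊x / (n : ℝ)⌋ (R : ℤ) with h5 | h5
      · exact Or.inl h5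
      · exact Or.inr (Or.inl (mem_filter.2 ⟨mem_Ico.2 ⟨h3, by omega⟩, hpm⟩))
  have hle1 := card_le_card hsub
  have hle2 := (card_le_card hsup).trans (card_insert_le _ _)
  rw [card_union_of_disjoint hdisj] at hle1 hle2
  have hcount : countSet x q a = ((quotientSet x).filter p).card := rfl
  rw [← hcount] at hle1 hle2
  have hle1' : (D.card : ℝ) + A.card ≤ countSet x q a := by exact_mod_cast hle1
  have hle2' : (countSet x q a : ℝ) ≤ D.card + A.card + 1 := by exact_mod_cast hle2
  have hDcard := abs_card_filter_modEq_sub_le hq a hR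
  rw [← hAcard]
  rw [abs_le] at hDcard ⊢
  constructor <;> linarith [hDcard.1, hDcard.2]

/-! ### Conclusion -/

theorem countMult_eq_sum (x : ℝ) (q : ℕ) (a : ℤ) :
    (countMult x q a : ℝ) = ∑ n ∈ Ioc 0 ⌊x⌋₊, floorIndicator q a (x / n) := by
  simp only [countMult, floorIndicator]
  rw [sum_boole]
  rfl

theorem floor_sqrt_bounds {x : ℝ} (hx : 1 ≤ x) :
    1 ≤ ⌊√x⌋₊ ∧ (⌊√x⌋₊ : ℝ) ^ 2 ≤ x ∧ x < ((⌊√x⌋₊ : ℝ) + 1) ^ 2 ∧ x ≤ 4 * (⌊√x⌋₊ : ℝ) ^ 2 := by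
  have hs : 1 ≤ √x := Real.one_le_sqrt.2 hx
  have h1 : 1 ≤ ⌊√x⌋₊ := Nat.le_floor (by exact_mod_cast hs)
  have h1' : (1 : ℝ) ≤ ⌊√x⌋₊ := by exact_mod_cast h1
  have h2 := Nat.floor_le (by linarith : 0 ≤ √x)
  have h3 := Nat.lt_floor_add_one √x
  have h4 := Real.sq_sqrt (by linarith : 0 ≤ x)
  refine ⟨h1, ?_, ?_, ?_⟩ <;> nlinarith

/-- Both asymptotic formulas, for a residue in the range from `1` to `q`, with a bound for the
sawtooth sums as a hypothesis. -/
theorem abs_count_sub_le {x E : ℝ} {q r : ℕ} (hx : 1 ≤ x) (hr : 1 ≤ r) (hrq : r ≤ q)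
    (hE0 : 0 ≤ E) (hE : ∀ (α c : ℝ) (J : ℕ), 0 ≤ α → α ≤ 2 →
      ((J : ℝ) ^ 2 ≤ 4 * (x / q) ∨ J ≤ 1) →
      |∑ n ∈ Ioc 0 J, sawtooth (x / q / (n + α) + c)| ≤ E) :
    |(countMult x q r : ℝ) - x * progressionSum q r| ≤ 4 * E + 5 ∧
    |(countSet x q r : ℝ) - 2 * √x / q| ≤ 6 * E + 15 := by
  have hq : 1 ≤ q := hr.trans hrq
  have hq1 : (1 : ℝ) ≤ q := by exact_mod_cast hq
  have hX0 : 0 < x / q := by positivity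
  have hXx : x / q ≤ x := div_le_self (by linarith) hq1
  have hEt : ∀ (α : ℝ) (J : ℕ), 0 ≤ α → α ≤ 2 → (J : ℝ) ^ 2 ≤ 4 * (x / q) →
      |∑ n ∈ Ioc 0 J, sawtooth (x / q / (n + α))| ≤ E := by
    intro α J h0 h2 hJ
    simpa only [add_zero] using hE α 0 J h0 h2 (Or.inl hJ)
  -- B is [√(x/q)], or 1 when x/q < 1; the latter is the reason for the alternative J ≤ 1 in the
  -- sawtooth estimate.
  obtain ⟨B, hB, hBx, hBX, hBE⟩ : ∃ B : ℕ, 1 ≤ B ∧ (B : ℝ) ^ 2 ≤ x ∧ x / q ≤ 4 * (B : ℝ) ^ 2 ∧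
      ((B : ℝ) ^ 2 ≤ 4 * (x / q) ∨ B ≤ 1) := by
    rcases le_or_gt 1 (x / q) with h | h
    · obtain ⟨h1, h2, -, h4⟩ := floor_sqrt_bounds h
      exact ⟨_, h1, h2.trans hXx, h4, Or.inl (by linarith)⟩
    · exact ⟨1, le_rfl, by simpa using hx, by norm_num; linarith, Or.inr le_rfl⟩
  obtain ⟨hR, hRx, hxR, hx4R⟩ := floor_sqrt_bounds hx
  set R := ⌊√x⌋₊ with hRdef
  have hfl : ∀ n : ℕ, 1 ≤ n → (n : ℝ) ^ 2 ≤ x → n ≤ ⌊x⌋₊ := fun n hn hnx => by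
    have : (1 : ℝ) ≤ n := by exact_mod_cast hn
    exact Nat.le_floor (by nlinarith)
  have hTB := abs_sum_floorIndicator_sub_le hq r fun c => hE 0 c B le_rfl (by norm_num) hBE
  have hGB := abs_sum_floorIndicator_tail_sub_le hx hr hrq hB hBx hBX hE0 hEt
  -- The sum over n ≤ R is not estimated directly, since R may be far larger than √(x/q). It is the
  -- head up to B plus the tail beyond B minus the tail beyond R; the series cancels and R/q
  -- remains.
  have hGR := abs_sum_floorIndicator_tail_sub_le hx hr hrq hR hRx (hXx.trans hx4R) hE0 hEt
  have hSB := sum_Ioc_consecutive (fun n : ℕ => floorIndicator q r (x / n)) (Nat.zero_le B)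
    (hfl B hB hBx)
  have hSR := sum_Ioc_consecutive (fun n : ℕ => floorIndicator q r (x / n)) (Nat.zero_le R)
    (hfl R hR hRx)
  rw [← countMult_eq_sum] at hSB hSR
  have hset := abs_countSet_sub_le hq r hR hRx hxR
  have hsqrt : |2 * √x / q - 2 * R / q| ≤ 2 := by
    have h1 := Nat.floor_le (Real.sqrt_nonneg x)
    have h2 := Nat.lt_floor_add_one √x
    rw [← sub_div, abs_div, abs_of_pos (by linarith : (0 : ℝ) < q), div_le_iff₀ (by linarith),
      abs_of_nonneg (by linarith)]
    linarith
  have h2R : 2 * (R : ℝ) / q = R / q + R / q := by ring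
  rw [h2R] at hsqrt
  rw [abs_le] at hTB hGB hGR hset hsqrt
  constructor <;> rw [abs_le] <;> constructor <;>
    linarith [hTB.1, hTB.2, hGB.1, hGB.2, hGR.1, hGR.2, hset.1, hset.2, hsqrt.1, hsqrt.2]

/-- Representatives from 1 to q, not from 0 to q - 1, so that r + qj with j ≥ 0 runs exactly over
the positive members of the class. -/
theorem exists_natCast_modEq {q : ℕ} (hq : 1 ≤ q) (a : ℤ) :
    ∃ r : ℕ, 1 ≤ r ∧ r ≤ q ∧ a ≡ r [ZMOD q] := by
  have h1 := Int.emod_nonneg (a - 1) (by omega : (q : ℤ) ≠ 0)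
  have h2 := Int.emod_lt_of_pos (a - 1) (by omega : 0 < (q : ℤ))
  refine ⟨((a - 1) % q).toNat + 1, by omega, by omega, ?_⟩
  push_cast
  rw [Int.toNat_of_nonneg h1]
  have h3 := ((Int.mod_modEq (a - 1) q).add_right 1).symm
  rwa [sub_add_cancel] at h3

theorem modEq_congr_right {q : ℕ} {a r : ℤ} (h : a ≡ r [ZMOD q]) (m : ℤ) :
    m ≡ a [ZMOD q] ↔ m ≡ r [ZMOD q] :=
  ⟨fun hm => hm.trans h, fun hm => hm.trans h.symm⟩

end FloorQuotient

theorem theorem1p1 (k l : ℝ) (hkl : FloorQuotient.IsExponentPair k l) :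
    ∃ C : ℝ, ∀ (x : ℝ) (a : ℤ) (q : ℕ), 1 ≤ x → 1 ≤ q →
      |(FloorQuotient.countMult x q a : ℝ) - x * FloorQuotient.progressionSum q a|
          ≤ C * ((x / q) ^ ((k + l) / (2 * k + 2)) + 1) ∧
      |(FloorQuotient.countSet x q a : ℝ) - 2 * Real.sqrt x / q|
          ≤ C * ((x / q) ^ ((k + l) / (2 * k + 2)) + 1) := by
  obtain ⟨C, hC, hsaw⟩ := FloorQuotient.exists_abs_sum_sawtooth_div_le hkl
  refine ⟨6 * C + 15, fun x a q hx hq => ?_⟩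
  have hq0 : (0 : ℝ) < q := by exact_mod_cast hq
  have hX : 0 < x / q := by positivity
  obtain ⟨r, hr, hrq, har⟩ := FloorQuotient.exists_natCast_modEq hq a
  have hiff := FloorQuotient.modEq_congr_right har
  have h1 : FloorQuotient.countMult x q a = FloorQuotient.countMult x q r := by
    simp only [FloorQuotient.countMult, hiff]
  have h2 : FloorQuotient.countSet x q a = FloorQuotient.countSet x q r := by
    simp only [FloorQuotient.countSet, hiff]
  have h3 : FloorQuotient.progressionSum q a = FloorQuotient.progressionSum q r := by
    unfold FloorQuotient.progressionSum FloorQuotient.progressionTerm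
    simp only [hiff]
  rw [h1, h2, h3]
  have hpos : 0 < (x / q) ^ ((k + l) / (2 * k + 2)) := by positivity
  have hE := FloorQuotient.abs_count_sub_le hx hr hrq (by positivity)
    fun α c J h0 h2 hJ => hsaw (x / q) α c J hX h0 h2 hJ
  have hCp := mul_pos hC hpos
  exact ⟨hE.1.trans (by linarith), hE.2.trans (by linarith)⟩
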